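/- Let $k \ge 2$ be a fixed integer. For $n \ge k+1$ let $N = \binom n2$, let $e_1, \dots, e_N$ be a uniformly random ordering of the edges of the complete graph on $[n]=\{1,\dots,n\}$, and, for $0 \le m \le N$, let $\mathcal G(n,m)$ be the graph on $[n]$ with edge set $\{e_1,\dots,e_m\}$. Independently of the ordering and of each other, the edges $e$ choose colour sets $c(e)$, each uniformly distributed over all $k$-element subsets of a set $W$ of $n-1$ colours. A rainbow spanning tree of $\mathcal G(n,m)$ is a spanning tree of $\mathcal G(n,m)$ together with a choice, for each of its edges $e$, of one colour from $c(e)$ such that the chosen colours are pairwise different. Let $m_{\mathcal C}$, $m_{\mathcal N}$ and $m_{\mathcal R}$ be the smallest $m \in \{0,\dots,N\}$ (if there is one) such that, respectively, $\mathcal G(n,m)$ is connected; every colour of $W$ belongs to $c(e_i)$ for some $i \le m$; $\mathcal G(n,m)$ has a rainbow spanning tree. Then, with probability tending to $1$ as $n \to \infty$, the three times $m_{\mathcal R}$, $m_{\mathcal C}$, $m_{\mathcal N}$ are all defined and $$m_{\mathcal R} = \max\{m_{\mathcal C}, m_{\mathcal N}\}.$$ -/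

import Mathlib

open Filter Topology MeasureTheory ProbabilityTheory

/-- The edges of the complete graph `K_n` on the vertex set `Fin n`. -/
abbrev KEdge (n : ℕ) : Type := ((⊤ : SimpleGraph (Fin n)).edgeSet : Set (Sym2 (Fin n)))

/-- The orderings `e_1, …, e_N` of all edges of `K_n`, where `N = n.choose 2`
(indexed from `0`, so that the edge `e_i` is the value at `i - 1`). -/
def EdgeOrder (n : ℕ) : Type := Fin (n.choose 2) ≃ KEdge n

/-- The `k`-element subsets of the colour set `W`, which is `Fin (n - 1)`. -/
def ColourSet (n k : ℕ) : Type := {S : Finset (Fin (n - 1)) // S.card = k}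

instance (n : ℕ) : MeasurableSpace (EdgeOrder n) := ⊤

instance (n k : ℕ) : MeasurableSpace (ColourSet n k) := ⊤

/-- An outcome: an ordering of the edges of `K_n`, and a set of `k` colours for every edge. -/
abbrev Outcome (n k : ℕ) : Type := EdgeOrder n × (KEdge n → ColourSet n k)

/-- The law of the coloured graph process: the ordering of the edges is uniformly random, the
colour sets of the edges are uniformly random, and all these choices are independent. It is a
probability measure as soon as there are at least `k` colours. -/
noncomputable def processLaw (n k : ℕ) : Measure (Outcome n k) :=
  (uniformOn (Set.univ : Set (EdgeOrder n))).prod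
    (Measure.pi fun _ : KEdge n => uniformOn (Set.univ : Set (ColourSet n k)))

namespace Outcome

variable {n k : ℕ}

/-- The set `E_m` of the first `m` edges. -/
def edges (ω : Outcome n k) (m : ℕ) : Set (KEdge n) :=
  {e | ∃ i : Fin (n.choose 2), (i : ℕ) < m ∧ ω.1.toFun i = e}

/-- The set `c(e)` of the colours chosen by the edge `e`. -/
def colours (ω : Outcome n k) (e : KEdge n) : Finset (Fin (n - 1)) := (ω.2 e).val

/-- The graph `𝒢(n, m)`, with the first `m` edges. -/
def graph (ω : Outcome n k) (m : ℕ) : SimpleGraph (Fin n) :=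
  SimpleGraph.fromEdgeSet (Subtype.val '' ω.edges m)

/-- `𝒢(n, m)` is connected. -/
def IsConn (ω : Outcome n k) (m : ℕ) : Prop := (ω.graph m).Connected

/-- `𝒢(n, m)` contains edges in every colour. -/
def AllColours (ω : Outcome n k) (m : ℕ) : Prop :=
  ∀ w : Fin (n - 1), ∃ e ∈ ω.edges m, w ∈ ω.colours e

/-- `𝒢(n, m)` has a rainbow spanning tree: a spanning tree whose edges can be given pairwise
different colours, each edge `e` receiving a colour from its own set `c(e)`. -/
def HasRainbowTree (ω : Outcome n k) (m : ℕ) : Prop :=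
  ∃ T : SimpleGraph (Fin n), T ≤ ω.graph m ∧ T.IsTree ∧
    ∃ f : KEdge n → Fin (n - 1),
      Set.InjOn f {e | (e : Sym2 (Fin n)) ∈ T.edgeSet} ∧
      ∀ e : KEdge n, (e : Sym2 (Fin n)) ∈ T.edgeSet → f e ∈ ω.colours e

end Outcome

/-- The first time `m ∈ {0, …, n.choose 2}` at which `E m` occurs exists and is equal to `t`. -/
def IsFirstTime (n : ℕ) (E : ℕ → Prop) (t : ℕ) : Prop :=
  IsLeast {m : ℕ | m ≤ n.choose 2 ∧ E m} t

/-! A spanning tree with its n - 1 edges coloured differently uses all n - 1 colours. So a rainbow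
spanning tree forces connectivity and the presence of every colour, and m_R ≥ max(m_C, m_N) holds
deterministically. For the converse, apply Rado's theorem to the graphic matroid: a rainbow spanning
tree exists as soon as, for every set `I` of colours, the edges with a colour in `I` have rank at
least |I|, that is, they leave at most n - |I| components (`exists_transversal_of_submodular`,
`hasRainbowTree_of_numComps`). It remains to show that, with high probability, no `I` violates this
condition at time max(m_C, m_N).

This random time lies with high probability between `earlyTime`, about n(log n - (log log n)/2)/2,
when isolated vertices still exist (second moment), and `lateTime`, about 3n log n, when the graph
is connected and all colours are present (first moment). The bad events cover all times of the
window at once: edges that have to be present are required only by the late time, and edges that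
have to be absent only at the early time. `processLaw_real_le` bounds the probability of such an
event, and union bounds do the rest (`hasRainbowTree_of_good` makes the reduction). A violating `I`
of least size is treated according to i = |I| and j = n - 1 - i, with the threshold b = n/√(log n).

If i ≤ b, minimality makes the edges coloured from `I` very compact: they have rank i - 1, and they
lie inside a set of at most (3(i - 1) + d)/2 vertices, where d edges of a spanning forest have two
colours in `I` (`exists_sparse_witness`). The case i = 1 is excluded because all colours are
present.

If j ≤ b, connectivity gives a cut crossed by j + 1 edges none of which has a colour in `I`
(`exists_large_cut`). Each of them has all its k ≥ 2 colours among j, at a cost of (j/(n - 1))². For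
j = 0 this is impossible.

If both i and j exceed b, half of the components form a cut that no edge with a colour in `I`
crosses (`exists_balanced_cut`); this is so unlikely that it survives a union bound over 4^n pairs.

The term (log log n)/2 in the early time is a compromise: about √(log n) isolated vertices are
expected, enough for them to exist, while in the range j ≤ b a cut pays only a factor √(log n), up
to constants, for each vertex of a small side. -/

/-! ### Orderings in which given elements come early or late -/

section OrderCounting

open Finset

variable {α : Type*} [Fintype α] [DecidableEq α] {N : ℕ}

/-- The orderings in which every element of `S` has an admissible position. -/
noncomputable def constrainedOrders (S : Finset α) (A : α → Fin N → Prop) : Finset (Fin N ≃ α) := by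
  classical exact univ.filter fun σ => ∀ e ∈ S, A e (σ.symm e)

lemma mem_constrainedOrders {S : Finset α} {A : α → Fin N → Prop} {σ : Fin N ≃ α} :
    σ ∈ constrainedOrders S A ↔ ∀ e ∈ S, A e (σ.symm e) := by
  simp [constrainedOrders]

open Classical in
/-- Double counting along the transpositions `(x y)`, `y ∉ S`. -/
lemma card_constrainedOrders_insert (S : Finset α) (A : α → Fin N → Prop) {x : α} (hx : x ∉ S) :
    #(constrainedOrders (insert x S) A) * #(Sᶜ) =
      ∑ σ ∈ constrainedOrders S A, #{y ∈ Sᶜ | A x (σ.symm y)} := by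
  have key : ∀ y ∈ Sᶜ, #(constrainedOrders (insert x S) A) =
      #{σ ∈ constrainedOrders S A | A x (σ.symm y)} := by
    intro y hy
    rw [mem_compl] at hy
    have hfix : ∀ e ∈ S, Equiv.swap x y e = e := fun e he =>
      Equiv.swap_apply_of_ne_of_ne (fun h => hx (h ▸ he)) (fun h => hy (h ▸ he))
    refine card_bij' (fun σ _ => σ.trans (Equiv.swap x y)) (fun σ _ => σ.trans (Equiv.swap x y))
      ?_ ?_ ?_ ?_
    · intro σ hσ
      rw [mem_constrainedOrders] at hσ
      simp only [mem_filter, mem_constrainedOrders, Equiv.symm_trans_apply, Equiv.symm_swap,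
        Equiv.swap_apply_right]
      refine ⟨fun e he => ?_, hσ x (mem_insert_self _ _)⟩
      rw [hfix e he]; exact hσ e (mem_insert_of_mem he)
    · intro σ hσ
      simp only [mem_filter, mem_constrainedOrders] at hσ
      simp only [mem_constrainedOrders, Equiv.symm_trans_apply, Equiv.symm_swap, mem_insert]
      rintro e (rfl | he)
      · simpa using hσ.2
      · rw [hfix e he]; exact hσ.1 e he
    · intro σ _; ext t; simp
    · intro σ _; ext t; simp
  calc #(constrainedOrders (insert x S) A) * #(Sᶜ)
      = ∑ y ∈ Sᶜ, #(constrainedOrders (insert x S) A) := by rw [sum_const, smul_eq_mul, mul_comm]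
    _ = ∑ y ∈ Sᶜ, #{σ ∈ constrainedOrders S A | A x (σ.symm y)} := sum_congr rfl key
    _ = _ := by
      simp only [card_filter]
      exact sum_comm

lemma card_compl_filter_position_lt (σ : Fin N ≃ α) (Q : Finset α) (m : ℕ) (hm : m ≤ N)
    (hQ : ∀ e ∈ Q, m ≤ (σ.symm e : ℕ)) :
    #{y ∈ Qᶜ | m ≤ (σ.symm y : ℕ)} = N - m - #Q := by
  have h1 : #{y : α | m ≤ (σ.symm y : ℕ)} = N - m := by
    have : #{y : α | m ≤ (σ.symm y : ℕ)} = #{i : Fin N | m ≤ (i : ℕ)} := by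
      refine card_bij (fun y _ => σ.symm y) (by simp) (by simp) ?_
      intro b hb; exact ⟨σ b, by simpa using hb, by simp⟩
    rw [this]
    have h2 := card_filter_add_card_filter_not (s := (univ : Finset (Fin N))) (fun i => (i : ℕ) < m)
    have h3 : #{i : Fin N | (i : ℕ) < m} = m := by
      rw [Fin.card_filter_val_lt]; omega
    simp only [not_lt, card_univ, Fintype.card_fin] at h2
    omega
  have h2 : ({y ∈ Qᶜ | m ≤ (σ.symm y : ℕ)} : Finset α) =
      ({y : α | m ≤ (σ.symm y : ℕ)} : Finset α) \ Q := by
    ext y; simp [and_comm]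
  rw [h2, card_sdiff_of_subset, h1]
  intro e he; simpa using hQ e he

lemma card_compl_filter_position_le (σ : Fin N ≃ α) (S : Finset α) (m : ℕ) :
    #{y ∈ Sᶜ | (σ.symm y : ℕ) < m} ≤ m := by
  calc #{y ∈ Sᶜ | (σ.symm y : ℕ) < m} ≤ #(range m) := by
        refine card_le_card_of_injOn (fun y => (σ.symm y : ℕ)) ?_ ?_
        · intro y hy; simp at hy; simpa using hy.2
        · intro y _ z _ h; simpa [Fin.val_inj] using h
    _ = m := card_range m

/-- All of `T` comes before time `m₁`, none of `Q` before time `m₀`. -/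
def TimeConstraint (T : Finset α) (m₀ m₁ : ℕ) (e : α) (i : Fin N) : Prop :=
  (e ∈ T → (i : ℕ) < m₁) ∧ (e ∉ T → m₀ ≤ (i : ℕ))

/-- Each new element multiplies the count by at most (m₁ - t)/(N - t) ≤ m₁/N. The constraint refers
to the fixed set `T₀` while the induction runs over its subsets, so the constraint stays the same
throughout. -/
lemma card_constrainedOrders_early (hN : Fintype.card α = N) (T₀ : Finset α) (m₀ m₁ : ℕ)
    (hm : m₁ ≤ N) (T : Finset α) (hT : T ⊆ T₀) :
    (#(constrainedOrders T (TimeConstraint (N := N) T₀ m₀ m₁)) : ℝ) ≤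
      N.factorial * ((m₁ : ℝ) / N) ^ #T := by
  induction T using Finset.induction_on with
  | empty =>
    have : #(constrainedOrders (∅ : Finset α) (TimeConstraint (N := N) T₀ m₀ m₁)) ≤
        N.factorial := by
      refine (card_le_univ _).trans ?_
      rw [Fintype.card_equiv (Fintype.equivFinOfCardEq hN).symm, Fintype.card_fin]
    simpa using this
  | insert x T hx ih =>
    have ih := ih ((subset_insert _ _).trans hT)
    classical
    have h := card_constrainedOrders_insert T (TimeConstraint (N := N) T₀ m₀ m₁) hx
    have hc : #(Tᶜ) = N - #T := by rw [card_compl, hN]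
    have hlt : #T < N := by
      rw [← hN, ← card_univ]; exact card_lt_card (ssubset_univ_iff.2 fun h => hx (h ▸ mem_univ x))
    have hbound : ∀ σ ∈ constrainedOrders T (TimeConstraint (N := N) T₀ m₀ m₁),
        #{y ∈ Tᶜ | TimeConstraint (N := N) T₀ m₀ m₁ x (σ.symm y)} ≤ m₁ - #T := by
      intro σ hσ
      rw [mem_constrainedOrders] at hσ
      have hx0 : x ∈ T₀ := hT (mem_insert_self _ _)
      have h1 : ∀ e ∈ T, (σ.symm e : ℕ) < m₁ := fun e he =>
        (hσ e he).1 (hT (mem_insert_of_mem he))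
      have h2 : #{y ∈ Tᶜ | (σ.symm y : ℕ) < m₁} + #T ≤ m₁ := by
        have h3 := card_compl_filter_position_le σ (∅ : Finset α) m₁
        rw [← card_union_of_disjoint]
        · refine (card_le_card ?_).trans h3
          intro y hy
          simp only [mem_union, mem_filter, mem_compl] at hy
          rcases hy with hy | hy
          · simpa using hy.2
          · simpa using h1 y hy
        · rw [disjoint_left]; intro y hy; simp at hy; exact hy.1
      have h3 : ({y ∈ Tᶜ | TimeConstraint (N := N) T₀ m₀ m₁ x (σ.symm y)} : Finset α) ⊆
          {y ∈ Tᶜ | (σ.symm y : ℕ) < m₁} := by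
        intro y hy
        simp only [mem_filter, mem_compl] at hy ⊢
        exact ⟨hy.1, hy.2.1 hx0⟩
      have := card_le_card h3
      omega
    have h' : #(constrainedOrders (insert x T) (TimeConstraint (N := N) T₀ m₀ m₁)) * (N - #T) ≤
        #(constrainedOrders T (TimeConstraint (N := N) T₀ m₀ m₁)) * (m₁ - #T) := by
      rw [← hc, h, ← smul_eq_mul, ← sum_const]
      exact sum_le_sum hbound
    have hpos : (0 : ℝ) < (N - #T : ℕ) := by exact_mod_cast Nat.sub_pos_of_lt hlt
    have hNpos : (0 : ℝ) < N := by exact_mod_cast (by omega : 0 < N)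
    have hratio : ((m₁ - #T : ℕ) : ℝ) ≤ (m₁ : ℝ) / N * (N - #T : ℕ) := by
      rcases le_or_gt #T m₁ with hle | hgt
      · rw [Nat.cast_sub hle, Nat.cast_sub hlt.le, div_mul_eq_mul_div, le_div_iff₀ hNpos]
        have : (m₁ : ℝ) ≤ N := by exact_mod_cast hm
        nlinarith [(Nat.cast_nonneg #T : (0 : ℝ) ≤ #T)]
      · rw [Nat.sub_eq_zero_of_le hgt.le]; simp only [Nat.cast_zero]; positivity
    have h'' : (#(constrainedOrders (insert x T) (TimeConstraint (N := N) T₀ m₀ m₁)) : ℝ) *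
        (N - #T : ℕ) ≤ #(constrainedOrders T (TimeConstraint (N := N) T₀ m₀ m₁)) *
        ((m₁ : ℝ) / N * (N - #T : ℕ)) :=
      (by exact_mod_cast h' : (#(constrainedOrders (insert x T)
        (TimeConstraint (N := N) T₀ m₀ m₁)) : ℝ) * (N - #T : ℕ) ≤
        #(constrainedOrders T (TimeConstraint (N := N) T₀ m₀ m₁)) * (m₁ - #T : ℕ)).trans
        (mul_le_mul_of_nonneg_left hratio (Nat.cast_nonneg _))
    rw [← mul_assoc] at h''
    have h3 := le_of_mul_le_mul_right h'' hpos
    rw [card_insert_of_notMem hx, pow_succ, ← mul_assoc]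
    exact h3.trans (mul_le_mul_of_nonneg_right ih (by positivity))

/-- The number of orderings in which `T` comes early and `Q` comes late. -/
lemma card_constrainedOrders_early_late (hN : Fintype.card α = N) (T Q : Finset α)
    (hTQ : Disjoint T Q) (m₀ m₁ : ℕ) (ht : #T ≤ m₀) (hm0 : m₀ ≤ N) (hm : m₁ ≤ N) :
    (#(constrainedOrders (Q ∪ T) (TimeConstraint (N := N) T m₀ m₁)) : ℝ) ≤
      N.factorial * ((m₁ : ℝ) / N) ^ #T * Real.exp (-(((m₀ : ℝ) - #T) / N) * #Q) := by
  induction Q using Finset.induction_on with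
  | empty => simpa using card_constrainedOrders_early hN T m₀ m₁ hm T subset_rfl
  | insert x Q hx ih =>
    rw [disjoint_insert_right] at hTQ
    have ih := ih hTQ.2
    classical
    have hxS : x ∉ Q ∪ T := by simp [hx, hTQ.1]
    have h := card_constrainedOrders_insert (Q ∪ T) (TimeConstraint (N := N) T m₀ m₁) hxS
    have hcard : #(Q ∪ T) = #Q + #T := card_union_of_disjoint hTQ.2.symm
    have hlt : #Q + #T < N := by
      rw [← hN, ← card_univ, ← hcard]
      exact card_lt_card (ssubset_univ_iff.2 fun h => hxS (h ▸ mem_univ x))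
    have hc : #((Q ∪ T)ᶜ) = N - (#Q + #T) := by rw [card_compl, hN, hcard]
    have hbound : ∀ σ ∈ constrainedOrders (Q ∪ T) (TimeConstraint (N := N) T m₀ m₁),
        #{y ∈ (Q ∪ T)ᶜ | TimeConstraint (N := N) T m₀ m₁ x (σ.symm y)} ≤ N - m₀ - #Q := by
      intro σ hσ
      rw [mem_constrainedOrders] at hσ
      have h1 : ∀ e ∈ Q, m₀ ≤ (σ.symm e : ℕ) := fun e he =>
        (hσ e (mem_union_left _ he)).2 fun h => (disjoint_left.1 hTQ.2 h he)
      rw [← card_compl_filter_position_lt σ Q m₀ hm0 h1]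
      refine card_le_card ?_
      intro y hy
      simp only [mem_filter, mem_compl, mem_union, not_or] at hy ⊢
      exact ⟨hy.1.1, hy.2.2 hTQ.1⟩
    have h' : #(constrainedOrders (insert x (Q ∪ T)) (TimeConstraint (N := N) T m₀ m₁)) *
        (N - (#Q + #T)) ≤
        #(constrainedOrders (Q ∪ T) (TimeConstraint (N := N) T m₀ m₁)) * (N - m₀ - #Q) := by
      rw [← hc, h, ← smul_eq_mul, ← sum_const]
      exact sum_le_sum hbound
    have hpos : (0 : ℝ) < (N - (#Q + #T) : ℕ) := by exact_mod_cast Nat.sub_pos_of_lt hlt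
    have hNpos : (0 : ℝ) < N := by exact_mod_cast (by omega : 0 < N)
    set a : ℝ := ((m₀ : ℝ) - #T) / N with ha
    have ht' : (#T : ℝ) ≤ m₀ := by exact_mod_cast ht
    have ha0 : 0 ≤ a := div_nonneg (by linarith) hNpos.le
    -- With q = #Q and t = #T ≤ m₀, the ratio (N - m₀ - q)/(N - q - t) equals 1 - (m₀ - t)/(N - q -
    -- t), which is at most 1 - a. If m₀ + q > N, the truncated left side is 0.
    have hratio : ((N - m₀ - #Q : ℕ) : ℝ) ≤ Real.exp (-a) * (N - (#Q + #T) : ℕ) := by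
      have hE := Real.add_one_le_exp (-a)
      refine le_trans ?_ (mul_le_mul_of_nonneg_right hE hpos.le)
      rw [Nat.cast_sub hlt.le]
      rcases le_or_gt (m₀ + #Q) N with hle | hgt
      · rw [Nat.sub_sub, Nat.cast_sub hle]
        push_cast
        have haN : a * N = m₀ - #T := by rw [ha]; field_simp
        nlinarith [mul_nonneg ha0 (by positivity : (0 : ℝ) ≤ (#Q : ℝ) + #T)]
      · rw [Nat.sub_sub, Nat.sub_eq_zero_of_le hgt.le]
        have : a ≤ 1 := by
          rw [ha, div_le_one hNpos]
          have : (m₀ : ℝ) ≤ N := by exact_mod_cast hm0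
          linarith [(Nat.cast_nonneg #T : (0 : ℝ) ≤ #T)]
        have h2 : ((#Q + #T : ℕ) : ℝ) ≤ N := by exact_mod_cast hlt.le
        simp only [Nat.cast_zero]
        exact mul_nonneg (by linarith) (by linarith)
    have h'' : (#(constrainedOrders (insert x (Q ∪ T)) (TimeConstraint (N := N) T m₀ m₁)) : ℝ) *
        (N - (#Q + #T) : ℕ) ≤ #(constrainedOrders (Q ∪ T) (TimeConstraint (N := N) T m₀ m₁)) *
        (Real.exp (-a) * (N - (#Q + #T) : ℕ)) :=
      (by exact_mod_cast h' : (#(constrainedOrders (insert x (Q ∪ T))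
        (TimeConstraint (N := N) T m₀ m₁)) : ℝ) * (N - (#Q + #T) : ℕ) ≤
        #(constrainedOrders (Q ∪ T) (TimeConstraint (N := N) T m₀ m₁)) * (N - m₀ - #Q : ℕ)).trans
        (mul_le_mul_of_nonneg_left hratio (Nat.cast_nonneg _))
    rw [← mul_assoc] at h''
    have h3 := le_of_mul_le_mul_right h'' hpos
    rw [insert_union, card_insert_of_notMem hx]
    refine h3.trans ?_
    have h4 : Real.exp (-a * ((#Q + 1 : ℕ) : ℝ)) = Real.exp (-a * #Q) * Real.exp (-a) := by
      rw [← Real.exp_add]; congr 1; push_cast; ring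
    rw [h4, ← mul_assoc]
    exact mul_le_mul_of_nonneg_right ih (Real.exp_pos _).le

/-- The proportion of orderings in which a given set of `q` elements avoids the first `m` places. -/
noncomputable def avoidProb (N m q : ℕ) : ℝ :=
  ∏ s ∈ range q, ((N : ℝ) - m - s) / ((N : ℝ) - s)

open Classical in
-- Exactly N - m - #Q of the N - #Q elements outside `Q` are late, so the double count is an
-- equality here. The second moment argument needs the exact first moment, for which an upper bound
-- would not do.
lemma card_avoiding_orders (hN : Fintype.card α = N) (Q : Finset α) (m : ℕ) (hm : m ≤ N)
    (hq : #Q + m ≤ N) :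
    (#{σ : Fin N ≃ α | ∀ e ∈ Q, m ≤ (σ.symm e : ℕ)} : ℝ) = N.factorial * avoidProb N m #Q := by
  have h0 : ∀ Q : Finset α, ({σ : Fin N ≃ α | ∀ e ∈ Q, m ≤ (σ.symm e : ℕ)} : Finset _) =
      constrainedOrders Q (fun _ i => m ≤ (i : ℕ)) := by
    intro Q; ext σ; simp [mem_constrainedOrders]
  rw [h0]
  induction Q using Finset.induction_on with
  | empty =>
    simp only [avoidProb, card_empty, range_zero, prod_empty, mul_one]
    have : constrainedOrders (∅ : Finset α) (fun _ (i : Fin N) => m ≤ (i : ℕ)) = univ := by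
      ext σ; simp [mem_constrainedOrders]
    rw [this, card_univ, Fintype.card_equiv (Fintype.equivFinOfCardEq hN).symm, Fintype.card_fin]
  | insert x Q hx ih =>
    have h := card_constrainedOrders_insert Q (fun _ (i : Fin N) => m ≤ (i : ℕ)) hx
    rw [card_insert_of_notMem hx] at hq ⊢
    have ih := ih (by omega)
    have hlt : #Q < N := by
      rw [← hN, ← card_univ]; exact card_lt_card (ssubset_univ_iff.2 fun h => hx (h ▸ mem_univ x))
    rw [card_compl, hN, sum_congr rfl (g := fun _ => N - m - #Q), sum_const, smul_eq_mul] at h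
    · have h' : (#(constrainedOrders (insert x Q) (fun _ (i : Fin N) => m ≤ (i : ℕ))) : ℝ) *
          (N - #Q) = #(constrainedOrders Q (fun _ (i : Fin N) => m ≤ (i : ℕ))) *
          (N - m - #Q) := by
        have h2 : ((N - m - #Q : ℕ) : ℝ) = (N : ℝ) - m - #Q := by
          rw [Nat.sub_sub, Nat.cast_sub (by omega)]; push_cast; ring
        rw [← h2, ← Nat.cast_sub hlt.le]
        exact_mod_cast h
      have hpos : (0 : ℝ) < (N : ℝ) - #Q := by
        have : (#Q : ℝ) < N := by exact_mod_cast hlt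
        linarith
      rw [avoidProb, prod_range_succ, ← avoidProb, ← mul_assoc, ← ih, mul_div_assoc',
        eq_div_iff hpos.ne', h']
    · intro σ hσ
      rw [mem_constrainedOrders] at hσ
      convert card_compl_filter_position_lt σ Q m hm hσ

end OrderCounting

/-! ### The law of the process and the main probability estimate -/

section Law

open Finset

noncomputable instance (n : ℕ) : Fintype (EdgeOrder n) :=
  inferInstanceAs (Fintype (Fin (n.choose 2) ≃ KEdge n))

noncomputable instance (n k : ℕ) : Fintype (ColourSet n k) :=
  inferInstanceAs (Fintype {S : Finset (Fin (n - 1)) // S.card = k})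

noncomputable instance (n k : ℕ) : DecidableEq (ColourSet n k) := Classical.decEq _

instance (n : ℕ) : MeasurableSingletonClass (EdgeOrder n) := ⟨fun _ => trivial⟩

instance (n k : ℕ) : MeasurableSingletonClass (ColourSet n k) := ⟨fun _ => trivial⟩

lemma card_KEdge (n : ℕ) : Fintype.card (KEdge n) = n.choose 2 := by
  have h := SimpleGraph.card_edgeFinset_top_eq_card_choose_two (V := Fin n)
  rw [Fintype.card_fin] at h
  rw [← h, ← SimpleGraph.edgeFinset_card]

lemma card_EdgeOrder (n : ℕ) : Fintype.card (EdgeOrder n) = (n.choose 2).factorial := by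
  have := Fintype.card_equiv (Fintype.equivFinOfCardEq (card_KEdge n)).symm
  rw [Fintype.card_fin] at this
  exact this

lemma card_ColourSet (n k : ℕ) : Fintype.card (ColourSet n k) = (n - 1).choose k := by
  have : Fintype.card (ColourSet n k) =
      Fintype.card {S : Finset (Fin (n - 1)) // S.card = k} := rfl
  rw [this, Fintype.card_finset_len, Fintype.card_fin]

variable {n k : ℕ}

lemma nonempty_EdgeOrder (n : ℕ) : Nonempty (EdgeOrder n) :=
  Fintype.card_pos_iff.1 (by rw [card_EdgeOrder]; positivity)

lemma nonempty_ColourSet (hk : k ≤ n - 1) : Nonempty (ColourSet n k) :=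
  Fintype.card_pos_iff.1 (by rw [card_ColourSet]; exact Nat.choose_pos hk)

lemma isProbabilityMeasure_processLaw (hk : k ≤ n - 1) :
    IsProbabilityMeasure (processLaw n k) := by
  have := nonempty_EdgeOrder n
  have := nonempty_ColourSet hk
  have : IsProbabilityMeasure (uniformOn (Set.univ : Set (EdgeOrder n))) :=
    isProbabilityMeasure_uniformOn Set.finite_univ Set.univ_nonempty
  have : IsProbabilityMeasure (uniformOn (Set.univ : Set (ColourSet n k))) :=
    isProbabilityMeasure_uniformOn Set.finite_univ Set.univ_nonempty
  unfold processLaw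
  infer_instance

open Classical in
/-- The law of the process is the uniform distribution on the outcomes. -/
lemma processLaw_real_eq (hk : k ≤ n - 1) (S : Set (Outcome n k)) :
    (processLaw n k).real S = (#{ω : Outcome n k | ω ∈ S} : ℝ) /
      ((n.choose 2).factorial * ((n - 1).choose k : ℝ) ^ (n.choose 2)) := by
  have := nonempty_EdgeOrder n
  have := nonempty_ColourSet hk
  have := isProbabilityMeasure_processLaw hk
  have : IsProbabilityMeasure (uniformOn (Set.univ : Set (ColourSet n k))) :=
    isProbabilityMeasure_uniformOn Set.finite_univ Set.univ_nonempty
  have hsing : ∀ ω : Outcome n k, (processLaw n k).real {ω} =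
      1 / ((n.choose 2).factorial * ((n - 1).choose k : ℝ) ^ (n.choose 2)) := by
    rintro ⟨σ, c⟩
    rw [measureReal_def, processLaw, ← Set.singleton_prod_singleton, Measure.prod_prod,
      Measure.pi_singleton]
    simp only [uniformOn_univ, Measure.count_singleton, prod_const, card_univ, card_KEdge,
      card_EdgeOrder, card_ColourSet]
    simp [ENNReal.toReal_mul, ENNReal.toReal_pow, mul_comm]
  have hS : S = (({ω : Outcome n k | ω ∈ S} : Finset (Outcome n k)) : Set (Outcome n k)) := by
    ext; simp
  rw [hS, ← sum_measureReal_singleton, sum_congr rfl fun ω _ => hsing ω, sum_const, ← hS]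
  rw [nsmul_eq_mul, mul_one_div]

lemma mem_edges_iff (ω : Outcome n k) (m : ℕ) (e : KEdge n) :
    e ∈ ω.edges m ↔ ((Equiv.symm (α := Fin (n.choose 2)) ω.1 e : Fin _) : ℕ) < m := by
  constructor
  · rintro ⟨i, hi, rfl⟩
    have : Equiv.symm (α := Fin (n.choose 2)) ω.1 (ω.1.toFun i) = i :=
      Equiv.symm_apply_apply (α := Fin (n.choose 2)) ω.1 i
    rw [this]; exact hi
  · intro h
    exact ⟨_, h, Equiv.apply_symm_apply (α := Fin (n.choose 2)) ω.1 e⟩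

open Classical in
/-- The probability that a random `k`-set of colours has the property `P`. -/
noncomputable def colourProb (n k : ℕ) (P : Finset (Fin (n - 1)) → Prop) : ℝ :=
  (#{a : ColourSet n k | P a.val} : ℝ) / (n - 1).choose k

lemma colourProb_nonneg (P : Finset (Fin (n - 1)) → Prop) : 0 ≤ colourProb n k P := by
  unfold colourProb; positivity

open Classical in
lemma colourProb_add_not (hk : k ≤ n - 1) (P : Finset (Fin (n - 1)) → Prop) :
    colourProb n k P + colourProb n k (fun S => ¬ P S) = 1 := by
  have h := card_filter_add_card_filter_not (s := (univ : Finset (ColourSet n k)))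
    (fun a => P a.val)
  rw [card_univ, card_ColourSet] at h
  have hpos : (0 : ℝ) < (n - 1).choose k := by exact_mod_cast Nat.choose_pos hk
  unfold colourProb
  rw [← add_div, div_eq_one_iff_eq hpos.ne']
  norm_cast
  convert h

lemma sum_prod_colours (f : KEdge n → ColourSet n k → ℝ) :
    ∑ c : KEdge n → ColourSet n k, ∏ e, f e (c e) = ∏ e, ∑ a, f e a := by
  rw [prod_univ_sum, Fintype.piFinset_univ]

set_option maxHeartbeats 1000000 in
open Classical in
/-- The main probability estimate: the edges of `T` are among the first `m₁` and have prescribed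
colour properties, and no edge of `R` among the first `m₀` has the colour property `B`. -/
theorem processLaw_real_le (hk : k ≤ n - 1) (T R : Finset (KEdge n)) (hTR : Disjoint T R)
    (m₀ m₁ : ℕ) (ht : #T ≤ m₀) (hm0 : m₀ ≤ n.choose 2) (hm1 : m₁ ≤ n.choose 2)
    (P : KEdge n → Finset (Fin (n - 1)) → Prop) (B : Finset (Fin (n - 1)) → Prop) (z : ℝ)
    (hz : z = ((m₀ : ℝ) - #T) / (n.choose 2 : ℕ)) :
    (processLaw n k).real {ω | (∀ e ∈ T, e ∈ ω.edges m₁ ∧ P e (ω.colours e)) ∧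
        ∀ e ∈ R, e ∈ ω.edges m₀ → ¬ B (ω.colours e)} ≤
      ((m₁ : ℝ) / (n.choose 2 : ℕ)) ^ #T * (∏ e ∈ T, colourProb n k (P e)) *
        Real.exp (-(#R * colourProb n k B * (z - z ^ 2 / 2))) := by
  set N := n.choose 2 with hN
  set C : ℝ := ((n - 1).choose k : ℝ) with hC
  have hCpos : 0 < C := by rw [hC]; exact_mod_cast Nat.choose_pos hk
  have hz0 : 0 ≤ z := by
    rw [hz]; refine div_nonneg ?_ (Nat.cast_nonneg _)
    have : (#T : ℝ) ≤ m₀ := by exact_mod_cast ht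
    linarith
  rw [processLaw_real_eq hk, div_le_iff₀ (by positivity)]
  set S : Set (Outcome n k) := {ω | (∀ e ∈ T, e ∈ ω.edges m₁ ∧ P e (ω.colours e)) ∧
        ∀ e ∈ R, e ∈ ω.edges m₀ → ¬ B (ω.colours e)} with hS
  have hcount : (#{ω : Outcome n k | ω ∈ S} : ℝ) =
      ∑ c : KEdge n → ColourSet n k, (#{σ : EdgeOrder n | ((σ, c) : Outcome n k) ∈ S} : ℝ) := by
    have h1 : #{ω : Outcome n k | ω ∈ S} =
        ∑ c : KEdge n → ColourSet n k, #{σ : EdgeOrder n | ((σ, c) : Outcome n k) ∈ S} := by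
      simp only [card_filter]
      rw [Fintype.sum_prod_type_right]
    exact_mod_cast h1
  -- For a fixed colouring, the bound on the number of orderings is a product over the edges: 0 or 1
  -- for an edge of `T`, and e^(-z) for an edge of `R` with property `B`. The sum over all
  -- colourings then becomes a product of sums over the colour sets of one edge.
  let g : KEdge n → ColourSet n k → ℝ := fun e a =>
    (if e ∈ T then (if P e a.val then 1 else 0) else 1) *
      (if e ∈ R then (if B a.val then Real.exp (-z) else 1) else 1)
  have hfib : ∀ c : KEdge n → ColourSet n k,
      (#{σ : EdgeOrder n | ((σ, c) : Outcome n k) ∈ S} : ℝ) ≤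
        N.factorial * ((m₁ : ℝ) / N) ^ #T * ∏ e, g e (c e) := by
    intro c
    by_cases hT : ∀ e ∈ T, P e (c e).val
    · set Q := {e ∈ R | B (c e).val} with hQ
      have h1 := card_constrainedOrders_early_late (card_KEdge n) T Q
        (hTR.mono_right (filter_subset _ _)) m₀ m₁ ht hm0 hm1
      have hg : ∏ e, g e (c e) = Real.exp (-z * #Q) := by
        have : ∀ e, g e (c e) = if e ∈ Q then Real.exp (-z) else 1 := by
          intro e
          have h2 : (if e ∈ T then (if P e (c e).val then (1 : ℝ) else 0) else 1) = 1 := by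
            split_ifs with h3 h4
            · rfl
            · exact absurd (hT e h3) h4
            · rfl
          simp only [g, h2, one_mul, hQ, mem_filter]
          split_ifs <;> simp_all
        rw [prod_congr rfl fun e _ => this e, prod_ite_mem, univ_inter, prod_const, ← Real.exp_nat_mul]
        congr 1; ring
      rw [hg, hz]
      refine le_trans ?_ h1
      norm_cast
      refine card_le_card fun σ hσ => ?_
      rw [mem_filter] at hσ
      obtain ⟨-, hσ1, hσ2⟩ := hσ
      refine mem_constrainedOrders.2 ?_
      intro e he
      refine ⟨fun heT => (mem_edges_iff _ _ _).1 (hσ1 e heT).1, fun heT => ?_⟩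
      have heQ : e ∈ Q := (mem_union.1 he).resolve_right heT
      rw [hQ, mem_filter] at heQ
      by_contra hlt
      exact hσ2 e heQ.1 ((mem_edges_iff _ _ _).2 (not_le.1 hlt)) heQ.2
    · have : #{σ : EdgeOrder n | ((σ, c) : Outcome n k) ∈ S} = 0 := by
        rw [card_eq_zero, filter_eq_empty_iff]
        rintro σ - hσ
        exact hT fun e he => (hσ.1 e he).2
      rw [this]
      have hgn : ∀ e a, 0 ≤ g e a := by
        intro e a; simp only [g]; split_ifs <;> positivity
      have := prod_nonneg fun e (_ : e ∈ univ) => hgn e (c e)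
      simp only [Nat.cast_zero]; positivity
  have hsum : ∀ e, ∑ a, g e a ≤ C * ((if e ∈ T then colourProb n k (P e) else 1) *
      (if e ∈ R then Real.exp (-(colourProb n k B * (z - z ^ 2 / 2))) else 1)) := by
    intro e
    have hcardsum : ∀ Q : ColourSet n k → Prop, ∑ a, (if Q a then (1 : ℝ) else 0) = #{a | Q a} := by
      intro Q; simp
    by_cases heT : e ∈ T
    · have heR : e ∉ R := disjoint_left.1 hTR heT
      simp only [g, heT, heR, if_true, if_false, mul_one]
      rw [hcardsum, colourProb, mul_div_cancel₀ _ hCpos.ne']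
    · by_cases heR : e ∈ R
      · simp only [g, heT, heR, if_true, if_false, one_mul]
        have h1 : ∀ a : ColourSet n k, (if B a.val then Real.exp (-z) else 1) =
            1 - (1 - Real.exp (-z)) * (if B a.val then (1 : ℝ) else 0) := by
          intro a; split_ifs <;> ring
        rw [sum_congr rfl fun a _ => h1 a, sum_sub_distrib, ← mul_sum, hcardsum, sum_const,
          card_univ, card_ColourSet]
        have h2 : (#{a : ColourSet n k | B a.val} : ℝ) = C * colourProb n k B := by
          rw [colourProb, mul_div_cancel₀ _ hCpos.ne']
        rw [h2, nsmul_eq_mul, mul_one, ← hC]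
        have h3 : C - (1 - Real.exp (-z)) * (C * colourProb n k B) =
            C * (1 - (1 - Real.exp (-z)) * colourProb n k B) := by ring
        rw [h3]
        refine mul_le_mul_of_nonneg_left ?_ hCpos.le
        have h4 : z - z ^ 2 / 2 ≤ 1 - Real.exp (-z) := by
          -- This follows from e^z ≥ 1 + z + z²/2, as (1 - z + z²/2)(1 + z + z²/2) = 1 + z⁴/4 ≥ 1.
          have h5 : Real.exp (-z) ≤ 1 - z + z ^ 2 / 2 := by
            have h6 := Real.quadratic_le_exp_of_nonneg hz0
            have h7 : Real.exp (-z) * Real.exp z = 1 := by rw [← Real.exp_add]; simp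
            have h8 : 1 ≤ (1 - z + z ^ 2 / 2) * Real.exp z := by
              have h9 : 0 ≤ 1 - z + z ^ 2 / 2 := by nlinarith [sq_nonneg (z - 1)]
              nlinarith [mul_le_mul_of_nonneg_left h6 h9, sq_nonneg z, sq_nonneg (z ^ 2)]
            exact le_of_mul_le_mul_right (by rw [h7]; exact h8) (Real.exp_pos z)
          linarith
        have h5 := Real.add_one_le_exp (-(colourProb n k B * (z - z ^ 2 / 2)))
        nlinarith [mul_le_mul_of_nonneg_left h4 (colourProb_nonneg (n := n) (k := k) B)]
      · simp only [g, heT, heR, if_false, mul_one]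
        rw [sum_const, card_univ, card_ColourSet]; simp [hC]
  have hgn : ∀ e a, 0 ≤ g e a := by
    intro e a; simp only [g]; split_ifs <;> positivity
  refine le_trans (le_of_eq (?_ : _ = (#{ω : Outcome n k | ω ∈ S} : ℝ))) ?_
  · congr!
  calc (#{ω : Outcome n k | ω ∈ S} : ℝ)
      = ∑ c : KEdge n → ColourSet n k, (#{σ : EdgeOrder n | ((σ, c) : Outcome n k) ∈ S} : ℝ) :=
        hcount
    _ ≤ ∑ c : KEdge n → ColourSet n k, N.factorial * ((m₁ : ℝ) / N) ^ #T * ∏ e, g e (c e) :=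
        sum_le_sum fun c _ => hfib c
    _ = N.factorial * ((m₁ : ℝ) / N) ^ #T * ∏ e, ∑ a, g e a := by
        rw [← mul_sum, sum_prod_colours]
    _ ≤ N.factorial * ((m₁ : ℝ) / N) ^ #T *
        ∏ e : KEdge n, (C * ((if e ∈ T then colourProb n k (P e) else 1) *
      (if e ∈ R then Real.exp (-(colourProb n k B * (z - z ^ 2 / 2))) else 1))) := by
        refine mul_le_mul_of_nonneg_left ?_ (by positivity)
        exact prod_le_prod (fun e _ => sum_nonneg fun a _ => hgn e a) fun e _ => hsum e
    _ = ((m₁ : ℝ) / N) ^ #T * (∏ e ∈ T, colourProb n k (P e)) *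
        Real.exp (-(#R * colourProb n k B * (z - z ^ 2 / 2))) * (N.factorial * C ^ N) := by
        rw [prod_mul_distrib, prod_mul_distrib, prod_const, card_univ, card_KEdge, prod_ite_mem,
          prod_ite_mem, univ_inter, univ_inter, prod_const, ← Real.exp_nat_mul]
        have : (#R : ℝ) * -(colourProb n k B * (z - z ^ 2 / 2)) =
          -(#R * colourProb n k B * (z - z ^ 2 / 2)) := by ring
        rw [this]
        ring

end Law

/-! ### Which colours a random k-set meets -/

section ColourProbabilities

open Finset

variable {n k : ℕ}

/-- The quotient is the product of (j - s)/(M - s) over s < k: the first two factors are at most j/M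
and the others at most 1. `Nat.choose_mul` with 2 marked elements isolates those two factors. -/
lemma choose_div_choose_le {j M : ℕ} (hk : 2 ≤ k) (hkM : k ≤ M) (hj : j ≤ M) :
    (j.choose k : ℝ) / M.choose k ≤ ((j : ℝ) / M) ^ 2 := by
  have hMpos : (0 : ℝ) < M.choose k := by exact_mod_cast Nat.choose_pos hkM
  rcases lt_or_ge j k with hjk | hjk
  · rw [Nat.choose_eq_zero_of_lt hjk]; simp only [Nat.cast_zero, zero_div]; positivity
  have h1 := Nat.choose_mul (n := j) hk
  have h2 := Nat.choose_mul (n := M) hk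
  have h3 : (j - 2).choose (k - 2) ≤ (M - 2).choose (k - 2) := Nat.choose_le_choose _ (by omega)
  have hM2 : (0 : ℝ) < M := by exact_mod_cast (by omega : 0 < M)
  have hk2 : (0 : ℝ) < k.choose 2 := by exact_mod_cast Nat.choose_pos hk
  have hc : (0 : ℝ) < (M - 2).choose (k - 2) := by
    exact_mod_cast Nat.choose_pos (by omega : k - 2 ≤ M - 2)
  rw [div_pow, div_le_div_iff₀ hMpos (by positivity)]
  have h1' : (j.choose k : ℝ) * k.choose 2 = j.choose 2 * (j - 2).choose (k - 2) := by
    exact_mod_cast h1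
  have h2' : (M.choose k : ℝ) * k.choose 2 = M.choose 2 * (M - 2).choose (k - 2) := by
    exact_mod_cast h2
  have h3' : ((j - 2).choose (k - 2) : ℝ) ≤ (M - 2).choose (k - 2) := by exact_mod_cast h3
  rw [Nat.cast_choose_two ℝ j] at h1'
  rw [Nat.cast_choose_two ℝ M] at h2'
  have hjr : (2 : ℝ) ≤ j := by exact_mod_cast hk.trans hjk
  have hjM : (j : ℝ) ≤ M := by exact_mod_cast hj
  refine le_of_mul_le_mul_right ?_ hk2
  have e1 : (j.choose k : ℝ) * (M : ℝ) ^ 2 * k.choose 2 =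
      (j : ℝ) * (j - 1) / 2 * (j - 2).choose (k - 2) * M ^ 2 := by rw [← h1']; ring
  have e2 : (j : ℝ) ^ 2 * M.choose k * k.choose 2 =
      (M : ℝ) * (M - 1) / 2 * (M - 2).choose (k - 2) * j ^ 2 := by rw [← h2']; ring
  rw [e1, e2]
  calc (j : ℝ) * (j - 1) / 2 * (j - 2).choose (k - 2) * M ^ 2
      ≤ (j : ℝ) * (j - 1) / 2 * (M - 2).choose (k - 2) * M ^ 2 := by
        have : (0 : ℝ) ≤ (j : ℝ) * (j - 1) / 2 := by
          have : (0 : ℝ) ≤ (j : ℝ) - 1 := by linarith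
          positivity
        gcongr
    _ = ((j : ℝ) * M / 2 * (M - 2).choose (k - 2)) * ((j - 1) * M) := by ring
    _ ≤ ((j : ℝ) * M / 2 * (M - 2).choose (k - 2)) * ((M - 1) * j) := by
        refine mul_le_mul_of_nonneg_left ?_ (by positivity)
        nlinarith
    _ = _ := by ring

lemma colourProb_eq (P : Finset (Fin (n - 1)) → Prop) [DecidablePred P] :
    colourProb n k P = (#{S ∈ powersetCard k (univ : Finset (Fin (n - 1))) | P S} : ℝ) /
      (n - 1).choose k := by
  unfold colourProb
  congr 2
  refine card_bij (fun a _ => a.val) ?_ ?_ ?_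
  · intro a ha
    simp only [mem_filter, mem_univ, true_and, mem_powersetCard, subset_univ] at ha ⊢
    exact ⟨a.2, ha⟩
  · intro a _ b _ h; exact Subtype.ext h
  · intro S hS
    simp only [mem_filter, mem_powersetCard, subset_univ, true_and] at hS
    exact ⟨⟨S, hS.1⟩, (@mem_filter _ _ (_) _ _).2 ⟨mem_univ _, hS.2⟩, rfl⟩

lemma colourProb_disjoint_le (hk : 2 ≤ k) (hkn : k ≤ n - 1) (I : Finset (Fin (n - 1))) :
    colourProb n k (fun S => Disjoint S I) ≤ (((n - 1 - #I : ℕ) : ℝ) / (n - 1 : ℕ)) ^ 2 := by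
  classical
  rw [colourProb_eq]
  have : ({S ∈ powersetCard k (univ : Finset (Fin (n - 1))) | Disjoint S I} : Finset _) =
      powersetCard k Iᶜ := by
    ext S
    simp only [mem_filter, mem_powersetCard, subset_univ, true_and, subset_compl_iff_disjoint_right]
    tauto
  rw [this, card_powersetCard, card_compl, Fintype.card_fin]
  exact choose_div_choose_le hk hkn (by omega)

lemma colourProb_superset_le (hkn : k ≤ n - 1) (A : Finset (Fin (n - 1))) (hA : #A ≤ k) :
    colourProb n k (fun S => A ⊆ S) ≤ (k.choose #A : ℝ) / (n - 1).choose #A := by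
  classical
  rw [colourProb_eq]
  have h1 : #{S ∈ powersetCard k (univ : Finset (Fin (n - 1))) | A ⊆ S} ≤
      (n - 1 - #A).choose (k - #A) := by
    have h0 : n - 1 - #A = #(Aᶜ) := by rw [card_compl, Fintype.card_fin]
    rw [h0, ← card_powersetCard]
    refine card_le_card_of_injOn (fun S => S \ A) ?_ ?_
    · intro S hS
      have hS := mem_filter.1 hS
      rw [mem_powersetCard_univ] at hS
      refine mem_powersetCard.2 ?_
      refine ⟨fun x hx => ?_, by rw [card_sdiff_of_subset hS.2, hS.1]⟩
      exact mem_compl.2 (mem_sdiff.1 hx).2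
    · intro S hS S' hS' h
      simp only [coe_filter, mem_powersetCard, subset_univ, true_and, Set.mem_ofPred_eq] at hS hS'
      simp only at h
      rw [← sdiff_union_of_subset hS.2, h, sdiff_union_of_subset hS'.2]
  have h2 := Nat.choose_mul (n := n - 1) hA
  have hpos : (0 : ℝ) < (n - 1).choose k := by exact_mod_cast Nat.choose_pos hkn
  have hpos2 : (0 : ℝ) < (n - 1).choose #A := by exact_mod_cast Nat.choose_pos (hA.trans hkn)
  rw [div_le_div_iff₀ hpos hpos2]
  calc _ ≤ (((n - 1 - #A).choose (k - #A) : ℕ) : ℝ) * (n - 1).choose #A := by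
        gcongr
    _ = _ := by rw [mul_comm, mul_comm (k.choose #A : ℝ)]; exact_mod_cast h2.symm

lemma colourProb_le_sum {ι : Type*} (s : Finset ι) (P : Finset (Fin (n - 1)) → Prop)
    (Q : ι → Finset (Fin (n - 1)) → Prop) (h : ∀ S, P S → ∃ a ∈ s, Q a S) :
    colourProb n k P ≤ ∑ a ∈ s, colourProb n k (Q a) := by
  classical
  unfold colourProb
  rw [← sum_div]
  gcongr
  norm_cast
  refine le_trans (card_le_card ?_) card_biUnion_le
  intro S hS
  simp only [mem_filter, mem_univ, true_and, mem_biUnion] at hS ⊢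
  exact h _ hS

lemma colourProb_not_disjoint_le (hk : 1 ≤ k) (hkn : k ≤ n - 1) (I : Finset (Fin (n - 1))) :
    colourProb n k (fun S => ¬ Disjoint S I) ≤ (k * #I : ℝ) / (n - 1 : ℕ) := by
  refine (colourProb_le_sum I _ (fun w S => {w} ⊆ S) ?_).trans ?_
  · intro S hS
    rw [not_disjoint_iff] at hS
    obtain ⟨w, h1, h2⟩ := hS
    exact ⟨w, h2, by simpa using h1⟩
  · refine (sum_le_card_nsmul _ _ ((k : ℝ) / (n - 1 : ℕ)) fun w _ => ?_).trans (le_of_eq ?_)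
    · refine (colourProb_superset_le hkn {w} (by simpa using hk)).trans (le_of_eq ?_)
      simp
    · rw [nsmul_eq_mul]; ring

/-- A union bound over the ordered pairs of colours in `I`. The bound is the square of that in
`colourProb_not_disjoint_le`: an edge with two colours in `I` pays twice, and this makes up for the
extra half vertex it contributes in `two_mul_card_cover_le`. -/
lemma colourProb_two_le_card_inter_le (hk : 2 ≤ k) (hkn : k ≤ n - 1) (I : Finset (Fin (n - 1))) :
    colourProb n k (fun S => 2 ≤ #(S ∩ I)) ≤ ((k * #I : ℝ) / (n - 1 : ℕ)) ^ 2 := by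
  refine (colourProb_le_sum I.offDiag _ (fun w S => {w.1, w.2} ⊆ S) ?_).trans ?_
  · intro S hS
    obtain ⟨a, ha, b, hb, hab⟩ := one_lt_card.1 hS
    simp only [mem_inter] at ha hb
    refine ⟨(a, b), by simp [mem_offDiag, ha.2, hb.2, hab], ?_⟩
    intro x hx
    simp only [mem_insert, mem_singleton] at hx
    rcases hx with rfl | rfl
    · exact ha.1
    · exact hb.1
  · refine (sum_le_card_nsmul _ _ (((k : ℝ) / (n - 1 : ℕ)) ^ 2) fun w hw => ?_).trans ?_
    · rw [mem_offDiag] at hw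
      have hc : #({w.1, w.2} : Finset (Fin (n - 1))) = 2 := card_pair hw.2.2
      refine (colourProb_superset_le hkn _ (by rw [hc]; exact hk)).trans ?_
      rw [hc]
      exact choose_div_choose_le le_rfl (by omega) hkn
    · rw [nsmul_eq_mul, offDiag_card, mul_div_right_comm, mul_pow,
        mul_comm]
      refine mul_le_mul_of_nonneg_left ?_ (by positivity)
      rw [sq, ← Nat.cast_mul]
      exact_mod_cast Nat.sub_le _ _

end ColourProbabilities

/-! ### Rado's theorem -/

section Rado

open Finset

/-- Rado's theorem on independent transversals, for a monotone submodular function. -/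
theorem exists_transversal_of_submodular {α W : Type*} [DecidableEq α] [DecidableEq W] [Fintype W]
    (r : Finset α → ℕ) (hmono : Monotone r) (hempty : r ∅ = 0)
    (hsub : ∀ A B, r (A ∪ B) + r (A ∩ B) ≤ r A + r B) (A : W → Finset α)
    (hA : ∀ I : Finset W, #I ≤ r (I.biUnion A)) :
    ∃ f : W → α, (∀ w, f w ∈ A w) ∧ ∀ I : Finset W, #I ≤ r (I.image f) := by
  induction hs : ∑ w, #(A w) using Nat.strong_induction_on generalizing A with
  | _ s ih =>
  have hne : ∀ w, (A w).Nonempty := by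
    intro w
    rw [nonempty_iff_ne_empty]
    intro h
    have := hA {w}
    simp [h, hempty] at this
  by_cases hone : ∀ w, #(A w) ≤ 1
  · choose f hf using hne
    refine ⟨f, hf, fun I => ?_⟩
    have hAf : ∀ w, A w = {f w} := fun w =>
      (eq_singleton_iff_unique_mem.2 ⟨hf w, fun x hx => card_le_one.1 (hone w) x hx _ (hf w)⟩)
    have : I.image f = I.biUnion A := by
      ext x; simp [hAf, eq_comm]
    rw [this]; exact hA I
  · push Not at hone
    obtain ⟨w, hw⟩ := hone
    obtain ⟨x, hx, y, hy, hxy⟩ := one_lt_card.1 hw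
    -- Of two distinct elements x, y of `A w`, one can be deleted without destroying the rank
    -- condition. The sets thus shrink to singletons.
    let B : α → W → Finset α := fun z => Function.update A w ((A w).erase z)
    have hBsub : ∀ z v, B z v ⊆ A v := by
      intro z v
      by_cases hv : v = w
      · subst hv; simp only [B, Function.update_self]; exact erase_subset _ _
      · simp only [B, Function.update_of_ne hv]; exact subset_rfl
    have step : ∀ z ∈ A w, (∀ I : Finset W, #I ≤ r (I.biUnion (B z))) →
        ∃ f : W → α, (∀ w, f w ∈ A w) ∧ ∀ I : Finset W, #I ≤ r (I.image f) := by
      intro z hz h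
      have hlt : ∑ v, #(B z v) < s := by
        rw [← hs]
        refine sum_lt_sum (fun v _ => card_le_card (hBsub z v)) ⟨w, mem_univ _, ?_⟩
        simp only [B, Function.update_self]
        exact card_erase_lt_of_mem hz
      obtain ⟨f, hf, hr⟩ := ih _ hlt (B z) h rfl
      exact ⟨f, fun v => hBsub z v (hf v), hr⟩
    by_contra hcon
    have h1 : ¬ ∀ I : Finset W, #I ≤ r (I.biUnion (B x)) := fun h => hcon (step x hx h)
    have h2 : ¬ ∀ I : Finset W, #I ≤ r (I.biUnion (B y)) := fun h => hcon (step y hy h)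
    push Not at h1 h2
    obtain ⟨I, hI⟩ := h1
    obtain ⟨J, hJ⟩ := h2
    have hmem : ∀ z (I : Finset W), r (I.biUnion (B z)) < #I → w ∈ I := by
      intro z I hI
      by_contra hwI
      have : I.biUnion (B z) = I.biUnion A := by
        refine biUnion_congr rfl fun v hv => ?_
        exact Function.update_of_ne (fun h : v = w => hwI (h ▸ hv)) _ _
      rw [this] at hI
      exact absurd (hA I) (not_le.2 hI)
    have hwI := hmem x I hI
    have hwJ := hmem y J hJ
    -- Suppose that `I` and `J` witness the failure of the two deletions; both contain w. Since x ≠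
    -- y, the two shrunken families together still cover `A` over `I ∪ J`, and what they have in
    -- common covers `A` over `I ∩ J` without w. Submodularity then yields |I| + |J| - 1 ≤ |I| + |J|
    -- - 2.
    have hU : (I ∪ J).biUnion A ⊆ I.biUnion (B x) ∪ J.biUnion (B y) := by
      intro e he
      rw [mem_biUnion] at he
      obtain ⟨v, hv, he⟩ := he
      rw [mem_union, mem_biUnion, mem_biUnion]
      by_cases hvw : v = w
      · subst hvw
        by_cases hex : e = x
        · right; exact ⟨v, hwJ, by simp [B, hex, hxy, hx]⟩
        · left; exact ⟨v, hwI, by simp [B, hex, he]⟩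
      · rcases mem_union.1 hv with hv | hv
        · left; exact ⟨v, hv, by simpa [B, Function.update_of_ne hvw] using he⟩
        · right; exact ⟨v, hv, by simpa [B, Function.update_of_ne hvw] using he⟩
    have hN : ((I ∩ J).erase w).biUnion A ⊆ I.biUnion (B x) ∩ J.biUnion (B y) := by
      intro e he
      rw [mem_biUnion] at he
      obtain ⟨v, hv, he⟩ := he
      rw [mem_erase, mem_inter] at hv
      rw [mem_inter, mem_biUnion, mem_biUnion]
      exact ⟨⟨v, hv.2.1, by simpa [B, Function.update_of_ne hv.1] using he⟩,
        ⟨v, hv.2.2, by simpa [B, Function.update_of_ne hv.1] using he⟩⟩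
    have e1 := (hA (I ∪ J)).trans (hmono hU)
    have e2 := (hA ((I ∩ J).erase w)).trans (hmono hN)
    rw [card_erase_of_mem (mem_inter.2 ⟨hwI, hwJ⟩)] at e2
    have e3 := hsub (I.biUnion (B x)) (J.biUnion (B y))
    have e4 := card_union_add_card_inter I J
    omega

end Rado

/-! ### Graphic rank through the dimension of the cut space -/

section CutSpace

open Finset

variable {n : ℕ}

/-- The functions on the vertices that are constant along every edge of `E`. -/
def cutSpace (E : Finset (KEdge n)) : Submodule ℚ (Fin n → ℚ) where
  carrier := {g | ∀ e ∈ E, ∀ x ∈ (e : Sym2 (Fin n)), ∀ y ∈ (e : Sym2 (Fin n)), g x = g y}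
  add_mem' := by
    intro g h hg hh e he x hx y hy
    simp only [Pi.add_apply, hg e he x hx y hy, hh e he x hx y hy]
  zero_mem' := by intro e _ x _ y _; rfl
  smul_mem' := by
    intro c g hg e he x hx y hy
    simp only [Pi.smul_apply, hg e he x hx y hy]

lemma mem_cutSpace {E : Finset (KEdge n)} {g : Fin n → ℚ} : g ∈ cutSpace E ↔
    ∀ e ∈ E, ∀ x ∈ (e : Sym2 (Fin n)), ∀ y ∈ (e : Sym2 (Fin n)), g x = g y := Iff.rfl

/-- The number of components of the graph with edge set `E`. -/
noncomputable def numComps (E : Finset (KEdge n)) : ℕ := Module.finrank ℚ (cutSpace E)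

lemma cutSpace_anti {E F : Finset (KEdge n)} (h : E ⊆ F) : cutSpace F ≤ cutSpace E :=
  fun _ hg e he => hg e (h he)

lemma cutSpace_union (E F : Finset (KEdge n)) : cutSpace (E ∪ F) = cutSpace E ⊓ cutSpace F := by
  ext g
  simp only [Submodule.mem_inf, mem_cutSpace, mem_union, or_imp, forall_and]

lemma numComps_anti {E F : Finset (KEdge n)} (h : E ⊆ F) : numComps F ≤ numComps E :=
  Submodule.finrank_mono (cutSpace_anti h)

lemma numComps_le (E : Finset (KEdge n)) : numComps E ≤ n := by
  have := Submodule.finrank_le (cutSpace E)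
  rwa [Module.finrank_fin_fun] at this

lemma numComps_empty : numComps (∅ : Finset (KEdge n)) = n := by
  have : cutSpace (∅ : Finset (KEdge n)) = ⊤ := by
    ext g; simp [mem_cutSpace]
  rw [numComps, this, finrank_top, Module.finrank_fin_fun]

/-- The cut space of a union is the intersection of the cut spaces, and their sum lies in the cut
space of the intersection. The dimension formula does the rest; it is the submodularity of the rank
n - `numComps`. -/
lemma numComps_supermodular (E F : Finset (KEdge n)) :
    numComps E + numComps F ≤ numComps (E ∪ F) + numComps (E ∩ F) := by
  have h1 := Submodule.finrank_sup_add_finrank_inf_eq (cutSpace E) (cutSpace F)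
  rw [← cutSpace_union] at h1
  have h2 : cutSpace E ⊔ cutSpace F ≤ cutSpace (E ∩ F) :=
    sup_le (cutSpace_anti inter_subset_left) (cutSpace_anti inter_subset_right)
  have h3 := Submodule.finrank_mono h2
  unfold numComps
  omega

lemma le_numComps_singleton_add_one (e : KEdge n) : n ≤ numComps {e} + 1 := by
  obtain ⟨e, he⟩ := e
  induction e using Sym2.ind with
  | _ a b =>
  let φ : (Fin n → ℚ) →ₗ[ℚ] ℚ :=
    (LinearMap.proj a : (Fin n → ℚ) →ₗ[ℚ] ℚ) - LinearMap.proj b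
  have hk : LinearMap.ker φ ≤ cutSpace {⟨s(a, b), he⟩} := by
    intro g hg
    have hg' : g a = g b := by simpa [φ, sub_eq_zero] using hg
    intro e he x hx y hy
    rw [mem_singleton] at he
    subst he
    simp only [Sym2.mem_iff] at hx hy
    rcases hx with rfl | rfl <;> rcases hy with rfl | rfl <;> simp [hg']
  have h1 := LinearMap.finrank_range_add_finrank_ker φ
  have h2 := Submodule.finrank_le (LinearMap.range φ)
  have h3 := Submodule.finrank_mono hk
  rw [Module.finrank_fin_fun] at h1
  rw [Module.finrank_self] at h2
  unfold numComps
  omega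

lemma numComps_le_insert (E : Finset (KEdge n)) (e : KEdge n) :
    numComps E ≤ numComps (insert e E) + 1 := by
  have h1 := numComps_supermodular E {e}
  have h2 := le_numComps_singleton_add_one e
  have h3 := numComps_le (E ∩ {e})
  rw [union_comm, ← insert_eq] at h1
  omega

lemma numComps_le_union (E X : Finset (KEdge n)) : numComps E ≤ numComps (E ∪ X) + #X := by
  induction X using Finset.induction_on with
  | empty => simp
  | insert e X he ih =>
    have := numComps_le_insert (E ∪ X) e
    rw [union_insert, card_insert_of_notMem he]
    omega

/-- A spanning forest. -/
lemma exists_basis (E : Finset (KEdge n)) :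
    ∃ T ⊆ E, #T + numComps E = n ∧ cutSpace T = cutSpace E := by
  induction E using Finset.induction_on with
  | empty => exact ⟨∅, subset_rfl, by simp [numComps_empty], rfl⟩
  | insert e E he ih =>
    obtain ⟨T, hT, hcard, hspace⟩ := ih
    by_cases h : cutSpace (insert e E) = cutSpace E
    · refine ⟨T, hT.trans (subset_insert _ _), ?_, hspace.trans h.symm⟩
      rw [numComps, h]; exact hcard
    · have hlt : numComps (insert e E) < numComps E :=
        Submodule.finrank_lt_finrank_of_lt
          (lt_of_le_of_ne (cutSpace_anti (subset_insert _ _)) h)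
      have hle := numComps_le_insert E e
      refine ⟨insert e T, insert_subset_insert _ hT, ?_, ?_⟩
      · rw [card_insert_of_notMem fun h => he (hT h)]; omega
      · rw [insert_eq, insert_eq, cutSpace_union, cutSpace_union, hspace]

/-- The constant functions already span one dimension, so nothing else fits. -/
lemma eq_of_numComps_le_one {E : Finset (KEdge n)} (h : numComps E ≤ 1) {g : Fin n → ℚ}
    (hg : g ∈ cutSpace E) (x y : Fin n) : g x = g y := by
  obtain ⟨v, hv⟩ := finrank_le_one_iff.1 h
  have hone : (fun _ => 1 : Fin n → ℚ) ∈ cutSpace E := fun _ _ _ _ _ _ => rfl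
  obtain ⟨a, ha⟩ := hv ⟨_, hone⟩
  obtain ⟨b, hb⟩ := hv ⟨g, hg⟩
  have ha' : ∀ z, a * v.1 z = 1 := fun z => congrFun (congrArg Subtype.val ha) z
  have hb' : ∀ z, b * v.1 z = g z := fun z => congrFun (congrArg Subtype.val hb) z
  have ha0 : a ≠ 0 := fun h => by simpa [h] using ha' x
  rw [← hb', ← hb']
  congr 1
  exact mul_left_cancel₀ ha0 ((ha' x).trans (ha' y).symm)

lemma numComps_le_one {E : Finset (KEdge n)}
    (h : ∀ g ∈ cutSpace E, ∀ x y : Fin n, g x = g y) : numComps E ≤ 1 := by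
  have hone : (fun _ => 1 : Fin n → ℚ) ∈ cutSpace E := fun _ _ _ _ _ _ => rfl
  refine finrank_le_one (⟨_, hone⟩ : cutSpace E) fun g => ?_
  rcases isEmpty_or_nonempty (Fin n) with hn | ⟨⟨x⟩⟩
  · exact ⟨0, Subsingleton.elim _ _⟩
  · refine ⟨g.1 x, Subtype.ext (funext fun y => ?_)⟩
    simpa using h g.1 g.2 x y

/-- The graph with edge set `E`. -/
def graphOf (E : Finset (KEdge n)) : SimpleGraph (Fin n) :=
  SimpleGraph.fromEdgeSet (Subtype.val '' (E : Set (KEdge n)))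

lemma graphOf_adj_of_mem {E : Finset (KEdge n)} {e : KEdge n} (he : e ∈ E) {x y : Fin n}
    (hx : x ∈ (e : Sym2 (Fin n))) (hy : y ∈ (e : Sym2 (Fin n))) (hxy : x ≠ y) :
    (graphOf E).Adj x y := by
  rw [graphOf, SimpleGraph.fromEdgeSet_adj]
  refine ⟨⟨e, he, ?_⟩, hxy⟩
  exact ((Sym2.mem_and_mem_iff hxy).1 ⟨hx, hy⟩)

lemma graphOf_edgeSet (E : Finset (KEdge n)) :
    (graphOf E).edgeSet = Subtype.val '' (E : Set (KEdge n)) := by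
  rw [graphOf, SimpleGraph.edgeSet_fromEdgeSet, sdiff_eq_left, Set.disjoint_left]
  rintro _ ⟨e, -, rfl⟩ h
  exact SimpleGraph.not_isDiag_of_mem_edgeSet _ e.2 h

lemma graphOf_reachable_of_mem {E : Finset (KEdge n)} {e : KEdge n} (he : e ∈ E) {x y : Fin n}
    (hx : x ∈ (e : Sym2 (Fin n))) (hy : y ∈ (e : Sym2 (Fin n))) : (graphOf E).Reachable x y := by
  by_cases hxy : x = y
  · rw [hxy]
  · exact (graphOf_adj_of_mem he hx hy hxy).reachable

/-- The indicator function of the component of `x` is constant along the edges, hence constant. -/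
lemma connected_of_numComps_le_one [NeZero n] {E : Finset (KEdge n)} (h : numComps E ≤ 1) :
    (graphOf E).Connected := by
  classical
  refine { preconnected := fun x y => ?_, nonempty := ⟨0⟩ }
  have hg : (fun z => if (graphOf E).Reachable x z then 1 else 0 : Fin n → ℚ) ∈ cutSpace E := by
    intro e he a ha b hb
    have hab := graphOf_reachable_of_mem he ha hb
    have : (graphOf E).Reachable x a ↔ (graphOf E).Reachable x b :=
      ⟨fun h => h.trans hab, fun h => h.trans hab.symm⟩
    simp only [this]
  have := eq_of_numComps_le_one h hg x y
  by_contra hxy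
  simp [hxy] at this

/-- A function in the cut space is determined by its values at one representative of each component.
`exists_balanced_cut` needs only this direction. -/
lemma numComps_le_card_connectedComponent (E : Finset (KEdge n)) :
    numComps E ≤ Nat.card (graphOf E).ConnectedComponent := by
  classical
  have : Fintype (graphOf E).ConnectedComponent := Fintype.ofFinite _
  let φ : cutSpace E →ₗ[ℚ] ((graphOf E).ConnectedComponent → ℚ) :=
    { toFun := fun g c => g.1 c.out
      map_add' := fun _ _ => rfl
      map_smul' := fun _ _ => rfl }
  have hφ : Function.Injective φ := by
    intro g h hgh
    have hreach : ∀ f ∈ cutSpace E, ∀ a b, (graphOf E).Reachable a b → f a = f b := by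
      rintro f hf a b ⟨p⟩
      induction p with
      | nil => rfl
      | cons hadj _ ih =>
        rw [graphOf, SimpleGraph.fromEdgeSet_adj] at hadj
        obtain ⟨⟨e, he, heq⟩, -⟩ := hadj
        rw [← ih]
        exact hf e he _ (by rw [heq]; simp) _ (by rw [heq]; simp)
    refine Subtype.ext (funext fun x => ?_)
    have hx : (graphOf E).Reachable x ((graphOf E).connectedComponentMk x).out := by
      refine SimpleGraph.ConnectedComponent.exact ?_
      exact (Quot.out_eq _).symm
    rw [hreach _ g.2 _ _ hx, hreach _ h.2 _ _ hx]
    exact congrFun hgh _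
  have := LinearMap.finrank_le_finrank_of_injective hφ
  rwa [Module.finrank_fintype_fun_eq_card, ← Nat.card_eq_fintype_card] at this

end CutSpace

/-! ### Cuts that respect a given edge set -/

section Cuts

open Finset

variable {n : ℕ}

open Classical in
/-- The edges between `U` and its complement. -/
noncomputable def cutEdges (U : Finset (Fin n)) : Finset (KEdge n) :=
  {e | (∃ x ∈ (e : Sym2 (Fin n)), x ∈ U) ∧ ∃ x ∈ (e : Sym2 (Fin n)), x ∉ U}

lemma mem_cutEdges {U : Finset (Fin n)} {e : KEdge n} : e ∈ cutEdges U ↔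
    (∃ x ∈ (e : Sym2 (Fin n)), x ∈ U) ∧ ∃ x ∈ (e : Sym2 (Fin n)), x ∉ U := by
  simp [cutEdges]

lemma mem_cutEdges_iff {U : Finset (Fin n)} {e : KEdge n} {a b : Fin n}
    (he : (e : Sym2 (Fin n)) = s(a, b)) : e ∈ cutEdges U ↔ ¬ (a ∈ U ↔ b ∈ U) := by
  rw [mem_cutEdges, he]
  simp only [Sym2.mem_iff, exists_eq_or_imp, exists_eq_left]
  tauto

lemma cutEdges_compl (U : Finset (Fin n)) : cutEdges Uᶜ = cutEdges U := by
  ext e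
  simp only [mem_cutEdges, mem_compl, not_not]
  tauto

lemma card_cutEdges (U : Finset (Fin n)) : #(cutEdges U) = #U * (n - #U) := by
  have h : n - #U = #(Uᶜ) := by rw [card_compl, Fintype.card_fin]
  rw [h, ← card_product]
  have hne : ∀ p ∈ U ×ˢ Uᶜ, p.1 ≠ p.2 := by
    intro p hp h
    rw [mem_product, mem_compl, h] at hp
    exact hp.2 hp.1
  symm
  refine card_bij (fun p hp => (⟨s(p.1, p.2), by simpa using hne p hp⟩ : KEdge n)) ?_ ?_ ?_
  · intro p hp
    rw [mem_cutEdges_iff (a := p.1) (b := p.2) rfl]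
    rw [mem_product, mem_compl] at hp
    tauto
  · intro p hp q hq h
    rw [mem_product, mem_compl] at hp hq
    have h' : s(p.1, p.2) = s(q.1, q.2) := congrArg Subtype.val h
    rw [Sym2.eq_iff] at h'
    rcases h' with h' | h'
    · exact Prod.ext h'.1 h'.2
    · exact absurd (h'.1 ▸ hp.1) hq.2
  · rintro e he
    obtain ⟨⟨x, hx, hxU⟩, y, hy, hyU⟩ := mem_cutEdges.1 he
    refine ⟨(x, y), by simp [hxU, hyU], Subtype.ext ?_⟩
    exact ((Sym2.mem_and_mem_iff fun h : x = y => hyU (h ▸ hxU)).1 ⟨hx, hy⟩).symm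

lemma exists_of_graphOf_adj {E : Finset (KEdge n)} {x y : Fin n} (h : (graphOf E).Adj x y) :
    ∃ e ∈ E, (e : Sym2 (Fin n)) = s(x, y) := by
  rw [graphOf, SimpleGraph.fromEdgeSet_adj] at h
  exact h.1

lemma exists_mem_cutEdges_of_connected {E : Finset (KEdge n)} (h : (graphOf E).Connected)
    {U : Finset (Fin n)} {x y : Fin n} (hx : x ∈ U) (hy : y ∉ U) : ∃ e ∈ E, e ∈ cutEdges U := by
  obtain ⟨p⟩ := h.preconnected x y
  obtain ⟨d, -, hd1, hd2⟩ := p.exists_boundary_dart (U : Set (Fin n)) hx hy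
  obtain ⟨e, he, heq⟩ := exists_of_graphOf_adj d.adj
  refine ⟨e, he, (mem_cutEdges_iff heq).2 ?_⟩
  simp only [mem_coe] at hd1 hd2
  tauto

lemma disjoint_cutEdges_of_mem_cutSpace {E : Finset (KEdge n)} {g : Fin n → ℚ}
    (hg : g ∈ cutSpace E) (c : ℚ) {e : KEdge n} (he : e ∈ E) :
    e ∉ cutEdges ({z | g z = c} : Finset (Fin n)) := by
  rw [mem_cutEdges]
  rintro ⟨⟨x, hx, hxc⟩, y, hy, hyc⟩
  simp only [mem_filter, mem_univ, true_and] at hxc hyc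
  exact hyc ((hg e he y hy x hx).trans hxc)

/-- A maximum cut among those that respect `E` is crossed by many edges of `F`. -/
theorem exists_large_cut {E F : Finset (KEdge n)} (hF : (graphOf F).Connected)
    (hE : 2 ≤ numComps E) :
    ∃ U : Finset (Fin n), 1 ≤ #U ∧ 2 * #U ≤ n ∧ (∀ e ∈ E, e ∉ cutEdges U) ∧
      numComps E ≤ #(cutEdges U ∩ F) + 1 := by
  classical
  suffices h : ∃ U : Finset (Fin n), (∀ e ∈ E, e ∉ cutEdges U) ∧
      numComps E ≤ #(cutEdges U ∩ F) + 1 by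
    obtain ⟨U, h1, h2⟩ := h
    have hne : 0 < #(cutEdges U ∩ F) := by omega
    obtain ⟨e, he⟩ := card_pos.1 hne
    obtain ⟨⟨x, -, hx⟩, y, -, hy⟩ := mem_cutEdges.1 (mem_inter.1 he).1
    have hUpos : 0 < #U := card_pos.2 ⟨x, hx⟩
    have hUcpos : 0 < #(Uᶜ) := card_pos.2 ⟨y, mem_compl.2 hy⟩
    have hsum : #U + #(Uᶜ) = n := by rw [card_add_card_compl, Fintype.card_fin]
    rcases le_total #U #(Uᶜ) with hle | hle
    · exact ⟨U, hUpos, by omega, h1, h2⟩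
    · exact ⟨Uᶜ, hUcpos, by omega, by rwa [cutEdges_compl], by rwa [cutEdges_compl]⟩
  -- For a cut with the most crossing edges, these edges together with `E` connect everything. This
  -- suffices, since adding an edge lowers the number of components by at most one.
  obtain ⟨U, hU, hmax⟩ := exists_max_image
    ({U | ∀ e ∈ E, e ∉ cutEdges U} : Finset (Finset (Fin n))) (fun U => #(cutEdges U ∩ F))
    ⟨∅, by simp [mem_cutEdges]⟩
  simp only [mem_filter, mem_univ, true_and] at hU hmax
  refine ⟨U, hU, ?_⟩
  set X := cutEdges U ∩ F with hX
  suffices h : numComps (E ∪ X) ≤ 1 by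
    have := numComps_le_union E X
    omega
  refine numComps_le_one fun g hg x y => ?_
  by_contra hxy
  -- Otherwise some level set `A` is crossed by no edge of `E ∪ X`, but by an edge f of the
  -- connected `F`. Replacing `U` by its symmetric difference with `A` keeps all of `X` crossing and
  -- gains f, against maximality.
  let A : Finset (Fin n) := {z | g z = g x}
  have hA : ∀ e ∈ E ∪ X, e ∉ cutEdges A := fun e he =>
    disjoint_cutEdges_of_mem_cutSpace hg (g x) he
  obtain ⟨f, hfF, hfA⟩ := exists_mem_cutEdges_of_connected hF (U := A) (x := x) (y := y)
    (by simp [A]) (by simpa [A] using fun h => hxy h.symm)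
  have hcross : ∀ e : KEdge n, e ∈ cutEdges (symmDiff U A) ↔
      ¬ (e ∈ cutEdges U ↔ e ∈ cutEdges A) := by
    rintro ⟨e, he⟩
    induction e using Sym2.ind with
    | _ a b =>
    rw [mem_cutEdges_iff (a := a) (b := b) rfl, mem_cutEdges_iff (a := a) (b := b) rfl,
      mem_cutEdges_iff (a := a) (b := b) rfl]
    simp only [mem_symmDiff]
    by_cases h1 : a ∈ U <;> by_cases h2 : a ∈ A <;> by_cases h3 : b ∈ U <;>
      by_cases h4 : b ∈ A <;> simp [h1, h2, h3, h4]
  have h1 := hmax (symmDiff U A) (by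
    intro e he
    rw [hcross]
    exact not_not.2 (iff_of_false (hU e he) (hA e (mem_union_left _ he))))
  have hfX : f ∉ X := fun h => hA f (mem_union_right _ h) hfA
  have h2 : insert f X ⊆ cutEdges (symmDiff U A) ∩ F := by
    intro e he
    rw [mem_insert] at he
    rw [mem_inter, hcross]
    rcases he with rfl | he
    · have : e ∉ cutEdges U := fun h => hfX (mem_inter.2 ⟨h, hfF⟩)
      exact ⟨fun hiff => this (hiff.2 hfA), hfF⟩
    · have h3 := hA e (mem_union_right _ he)
      have h4 := mem_inter.1 he
      exact ⟨fun hiff => h3 (hiff.1 h4.1), h4.2⟩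
  have h3 := card_le_card h2
  rw [card_insert_of_notMem hfX] at h3
  omega

/-- Half of the components make up a cut that respects `E`. -/
theorem exists_balanced_cut (E : Finset (KEdge n)) :
    ∃ U : Finset (Fin n), numComps E ≤ 2 * #U + 1 ∧ 2 * #U ≤ n ∧ ∀ e ∈ E, e ∉ cutEdges U := by
  classical
  have : Fintype (graphOf E).ConnectedComponent := Fintype.ofFinite _
  have hcard := numComps_le_card_connectedComponent E
  rw [Nat.card_eq_fintype_card] at hcard
  set s := Fintype.card (graphOf E).ConnectedComponent with hs
  -- A union of components has at least as many vertices as components. Taking half of the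
  -- components makes both sides large, and the smaller side is kept.
  obtain ⟨S, -, hS⟩ := exists_subset_card_eq
    (s := (univ : Finset (graphOf E).ConnectedComponent)) (n := s / 2)
    (by rw [card_univ]; omega)
  let pre : Finset (graphOf E).ConnectedComponent → Finset (Fin n) := fun S =>
    {x | (graphOf E).connectedComponentMk x ∈ S}
  have hpre : ∀ S, #S ≤ #(pre S) := by
    intro S
    have : S ⊆ (pre S).image (graphOf E).connectedComponentMk := by
      intro c hc
      induction c using SimpleGraph.ConnectedComponent.ind with
      | _ v => exact mem_image.2 ⟨v, by simpa [pre] using hc, rfl⟩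
    exact (card_le_card this).trans card_image_le
  have hcut : ∀ e ∈ E, e ∉ cutEdges (pre S) := by
    intro e he h
    obtain ⟨⟨x, hx, hxS⟩, y, hy, hyS⟩ := mem_cutEdges.1 h
    have := SimpleGraph.ConnectedComponent.sound (graphOf_reachable_of_mem he hx hy)
    simp only [pre, mem_filter, mem_univ, true_and] at hxS hyS
    rw [this] at hxS
    exact hyS hxS
  have hcompl : pre Sᶜ = (pre S)ᶜ := by ext x; simp [pre]
  have h1 := hpre S
  have h2 := hpre Sᶜ
  rw [card_compl, ← hs] at h2
  have hsum : #(pre S) + #(pre S)ᶜ = n := by rw [card_add_card_compl, Fintype.card_fin]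
  rw [hcompl] at h2
  rcases le_total #(pre S) #(pre S)ᶜ with hle | hle
  · exact ⟨pre S, by omega, by omega, hcut⟩
  · exact ⟨(pre S)ᶜ, by omega, by omega, by rwa [cutEdges_compl]⟩

end Cuts

/-! ### Rainbow spanning trees and the rank condition -/

section Rainbow

open Finset

variable {n k : ℕ}

open Classical in
/-- The first `m` edges, as a finset. -/
noncomputable def firstEdges (ω : Outcome n k) (m : ℕ) : Finset (KEdge n) := {e | e ∈ ω.edges m}

lemma mem_firstEdges {ω : Outcome n k} {m : ℕ} {e : KEdge n} :
    e ∈ firstEdges ω m ↔ e ∈ ω.edges m := by simp [firstEdges]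

lemma firstEdges_mono (ω : Outcome n k) {m m' : ℕ} (h : m ≤ m') :
    firstEdges ω m ⊆ firstEdges ω m' := by
  intro e he
  rw [mem_firstEdges, mem_edges_iff] at *
  omega

lemma graphOf_firstEdges (ω : Outcome n k) (m : ℕ) : graphOf (firstEdges ω m) = ω.graph m := by
  have : ((firstEdges ω m : Finset (KEdge n)) : Set (KEdge n)) = ω.edges m := by
    ext e; simp [mem_firstEdges]
  rw [graphOf, this, Outcome.graph]

/-- The edges among the first `m` that have a colour in `I`. -/
noncomputable def colouredEdges (ω : Outcome n k) (m : ℕ) (I : Finset (Fin (n - 1))) :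
    Finset (KEdge n) := {e ∈ firstEdges ω m | ¬ Disjoint (ω.colours e) I}

lemma mem_colouredEdges {ω : Outcome n k} {m : ℕ} {I : Finset (Fin (n - 1))} {e : KEdge n} :
    e ∈ colouredEdges ω m I ↔ e ∈ ω.edges m ∧ ¬ Disjoint (ω.colours e) I := by
  simp [colouredEdges, mem_firstEdges]

/-- If the edges coloured from any set `I` of colours have rank at least `|I|`, then there is a
rainbow spanning tree. -/
theorem hasRainbowTree_of_numComps (hn : 2 ≤ n) (ω : Outcome n k) (m : ℕ)
    (h : ∀ I : Finset (Fin (n - 1)), numComps (colouredEdges ω m I) + #I ≤ n) :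
    ω.HasRainbowTree m := by
  classical
  obtain ⟨f, hf, hr⟩ := exists_transversal_of_submodular
    (fun E : Finset (KEdge n) => n - numComps E)
    (fun E F hEF => Nat.sub_le_sub_left (numComps_anti hEF) _) (by simp [numComps_empty])
    (by
      intro A B
      have h1 := numComps_supermodular A B
      have h2 := numComps_le A
      have h3 := numComps_le B
      have h4 := numComps_le (A ∪ B)
      have h5 := numComps_le (A ∩ B)
      omega) (fun w => colouredEdges ω m {w}) (by
      intro I
      have : I.biUnion (fun w => colouredEdges ω m {w}) = colouredEdges ω m I := by
        ext e
        simp only [mem_biUnion, mem_colouredEdges, not_disjoint_iff, mem_singleton]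
        constructor
        · rintro ⟨w, hw, he, w', hw', rfl⟩; exact ⟨he, w', hw', hw⟩
        · rintro ⟨he, w, hw, hwI⟩; exact ⟨w, hwI, he, w, hw, rfl⟩
      rw [this]
      have := h I
      omega)
  have hNZ : NeZero n := ⟨by omega⟩
  set F : Finset (KEdge n) := univ.image f with hF
  -- The edges chosen by all n - 1 colours have rank n - 1, so they form a connected graph. Such a
  -- graph has at least n - 1 edges, so the choice is injective and the graph is a tree.
  have hu := hr univ
  rw [card_univ, Fintype.card_fin, ← hF] at hu
  have hconn : (graphOf F).Connected := connected_of_numComps_le_one (by omega)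
  have hEcard : Nat.card (graphOf F).edgeSet = #F := by
    rw [graphOf_edgeSet, Nat.card_image_of_injective Subtype.val_injective]
    simp
  have hFle : #F ≤ n - 1 := by
    refine card_image_le.trans ?_
    rw [card_univ, Fintype.card_fin]
  have hge := hconn.card_vert_le_card_edgeSet_add_one
  rw [hEcard, Nat.card_eq_fintype_card, Fintype.card_fin] at hge
  have htree : (graphOf F).IsTree := by
    rw [SimpleGraph.isTree_iff_connected_and_card]
    refine ⟨hconn, ?_⟩
    rw [hEcard, Nat.card_eq_fintype_card, Fintype.card_fin]
    omega
  have hinj : Function.Injective f := by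
    rw [← Set.injOn_univ, ← coe_univ, ← card_image_iff, ← hF, card_univ, Fintype.card_fin]
    omega
  have hNe : Nonempty (Fin (n - 1)) := ⟨⟨0, by omega⟩⟩
  have hmemT : ∀ e : KEdge n, (e : Sym2 (Fin n)) ∈ (graphOf F).edgeSet → ∃ w, f w = e := by
    intro e he
    rw [graphOf_edgeSet] at he
    obtain ⟨e', he', heq⟩ := he
    rw [Subtype.val_injective heq] at he'
    simpa [hF] using he'
  -- The inverse of the transversal gives each tree edge the colour that chose it.
  refine ⟨graphOf F, ?_, htree, Function.invFun f, ?_, ?_⟩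
  · rw [← graphOf_firstEdges]
    refine SimpleGraph.fromEdgeSet_mono (Set.image_mono ?_)
    intro e he
    simp only [hF, coe_image, coe_univ, Set.image_univ, Set.mem_range] at he
    obtain ⟨w, rfl⟩ := he
    exact mem_firstEdges.2 (mem_colouredEdges.1 (hf w)).1
  · intro e he e' he' heq
    obtain ⟨w, rfl⟩ := hmemT e he
    obtain ⟨w', rfl⟩ := hmemT e' he'
    rw [Function.leftInverse_invFun hinj w, Function.leftInverse_invFun hinj w'] at heq
    rw [heq]
  · intro e he
    obtain ⟨w, rfl⟩ := hmemT e he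
    rw [Function.leftInverse_invFun hinj w]
    have := (mem_colouredEdges.1 (hf w)).2
    rw [not_disjoint_iff] at this
    obtain ⟨w', h1, h2⟩ := this
    rwa [mem_singleton.1 h2] at h1

lemma isConn_of_hasRainbowTree {ω : Outcome n k} {m : ℕ} (h : ω.HasRainbowTree m) : ω.IsConn m := by
  obtain ⟨T, hT, htree, -⟩ := h
  exact htree.connected.mono hT

/-- There are as many tree edges as colours, so an injective choice of colours is onto. -/
lemma allColours_of_hasRainbowTree {ω : Outcome n k} {m : ℕ} (h : ω.HasRainbowTree m) :
    ω.AllColours m := by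
  classical
  obtain ⟨T, hT, htree, f, hinj, hf⟩ := h
  have hcard := (SimpleGraph.isTree_iff_connected_and_card.1 htree).2
  rw [Nat.card_eq_fintype_card (α := Fin n), Fintype.card_fin] at hcard
  set S : Finset (KEdge n) := {e | (e : Sym2 (Fin n)) ∈ T.edgeSet} with hS
  have hSc : #S = n - 1 := by
    have h1 : Nat.card T.edgeSet = #S := by
      have : T.edgeSet = Subtype.val '' (S : Set (KEdge n)) := by
        ext e
        simp only [hS, coe_filter, mem_univ, true_and, Set.mem_image, Set.mem_ofPred_eq]
        constructor
        · intro he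
          exact ⟨⟨e, SimpleGraph.edgeSet_mono le_top he⟩, he, rfl⟩
        · rintro ⟨e', he', rfl⟩; exact he'
      rw [this, Nat.card_image_of_injective Subtype.val_injective]
      simp
    omega
  have himg : S.image f = univ := by
    rw [← card_eq_iff_eq_univ, card_image_of_injOn, hSc, Fintype.card_fin]
    intro e he e' he' h
    exact hinj (by simpa [hS] using he) (by simpa [hS] using he') h
  intro w
  have hw : w ∈ S.image f := himg ▸ mem_univ w
  obtain ⟨e, he, rfl⟩ := mem_image.1 hw
  have heT : (e : Sym2 (Fin n)) ∈ T.edgeSet := by simpa [hS] using he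
  refine ⟨e, ?_, hf e heT⟩
  have := SimpleGraph.edgeSet_mono hT heT
  rw [← graphOf_firstEdges, graphOf_edgeSet] at this
  obtain ⟨e', he', heq⟩ := this
  rw [Subtype.val_injective heq] at he'
  exact mem_firstEdges.1 he'

end Rainbow

/-! ### The structure of a minimal violating colour set -/

section MinimalViolation

open Finset

variable {n k : ℕ}

/-- An edge set that covers `V`, in which every edge outside `D` meets another edge, covers at most
`3/2` vertices per edge outside `D`. -/
lemma two_mul_card_cover_le {T D : Finset (KEdge n)} (hD : D ⊆ T) {V : Finset (Fin n)}
    (hV : ∀ x ∈ V, ∃ e ∈ T, x ∈ (e : Sym2 (Fin n)))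
    (h : ∀ e ∈ T, e ∉ D → ∃ x ∈ (e : Sym2 (Fin n)), ∃ f ∈ T, f ≠ e ∧ x ∈ (f : Sym2 (Fin n))) :
    2 * #V ≤ 3 * #T + #D := by
  classical
  let deg : Fin n → ℕ := fun x => #(T.filter fun e : KEdge n => x ∈ (e : Sym2 (Fin n)))
  have hdeg : ∀ e ∈ T, ∀ x ∈ (e : Sym2 (Fin n)), 1 ≤ deg x := fun e he x hx =>
    card_pos.2 ⟨e, mem_filter.2 ⟨he, hx⟩⟩
  -- Every vertex of `V` splits a unit weight evenly among the edges of `T` at it. An edge collects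
  -- at most 2, and at most 3/2 if one of its ends lies on another edge of `T`.
  have h1 : (#V : ℚ) = ∑ e ∈ T, ∑ x ∈ V with x ∈ (e : Sym2 (Fin n)), (1 : ℚ) / deg x := by
    have : ∀ x ∈ V, (1 : ℚ) = ∑ _e ∈ T.filter (fun e : KEdge n => x ∈ (e : Sym2 (Fin n))),
        (1 : ℚ) / deg x := by
      intro x hx
      obtain ⟨e, he, hxe⟩ := hV x hx
      have hpos : (0 : ℚ) < deg x := by exact_mod_cast hdeg e he x hxe
      rw [sum_const, nsmul_eq_mul, mul_one_div, eq_comm, div_eq_one_iff_eq hpos.ne']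
    rw [card_eq_sum_ones, Nat.cast_sum, Nat.cast_one, sum_congr rfl this]
    simp only [sum_filter]
    exact sum_comm
  have h2 : ∀ e ∈ T, ∑ x ∈ V with x ∈ (e : Sym2 (Fin n)), (1 : ℚ) / deg x ≤
      3 / 2 + (if e ∈ D then 1 / 2 else 0) := by
    intro e he
    obtain ⟨a, b, hab⟩ : ∃ a b, (e : Sym2 (Fin n)) = s(a, b) := by
      induction hs : (e : Sym2 (Fin n)) using Sym2.ind with
      | _ a b => exact ⟨a, b, rfl⟩
    have hne : a ≠ b := by
      have := e.2
      rw [hab] at this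
      simpa using this
    have hsub : ({x ∈ V | x ∈ (e : Sym2 (Fin n))} : Finset (Fin n)) ⊆ {a, b} := by
      intro x hx
      have := (mem_filter.1 hx).2
      rw [hab, Sym2.mem_iff] at this
      simpa using this
    have hle : ∑ x ∈ V with x ∈ (e : Sym2 (Fin n)), (1 : ℚ) / deg x ≤ 1 / deg a + 1 / deg b := by
      refine (sum_le_sum_of_subset_of_nonneg hsub fun x _ _ => by positivity).trans ?_
      rw [sum_pair hne]
    have hone : ∀ x ∈ (e : Sym2 (Fin n)), (1 : ℚ) / deg x ≤ 1 := by
      intro x hx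
      have : (1 : ℚ) ≤ deg x := by exact_mod_cast hdeg e he x hx
      rw [div_le_one (by linarith)]; exact this
    have ha := hone a (by simp [hab])
    have hb := hone b (by simp [hab])
    by_cases heD : e ∈ D
    · simp only [heD, if_true]; linarith
    · simp only [heD, if_false]
      obtain ⟨x, hx, f, hf, hfe, hxf⟩ := h e he heD
      have h2deg : (2 : ℚ) ≤ deg x := by
        have : 1 < deg x := one_lt_card.2
          ⟨e, mem_filter.2 ⟨he, hx⟩, f, mem_filter.2 ⟨hf, hxf⟩, hfe.symm⟩
        exact_mod_cast this
      have hhalf : (1 : ℚ) / deg x ≤ 1 / 2 := one_div_le_one_div_of_le (by norm_num) h2deg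
      rw [hab, Sym2.mem_iff] at hx
      rcases hx with rfl | rfl <;> linarith
  have h3 : (#V : ℚ) ≤ 3 / 2 * #T + 1 / 2 * #D := by
    rw [h1]
    refine (sum_le_sum h2).trans (le_of_eq ?_)
    rw [sum_add_distrib, sum_const, ← sum_filter, sum_const, filter_mem_eq_inter,
      inter_eq_right.2 hD, nsmul_eq_mul, nsmul_eq_mul]
    ring
  have : (2 * #V : ℚ) ≤ 3 * #T + #D := by linarith
  exact_mod_cast this

/-- The structure of a minimal set of colours whose edges have too small a rank. -/
theorem exists_sparse_witness (ω : Outcome n k) (m : ℕ) (I : Finset (Fin (n - 1)))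
    (hI : n < numComps (colouredEdges ω m I) + #I)
    (hmin : ∀ w ∈ I, numComps (colouredEdges ω m (I.erase w)) + (#I - 1) ≤ n) :
    ∃ T ⊆ colouredEdges ω m I, ∃ D ⊆ T, ∃ V : Finset (Fin n), #T + 1 = #I ∧
      (∀ e ∈ colouredEdges ω m I, ∀ x ∈ (e : Sym2 (Fin n)), x ∈ V) ∧
      (∀ e ∈ D, 2 ≤ #(ω.colours e ∩ I)) ∧ 2 * #V ≤ 3 * #T + #D := by
  classical
  set E := colouredEdges ω m I with hE
  have hsub : ∀ w, colouredEdges ω m (I.erase w) ⊆ E := by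
    intro w e he
    rw [mem_colouredEdges] at he
    rw [hE, mem_colouredEdges]
    exact ⟨he.1, fun h => he.2 (h.mono_right (erase_subset _ _))⟩
  have hIne : I.Nonempty := by
    rw [nonempty_iff_ne_empty]
    rintro rfl
    have := numComps_le E
    simp at hI
    omega
  obtain ⟨w₀, hw₀⟩ := hIne
  obtain ⟨T, hT, hTcard, hTspace⟩ := exists_basis E
  -- By minimality, `I.erase w` satisfies the rank condition, so its edges leave at most n - |I| + 1
  -- components, no more than those of `E`. Dropping any one colour therefore keeps the cut space.
  have hspace : ∀ w ∈ I, cutSpace (colouredEdges ω m (I.erase w)) = cutSpace E := by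
    intro w hw
    refine (Submodule.eq_of_le_of_finrank_le (cutSpace_anti (hsub w)) ?_).symm
    have := hmin w hw
    have : 0 < #I := card_pos.2 ⟨w, hw⟩
    change numComps _ ≤ numComps _
    omega
  have h0 := hmin w₀ hw₀
  have h0' := numComps_anti (hsub w₀)
  have hIpos : 0 < #I := card_pos.2 ⟨w₀, hw₀⟩
  refine ⟨T, hT, {e ∈ T | 2 ≤ #(ω.colours e ∩ I)}, filter_subset _ _,
    univ.filter fun x => ∃ e ∈ T, x ∈ (e : Sym2 (Fin n)), by omega, ?_, ?_, ?_⟩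
  · intro e he x hx
    by_contra hxV
    simp only [mem_filter, mem_univ, true_and, not_exists, not_and] at hxV
    -- A vertex missed by `T` is isolated in `T`, hence also in `E`, which has the same cut space.
    have hg : (Pi.single x 1 : Fin n → ℚ) ∈ cutSpace E := by
      rw [← hTspace]
      intro f hf a ha b hb
      have hax : a ≠ x := fun h => hxV f hf (h ▸ ha)
      have hbx : b ≠ x := fun h => hxV f hf (h ▸ hb)
      simp [hax, hbx]
    obtain ⟨y, hy⟩ := Sym2.mem_iff_exists.1 hx
    have hxy : y ≠ x := by
      have := e.2
      rw [hy] at this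
      simpa [eq_comm] using this
    have := hg e he x hx y (by rw [hy]; simp)
    simp [hxy] at this
  · intro e he; exact (mem_filter.1 he).2
  · refine two_mul_card_cover_le (filter_subset _ _) (fun x hx => by simpa using hx) ?_
    intro e he heD
    -- Suppose that e meets no other edge of `T` and has a single colour w in `I`. Then the two ends
    -- of e form a whole component of `E`, with no other edge; once w is dropped they are isolated,
    -- so the cut space grows, contrary to minimality.
    by_contra hcon
    push Not at hcon
    refine heD (mem_filter.2 ⟨he, ?_⟩)
    have heE := hT he
    have hnd := (mem_colouredEdges.1 heE).2
    rw [not_disjoint_iff] at hnd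
    obtain ⟨w, hwe, hwI⟩ := hnd
    by_contra hlt
    have hone : ∀ v ∈ ω.colours e ∩ I, v = w := fun v hv =>
      card_le_one.1 (by omega) v hv w (mem_inter.2 ⟨hwe, hwI⟩)
    have he' : e ∉ colouredEdges ω m (I.erase w) := by
      intro h
      have h := (mem_colouredEdges.1 h).2
      rw [not_disjoint_iff] at h
      obtain ⟨v, hv, hvI⟩ := h
      rw [mem_erase] at hvI
      exact hvI.1 (hone v (mem_inter.2 ⟨hv, hvI.2⟩))
    have hgT : (fun z => if z ∈ (e : Sym2 (Fin n)) then 1 else 0 : Fin n → ℚ) ∈ cutSpace E := by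
      rw [← hTspace]
      intro f hf a ha b hb
      by_cases hfe : f = e
      · subst hfe; simp [ha, hb]
      · have hna : a ∉ (e : Sym2 (Fin n)) := fun h => hcon a h f hf hfe ha
        have hnb : b ∉ (e : Sym2 (Fin n)) := fun h => hcon b h f hf hfe hb
        simp [hna, hnb]
    obtain ⟨a, b, hab⟩ : ∃ a b, (e : Sym2 (Fin n)) = s(a, b) := by
      induction hs : (e : Sym2 (Fin n)) using Sym2.ind with
      | _ a b => exact ⟨a, b, rfl⟩
    have hne : a ≠ b := by
      have := e.2
      rw [hab] at this
      simpa using this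
    have hga : (Pi.single a 1 : Fin n → ℚ) ∈ cutSpace E := by
      rw [← hspace w hwI]
      have : ∀ f ∈ colouredEdges ω m (I.erase w), a ∉ (f : Sym2 (Fin n)) := by
        intro f hf haf
        have hfE := hsub w hf
        obtain ⟨c, hc⟩ := Sym2.mem_iff_exists.1 haf
        have hac : a ≠ c := by
          have := f.2
          rw [hc] at this
          simpa using this
        have h3 := hgT f hfE a haf c (by rw [hc]; simp)
        have hae : a ∈ (e : Sym2 (Fin n)) := by simp [hab]
        have hce : c ∈ (e : Sym2 (Fin n)) := by
          by_contra hce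
          simp [hae, hce] at h3
        have : f = e := Subtype.ext
          (hc.trans ((Sym2.mem_and_mem_iff hac).1 ⟨hae, hce⟩).symm)
        exact he' (this ▸ hf)
      intro f hf x hx y hy
      have hxa : x ≠ a := fun h => this f hf (h ▸ hx)
      have hya : y ≠ a := fun h => this f hf (h ▸ hy)
      simp [hxa, hya]
    have := hga e heE a (by simp [hab]) b (by simp [hab])
    simp [hne.symm] at this

end MinimalViolation

/-! ### The bad events and their union bounds -/

section BadEvents

open Finset

variable {n k : ℕ}

open Classical in
/-- The edges with both ends in `V`. -/
noncomputable def edgesInside (V : Finset (Fin n)) : Finset (KEdge n) :=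
  {e | ∀ x ∈ (e : Sym2 (Fin n)), x ∈ V}

lemma mem_edgesInside {V : Finset (Fin n)} {e : KEdge n} :
    e ∈ edgesInside V ↔ ∀ x ∈ (e : Sym2 (Fin n)), x ∈ V := by simp [edgesInside]

lemma card_edgesInside_le (V : Finset (Fin n)) : #(edgesInside V) ≤ #V ^ 2 := by
  rw [sq, ← card_product]
  refine card_le_card_of_injOn (fun e : KEdge n => Quot.out (e : Sym2 (Fin n))) ?_ ?_
  · intro e he
    have h := mem_edgesInside.1 he
    exact mem_product.2 ⟨h _ (Sym2.out_fst_mem _), h _ (Sym2.out_snd_mem _)⟩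
  · intro e _ e' _ h
    refine Subtype.ext ?_
    rw [← Quot.out_eq (e : Sym2 (Fin n)), ← Quot.out_eq (e' : Sym2 (Fin n))]
    exact congrArg _ h

/-- A small set of colours `I` is confined to a small set of vertices. -/
def ConfinedColours (ω : Outcome n k) (m₀ m₁ : ℕ) (I : Finset (Fin (n - 1)))
    (T D : Finset (KEdge n)) (V : Finset (Fin n)) : Prop :=
  (∀ e ∈ T, e ∈ ω.edges m₁ ∧ (if e ∈ D then 2 ≤ #(ω.colours e ∩ I) else
    ¬ Disjoint (ω.colours e) I)) ∧
  ∀ e ∈ (edgesInside V)ᶜ, e ∈ ω.edges m₀ → ¬ ¬ Disjoint (ω.colours e) I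

/-- All early edges that cross `U` avoid the colours `I`. -/
def AvoidedCut (ω : Outcome n k) (m₀ : ℕ) (I : Finset (Fin (n - 1))) (U : Finset (Fin n)) : Prop :=
  ∀ e ∈ cutEdges U, e ∈ ω.edges m₀ → Disjoint (ω.colours e) I

/-- Here d counts the edges of `T` with two colours in `I`. The set `V` has exactly the largest size
that `exists_sparse_witness` allows, since a smaller cover can be padded; this removes one
summation. -/
def SmallColourSetBad (n k m₀ m₁ b : ℕ) : Set (Outcome n k) :=
  {ω | ∃ i ∈ Icc 2 b, ∃ I ∈ powersetCard i (univ : Finset (Fin (n - 1))), ∃ d ∈ range i,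
    ∃ V ∈ powersetCard ((3 * (i - 1) + d) / 2) (univ : Finset (Fin n)),
    ∃ T ∈ powersetCard (i - 1) (edgesInside V), ∃ D ∈ powersetCard d T,
      ω ∈ {ω | ConfinedColours ω m₀ m₁ I T D V}}

/-- A violating `I` leaves at least n - |I| + 1 components; the lower bound on |U| is what
`exists_balanced_cut` makes of this. -/
def BalancedCutBad (n k m₀ b : ℕ) : Set (Outcome n k) :=
  {ω | ∃ I ∈ ({I | b < #I ∧ b < n - 1 - #I} : Finset (Finset (Fin (n - 1)))),
    ∃ U ∈ ({U | n - 1 - #I + 1 ≤ 2 * #U ∧ 2 * #U ≤ n} : Finset (Finset (Fin n))),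
      ω ∈ {ω | AvoidedCut ω m₀ I U}}

/-- The number j counts the colours outside `I`. A violating `I` leaves at least j + 2 components,
so `exists_large_cut` provides j + 1 crossing edges, collected in `X`. -/
def LargeColourSetBad (n k m₀ m₁ b : ℕ) : Set (Outcome n k) :=
  {ω | ∃ j ∈ range (b + 1), ∃ I ∈ powersetCard (n - 1 - j) (univ : Finset (Fin (n - 1))),
    ∃ u ∈ Icc 1 (n / 2), ∃ U ∈ powersetCard u (univ : Finset (Fin n)),
    ∃ X ∈ powersetCard (j + 1) (cutEdges U),
      ω ∈ {ω | (∀ e ∈ X, e ∈ ω.edges m₁ ∧ Disjoint (ω.colours e) I) ∧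
        ∀ e ∈ cutEdges U \ X, e ∈ ω.edges m₀ → ¬ ¬ Disjoint (ω.colours e) I}}

theorem hasRainbowTree_of_good {ω : Outcome n k} {m₀ m₁ b m : ℕ} (hn : 2 ≤ n) (hb : 2 * b ≤ n)
    (h0 : m₀ ≤ m) (h1 : m ≤ m₁) (hconn : ω.IsConn m) (hall : ω.AllColours m)
    (hA : ω ∉ SmallColourSetBad n k m₀ m₁ b) (hB : ω ∉ BalancedCutBad n k m₀ b)
    (hC : ω ∉ LargeColourSetBad n k m₀ m₁ b) : ω.HasRainbowTree m := by
  classical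
  by_contra hR
  have hex : ∃ I : Finset (Fin (n - 1)), n < numComps (colouredEdges ω m I) + #I := by
    by_contra hcon
    push Not at hcon
    exact hR (hasRainbowTree_of_numComps hn ω m hcon)
  obtain ⟨I₀, hI₀⟩ := hex
  obtain ⟨I, hI, hImin⟩ := exists_min_image
    (univ.filter fun I : Finset (Fin (n - 1)) => n < numComps (colouredEdges ω m I) + #I) card
    ⟨I₀, by simpa using hI₀⟩
  simp only [mem_filter, mem_univ, true_and] at hI hImin
  have hcardI : #I ≤ n - 1 := by simpa using card_le_univ I
  have he01 : ∀ e, e ∈ ω.edges m₀ → e ∈ ω.edges m := fun e he =>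
    mem_firstEdges.1 (firstEdges_mono ω h0 (mem_firstEdges.2 he))
  have he12 : ∀ e, e ∈ ω.edges m → e ∈ ω.edges m₁ := fun e he =>
    mem_firstEdges.1 (firstEdges_mono ω h1 (mem_firstEdges.2 he))
  have hdisj : ∀ e ∈ ω.edges m, e ∉ colouredEdges ω m I → Disjoint (ω.colours e) I := by
    intro e he hne
    by_contra hd
    exact hne (mem_colouredEdges.2 ⟨he, hd⟩)
  rcases le_or_gt #I b with hIb | hIb
  · obtain ⟨T, hT, D, hD, V, hTI, hV, hD2, hcard⟩ := exists_sparse_witness ω m I hI (by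
      intro w hw
      by_contra hlt
      have hc := card_erase_of_mem hw
      have := hImin (I.erase w) (by omega)
      have : 0 < #I := card_pos.2 ⟨w, hw⟩
      omega)
    -- For a single colour, the forest `T` and the vertex set `V` would be empty, although the
    -- colour does occur on some edge.
    have hI2 : 2 ≤ #I := by
      by_contra hlt
      have hT0 : #T = 0 := by omega
      have hD0 : #D = 0 := by have := card_le_card hD; omega
      have hV0 : V = ∅ := card_eq_zero.1 (by omega)
      obtain ⟨w, hw⟩ := card_pos.1 (by omega : 0 < #I)
      obtain ⟨e, he, hwe⟩ := hall w
      obtain ⟨x, hx⟩ : ∃ x, x ∈ (e : Sym2 (Fin n)) := ⟨_, Sym2.out_fst_mem _⟩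
      have := hV e (mem_colouredEdges.2 ⟨he, not_disjoint_iff.2 ⟨w, hwe, hw⟩⟩) x hx
      simp [hV0] at this
    have hDT := card_le_card hD
    obtain ⟨V', hVV', hV'⟩ := exists_superset_card_eq (s := V) (n := (3 * (#I - 1) + #D) / 2)
      (by omega) (by rw [Fintype.card_fin]; omega)
    refine hA ⟨#I, mem_Icc.2 ⟨hI2, hIb⟩, I, by simp, #D, mem_range.2 (by omega), V', by simp [hV'],
      T, ?_, D, mem_powersetCard.2 ⟨hD, rfl⟩, ?_, ?_⟩
    · refine mem_powersetCard.2 ⟨fun e he => mem_edgesInside.2 fun x hx => ?_, by omega⟩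
      exact hVV' (hV e (hT he) x hx)
    · intro e he
      have h := mem_colouredEdges.1 (hT he)
      refine ⟨he12 e h.1, ?_⟩
      split_ifs with heD
      · exact hD2 e heD
      · exact h.2
    · intro e he hem
      -- The double negation in the event comes from the form `¬ B` in `processLaw_real_le`, with
      -- `B` the property of meeting `I`.
      refine not_not.2 (hdisj e (he01 e hem) fun hcol => ?_)
      rw [mem_compl, mem_edgesInside] at he
      exact he fun x hx => hVV' (hV e hcol x hx)
  rcases le_or_gt (n - 1 - #I) b with hJb | hJb
  · obtain ⟨U, hU1, hU2, hU3, hU4⟩ := exists_large_cut (E := colouredEdges ω m I)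
      (F := firstEdges ω m) (by rw [graphOf_firstEdges]; exact hconn) (by omega)
    obtain ⟨X, hX, hXc⟩ := exists_subset_card_eq (s := cutEdges U ∩ firstEdges ω m)
      (n := n - 1 - #I + 1) (by omega)
    refine hC ⟨n - 1 - #I, mem_range.2 (by omega), I, by simp; omega, #U,
      mem_Icc.2 ⟨hU1, by omega⟩, U, by simp, X,
      mem_powersetCard.2 ⟨hX.trans inter_subset_left, hXc⟩, ?_, ?_⟩
    · intro e he
      have h := mem_inter.1 (hX he)
      have hem := mem_firstEdges.1 h.2
      exact ⟨he12 e hem, hdisj e hem fun hcol => hU3 e hcol h.1⟩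
    · intro e he hem
      refine not_not.2 (hdisj e (he01 e hem) fun hcol => hU3 e hcol (mem_sdiff.1 he).1)
  · obtain ⟨U, hU1, hU2, hU3⟩ := exists_balanced_cut (colouredEdges ω m I)
    refine hB ⟨I, by simp [hIb, hJb], U, by simp only [mem_filter, mem_univ, true_and]; omega, ?_⟩
    intro e he hem
    exact hdisj e (he01 e hem) fun hcol => hU3 e hcol he

lemma measureReal_exists_le_sum {Ω ι : Type*} [MeasurableSpace Ω] (μ : Measure Ω)
    [IsFiniteMeasure μ] (s : Finset ι) (F : ι → Set Ω) (B : ι → ℝ)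
    (h : ∀ a ∈ s, μ.real (F a) ≤ B a) : μ.real {ω | ∃ a ∈ s, ω ∈ F a} ≤ ∑ a ∈ s, B a := by
  have : {ω | ∃ a ∈ s, ω ∈ F a} = ⋃ a ∈ s, F a := by ext; simp
  rw [this]
  exact (measureReal_biUnion_finset_le s F).trans (sum_le_sum h)

lemma measureReal_exists_le_card_mul {Ω ι : Type*} [MeasurableSpace Ω] (μ : Measure Ω)
    [IsFiniteMeasure μ] (s : Finset ι) (F : ι → Set Ω) (B : ℝ)
    (h : ∀ a ∈ s, μ.real (F a) ≤ B) : μ.real {ω | ∃ a ∈ s, ω ∈ F a} ≤ #s * B := by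
  refine (measureReal_exists_le_sum μ s F (fun _ => B) h).trans (le_of_eq ?_)
  rw [sum_const, nsmul_eq_mul]

lemma le_colourProb_not_disjoint (hk : 2 ≤ k) (hkn : k ≤ n - 1) (I : Finset (Fin (n - 1))) :
    1 - (((n - 1 - #I : ℕ) : ℝ) / (n - 1 : ℕ)) ^ 2 ≤ colourProb n k (fun S => ¬ Disjoint S I) := by
  have h1 := colourProb_add_not (n := n) (k := k) hkn (fun S => Disjoint S I)
  have h2 := colourProb_disjoint_le hk hkn I
  linarith

/-- The sums follow the quantifiers of the event. In the exponent i - 1 + d, every edge of `T` pays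
ki/(n - 1) once and every edge of `D` once more. `G` is any lower bound for the vacancy exponent, so
that the asymptotics can be done separately. -/
theorem smallColourSetBad_le (hk : 2 ≤ k) (hkn : k ≤ n - 1) {m₀ m₁ b : ℕ} (hb : b ≤ m₀)
    (hm0 : m₀ ≤ n.choose 2) (hm1 : m₁ ≤ n.choose 2) (G : ℕ → ℝ)
    (hG : ∀ i ∈ Icc 2 b, ∀ v z : ℝ, v ≤ 2 * i → 0 ≤ v →
      z = ((m₀ : ℝ) - (i - 1 : ℕ)) / (n.choose 2 : ℕ) →
      G i ≤ ((n.choose 2 : ℕ) - v ^ 2) * (1 - (((n - 1 - i : ℕ) : ℝ) / (n - 1 : ℕ)) ^ 2) *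
        (z - z ^ 2 / 2)) :
    (processLaw n k).real (SmallColourSetBad n k m₀ m₁ b) ≤
      ∑ i ∈ Icc 2 b, ((n - 1).choose i : ℝ) * ∑ d ∈ range i,
        (n.choose ((3 * (i - 1) + d) / 2) : ℝ) *
        (((((3 * (i - 1) + d) / 2) ^ 2).choose (i - 1) : ℝ) * (((i - 1).choose d : ℝ) *
        (((m₁ : ℝ) / (n.choose 2 : ℕ)) ^ (i - 1) * ((k * i : ℝ) / (n - 1 : ℕ)) ^ (i - 1 + d) *
          Real.exp (-G i)))) := by
  classical
  have := isProbabilityMeasure_processLaw hkn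
  refine measureReal_exists_le_sum _ _ _ _ fun i hi => ?_
  have hi' := mem_Icc.1 hi
  have hcI : (n - 1).choose i = #(powersetCard i (univ : Finset (Fin (n - 1)))) := by simp
  rw [hcI]
  refine measureReal_exists_le_card_mul _ _ _ _ fun I hI => measureReal_exists_le_sum _ _ _ _
    fun d hd => ?_
  have hcV : n.choose ((3 * (i - 1) + d) / 2) =
    #(powersetCard ((3 * (i - 1) + d) / 2) (univ : Finset (Fin n))) := by simp
  rw [hcV]
  refine measureReal_exists_le_card_mul _ _ _ _ fun V hV => ?_
  rw [mem_powersetCard] at hI hV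
  have hdr := mem_range.1 hd
  refine (measureReal_exists_le_card_mul _ _ _ (((i - 1).choose d : ℝ) *
        (((m₁ : ℝ) / (n.choose 2 : ℕ)) ^ (i - 1) * ((k * i : ℝ) / (n - 1 : ℕ)) ^ (i - 1 + d) *
          Real.exp (-G i))) fun T hT => ?_).trans ?_
  · rw [mem_powersetCard] at hT
    refine (measureReal_exists_le_card_mul _ _ _ (((m₁ : ℝ) / (n.choose 2 : ℕ)) ^ (i - 1) *
      ((k * i : ℝ) / (n - 1 : ℕ)) ^ (i - 1 + d) * Real.exp (-G i)) fun D hD => ?_).trans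
      (le_of_eq (by rw [card_powersetCard, hT.2]))
    rw [mem_powersetCard] at hD
    have hdisj : Disjoint T (edgesInside V)ᶜ := disjoint_compl_right.mono_left hT.1
    refine (processLaw_real_le hkn T (edgesInside V)ᶜ hdisj m₀ m₁ (by omega) hm0 hm1
      (fun e S => if e ∈ D then 2 ≤ #(S ∩ I) else ¬ Disjoint S I) (fun S => ¬ Disjoint S I)
      _ rfl).trans ?_
    have hy : (0 : ℝ) ≤ (k * i : ℝ) / (n - 1 : ℕ) := by positivity
    rw [hT.2]
    refine mul_le_mul (mul_le_mul_of_nonneg_left ?_ (by positivity)) ?_ (Real.exp_pos _).le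
      (by positivity)
    · calc ∏ e ∈ T, colourProb n k (fun S => if e ∈ D then 2 ≤ #(S ∩ I) else ¬ Disjoint S I)
          ≤ ∏ e ∈ T, ((k * i : ℝ) / (n - 1 : ℕ) *
            if e ∈ D then (k * i : ℝ) / (n - 1 : ℕ) else 1) := by
            refine prod_le_prod (fun e _ => colourProb_nonneg _) fun e _ => ?_
            by_cases heD : e ∈ D
            · simp only [heD, if_true]
              refine (colourProb_two_le_card_inter_le hk hkn I).trans (le_of_eq ?_)
              rw [hI.2, sq]
            · simp only [heD, if_false, mul_one]
              refine (colourProb_not_disjoint_le (by omega) hkn I).trans (le_of_eq ?_)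
              rw [hI.2]
        _ = _ := by
            rw [prod_mul_distrib, prod_const, hT.2, prod_ite_mem, inter_eq_right.2 hD.1,
              prod_const, hD.2, pow_add]
    · refine Real.exp_le_exp.2 (neg_le_neg ?_)
      set z : ℝ := ((m₀ : ℝ) - (i - 1 : ℕ)) / (n.choose 2 : ℕ) with hz
      have hvle : ((#V : ℕ) : ℝ) ≤ 2 * i := by
        rw [hV.2]
        have : (3 * (i - 1) + d) / 2 ≤ 2 * i := by omega
        exact_mod_cast this
      refine (hG i hi #V z hvle (by positivity) hz).trans ?_
      have hNpos : (0 : ℝ) < (n.choose 2 : ℕ) := by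
        exact_mod_cast (by omega : 0 < n.choose 2)
      have hz0 : 0 ≤ z := by
        refine div_nonneg ?_ hNpos.le
        have : ((i - 1 : ℕ) : ℝ) ≤ m₀ := by exact_mod_cast (by omega : i - 1 ≤ m₀)
        linarith
      have hz1 : z ≤ 1 := by
        rw [hz, div_le_one hNpos]
        have : (m₀ : ℝ) ≤ (n.choose 2 : ℕ) := by exact_mod_cast hm0
        have h2 : (0 : ℝ) ≤ (i - 1 : ℕ) := Nat.cast_nonneg _
        linarith
      have hzz : 0 ≤ z - z ^ 2 / 2 := by nlinarith
      refine mul_le_mul_of_nonneg_right ?_ hzz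
      have hp := le_colourProb_not_disjoint hk hkn I
      rw [hI.2] at hp
      have hp0 : 0 ≤ 1 - (((n - 1 - i : ℕ) : ℝ) / (n - 1 : ℕ)) ^ 2 := by
        have : ((n - 1 - i : ℕ) : ℝ) / (n - 1 : ℕ) ≤ 1 :=
          div_le_one_of_le₀ (by exact_mod_cast Nat.sub_le _ _) (by positivity)
        have h0 : (0 : ℝ) ≤ ((n - 1 - i : ℕ) : ℝ) / (n - 1 : ℕ) := by positivity
        nlinarith
      refine mul_le_mul ?_ hp hp0 (by positivity)
      have hc : #(edgesInside V) + #((edgesInside V)ᶜ) = n.choose 2 := by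
        rw [card_add_card_compl, card_KEdge]
      have hc' : (#(edgesInside V) : ℝ) + #((edgesInside V)ᶜ) = (n.choose 2 : ℕ) := by
        exact_mod_cast hc
      have hle : (#(edgesInside V) : ℝ) ≤ (#V : ℝ) ^ 2 := by
        exact_mod_cast card_edgesInside_le V
      linarith
  · refine mul_le_mul_of_nonneg_right ?_ (by positivity)
    rw [card_powersetCard]
    have : #(edgesInside V) ≤ ((3 * (i - 1) + d) / 2) ^ 2 := by
      rw [← hV.2]; exact card_edgesInside_le V
    exact_mod_cast Nat.choose_le_choose _ this

/-- No edge has to be present, and the crude count of 2^n colour sets and 2^n vertex sets suffices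
for the exponent of `balanced_exponent`. -/
theorem balancedCutBad_le (hk : 2 ≤ k) (hkn : k ≤ n - 1) {m₀ b : ℕ} (hm0 : m₀ ≤ n.choose 2)
    (G z : ℝ) (hz : z = (m₀ : ℝ) / (n.choose 2 : ℕ))
    (hG : ∀ i u : ℕ, b < i → b < n - 1 - i → n - 1 - i + 1 ≤ 2 * u → 2 * u ≤ n →
      G ≤ (u * (n - u : ℕ) : ℝ) * (1 - (((n - 1 - i : ℕ) : ℝ) / (n - 1 : ℕ)) ^ 2) *
        (z - z ^ 2 / 2)) :
    (processLaw n k).real (BalancedCutBad n k m₀ b) ≤ 2 ^ n * (2 ^ n * Real.exp (-G)) := by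
  classical
  have := isProbabilityMeasure_processLaw hkn
  refine (measureReal_exists_le_card_mul _ _ _ (2 ^ n * Real.exp (-G)) fun I hI => ?_).trans ?_
  · refine (measureReal_exists_le_card_mul _ _ _ (Real.exp (-G)) fun U hU => ?_).trans ?_
    · simp only [mem_filter, mem_univ, true_and] at hI hU
      have h := processLaw_real_le hkn ∅ (cutEdges U) (disjoint_empty_left _) m₀ m₀ (by simp) hm0
        hm0 (fun _ _ => True) (fun S => ¬ Disjoint S I) z (by simp [hz])
      simp only [notMem_empty, false_imp_iff, implies_true, true_and, card_empty, pow_zero,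
        prod_empty, one_mul, not_not] at h
      refine h.trans (Real.exp_le_exp.2 (neg_le_neg ?_))
      refine (hG #I #U hI.1 hI.2 hU.1 hU.2).trans ?_
      have hz0 : 0 ≤ z := by rw [hz]; positivity
      have hz1 : z ≤ 1 := by
        rw [hz]; exact div_le_one_of_le₀ (by exact_mod_cast hm0) (by positivity)
      have hzz : 0 ≤ z - z ^ 2 / 2 := by nlinarith
      refine mul_le_mul_of_nonneg_right ?_ hzz
      rw [card_cutEdges]
      push_cast
      exact mul_le_mul_of_nonneg_left (le_colourProb_not_disjoint hk hkn I) (by positivity)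
    · refine mul_le_mul_of_nonneg_right ?_ (Real.exp_pos _).le
      refine le_trans (b := ((Fintype.card (Finset (Fin n)) : ℕ) : ℝ)) ?_ (by simp)
      exact_mod_cast card_le_univ _
  · refine mul_le_mul_of_nonneg_right ?_ (by positivity)
    refine le_trans (b := ((Fintype.card (Finset (Fin (n - 1))) : ℕ) : ℝ)) ?_ ?_
    · exact_mod_cast card_le_univ _
    · simp only [Fintype.card_finset, Fintype.card_fin, Nat.cast_pow, Nat.cast_ofNat]
      exact pow_le_pow_right₀ (by norm_num) (Nat.sub_le _ _)

/-- An edge of `X` has all its colours among the j outside `I`, whence the square. The edges of `X`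
are taken out of the cut before the vacant edges are counted, because `processLaw_real_le` wants
disjoint sets. -/
theorem largeColourSetBad_le (hk : 2 ≤ k) (hkn : k ≤ n - 1) {m₀ m₁ b : ℕ} (hb : b + 1 ≤ m₀)
    (hbn : b ≤ n - 1)
    (hm0 : m₀ ≤ n.choose 2) (hm1 : m₁ ≤ n.choose 2) (G : ℕ → ℕ → ℝ)
    (hG : ∀ j ∈ range (b + 1), ∀ u ∈ Icc 1 (n / 2), ∀ z : ℝ,
      z = ((m₀ : ℝ) - (j + 1 : ℕ)) / (n.choose 2 : ℕ) →
      G j u ≤ ((u * (n - u : ℕ) : ℝ) - (j + 1 : ℕ)) * (1 - ((j : ℝ) / (n - 1 : ℕ)) ^ 2) *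
        (z - z ^ 2 / 2)) :
    (processLaw n k).real (LargeColourSetBad n k m₀ m₁ b) ≤
      ∑ j ∈ range (b + 1), ((n - 1).choose (n - 1 - j) : ℝ) * ∑ u ∈ Icc 1 (n / 2),
        (n.choose u : ℝ) * (((u * (n - u)).choose (j + 1) : ℝ) *
        (((m₁ : ℝ) / (n.choose 2 : ℕ)) ^ (j + 1) * (((j : ℝ) / (n - 1 : ℕ)) ^ 2) ^ (j + 1) *
          Real.exp (-G j u))) := by
  classical
  have := isProbabilityMeasure_processLaw hkn
  refine measureReal_exists_le_sum _ _ _ _ fun j hj => ?_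
  have hj' := mem_range.1 hj
  have hcI : (n - 1).choose (n - 1 - j) =
    #(powersetCard (n - 1 - j) (univ : Finset (Fin (n - 1)))) := by simp
  rw [hcI]
  refine measureReal_exists_le_card_mul _ _ _ _ fun I hI => measureReal_exists_le_sum _ _ _ _
    fun u hu => ?_
  have hcU : n.choose u = #(powersetCard u (univ : Finset (Fin n))) := by simp
  rw [hcU]
  refine measureReal_exists_le_card_mul _ _ _ _ fun U hU => ?_
  rw [mem_powersetCard] at hI hU
  have hjI : n - 1 - #I = j := by omega
  refine (measureReal_exists_le_card_mul _ _ _ (((m₁ : ℝ) / (n.choose 2 : ℕ)) ^ (j + 1) *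
    (((j : ℝ) / (n - 1 : ℕ)) ^ 2) ^ (j + 1) * Real.exp (-G j u)) fun X hX => ?_).trans
    (le_of_eq (by rw [card_powersetCard, card_cutEdges, hU.2]))
  rw [mem_powersetCard] at hX
  refine (processLaw_real_le hkn X (cutEdges U \ X) disjoint_sdiff m₀ m₁ (by omega) hm0 hm1
    (fun e S => Disjoint S I) (fun S => ¬ Disjoint S I) _ rfl).trans ?_
  rw [hX.2]
  refine mul_le_mul (mul_le_mul_of_nonneg_left ?_ (by positivity)) ?_ (Real.exp_pos _).le
    (by positivity)
  · rw [prod_const, hX.2]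
    refine pow_le_pow_left₀ (colourProb_nonneg _) ?_ _
    refine (colourProb_disjoint_le hk hkn I).trans (le_of_eq ?_)
    rw [hjI]
  · refine Real.exp_le_exp.2 (neg_le_neg ?_)
    set z : ℝ := ((m₀ : ℝ) - (j + 1 : ℕ)) / (n.choose 2 : ℕ) with hz
    refine (hG j hj u hu z hz).trans ?_
    have hNpos : (0 : ℝ) < (n.choose 2 : ℕ) := by
      exact_mod_cast (by omega : 0 < n.choose 2)
    have hz0 : 0 ≤ z := by
      refine div_nonneg ?_ hNpos.le
      have : ((j + 1 : ℕ) : ℝ) ≤ m₀ := by exact_mod_cast (by omega : j + 1 ≤ m₀)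
      linarith
    have hz1 : z ≤ 1 := by
      rw [hz, div_le_one hNpos]
      have : (m₀ : ℝ) ≤ (n.choose 2 : ℕ) := by exact_mod_cast hm0
      have h2 : (0 : ℝ) ≤ (j + 1 : ℕ) := Nat.cast_nonneg _
      linarith
    have hzz : 0 ≤ z - z ^ 2 / 2 := by nlinarith
    refine mul_le_mul_of_nonneg_right ?_ hzz
    have hp := le_colourProb_not_disjoint hk hkn I
    rw [hjI] at hp
    have hp0 : 0 ≤ 1 - ((j : ℝ) / (n - 1 : ℕ)) ^ 2 := by
      have : (j : ℝ) / (n - 1 : ℕ) ≤ 1 :=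
        div_le_one_of_le₀ (by exact_mod_cast (by omega : j ≤ n - 1)) (by positivity)
      have h0 : (0 : ℝ) ≤ (j : ℝ) / (n - 1 : ℕ) := by positivity
      nlinarith
    refine mul_le_mul (le_of_eq ?_) hp hp0 (Nat.cast_nonneg _)
    have hXle : j + 1 ≤ u * (n - u) := by
      rw [← hX.2, ← hU.2, ← card_cutEdges]; exact card_le_card hX.1
    rw [card_sdiff_of_subset hX.1, card_cutEdges, hU.2, hX.2, Nat.cast_sub hXle, Nat.cast_mul]

end BadEvents

/-! ### Choice of the parameters and growth of the logarithm -/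

section Parameters

/-- A time just before the connectivity threshold. -/
noncomputable def earlyTime (n : ℕ) : ℕ :=
  ⌊(n : ℝ) * (Real.log n - Real.log (Real.log n) / 2) / 2⌋₊

/-- A time well after the connectivity threshold. -/
noncomputable def lateTime (n : ℕ) : ℕ := ⌊3 * (n : ℝ) * Real.log n⌋₊

/-- The size that separates small colour sets from linear ones. -/
noncomputable def sizeThreshold (n : ℕ) : ℕ := ⌊(n : ℝ) / √(Real.log n)⌋₊

lemma tendsto_log_natCast : Tendsto (fun n : ℕ => Real.log n) atTop atTop :=
  Real.tendsto_log_atTop.comp tendsto_natCast_atTop_atTop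

lemma eventually_le_log (C : ℝ) : ∀ᶠ n : ℕ in atTop, C ≤ Real.log n :=
  tendsto_log_natCast.eventually_ge_atTop C

/-- Powers of the logarithm are smaller than powers of `n`. -/
lemma eventually_mul_log_pow_le (C : ℝ) (p : ℕ) {ε : ℝ} (hε : 0 < ε) :
    ∀ᶠ n : ℕ in atTop, C * Real.log n ^ p ≤ Real.exp (ε * Real.log n) := by
  have h := (isLittleO_pow_exp_pos_mul_atTop p hε).bound
    (inv_pos.2 (by positivity : (0 : ℝ) < |C| + 1))
  filter_upwards [tendsto_log_natCast.eventually h] with n hn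
  rw [Real.norm_eq_abs, Real.norm_eq_abs, abs_of_pos (Real.exp_pos _), ← div_eq_inv_mul,
    le_div_iff₀ (by positivity)] at hn
  calc C * Real.log n ^ p ≤ |C * Real.log n ^ p| := le_abs_self _
    _ = |Real.log n ^ p| * |C| := by rw [abs_mul, mul_comm]
    _ ≤ |Real.log n ^ p| * (|C| + 1) := by gcongr; linarith
    _ ≤ _ := hn

lemma eventually_mul_log_pow_le_natCast (C : ℝ) (p : ℕ) :
    ∀ᶠ n : ℕ in atTop, C * Real.log n ^ p ≤ n := by
  filter_upwards [eventually_mul_log_pow_le C p one_pos, eventually_ge_atTop 1] with n hn h1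
  rwa [one_mul, Real.exp_log (by exact_mod_cast h1)] at hn

lemma eventually_loglog_le {ε : ℝ} (hε : 0 < ε) :
    ∀ᶠ n : ℕ in atTop, Real.log (Real.log n) ≤ ε * Real.log n := by
  have h := tendsto_log_natCast.eventually ((Real.isLittleO_log_id_atTop).bound hε)
  filter_upwards [h, eventually_le_log 1] with n hn h1
  rw [Real.norm_eq_abs, Real.norm_eq_abs, id, abs_of_pos (by linarith : 0 < Real.log n)] at hn
  exact (le_abs_self _).trans hn

lemma choose_two_eq (n : ℕ) : ((n.choose 2 : ℕ) : ℝ) = (n : ℝ) * (n - 1) / 2 :=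
  Nat.cast_choose_two ℝ n

lemma earlyTime_le {n : ℕ} (h : 0 ≤ Real.log n - Real.log (Real.log n) / 2) :
    (earlyTime n : ℝ) ≤ (n : ℝ) * (Real.log n - Real.log (Real.log n) / 2) / 2 :=
  Nat.floor_le (by positivity)

lemma le_earlyTime (n : ℕ) :
    (n : ℝ) * (Real.log n - Real.log (Real.log n) / 2) / 2 - 1 ≤ earlyTime n :=
  (Nat.sub_one_lt_floor _).le

end Parameters

/-! ### Second moment: isolated vertices before the threshold -/

section LowerBound

open Finset

/-- Chebyshev's inequality in counting form. The number `X ω` of v with ω in `S v` has mean c * a,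
and each ω with `X ω = 0` contributes (c * a)² to the sum of squared deviations. -/
lemma card_avoiding_all_le {Ω V : Type*} [Fintype Ω] [Fintype V] [DecidableEq Ω] [DecidableEq V]
    (S : V → Finset Ω) (M a b : ℝ) (hM : M = Fintype.card Ω) (h1 : ∀ v, (#(S v) : ℝ) = M * a)
    (h2 : ∀ v w, v ≠ w → (#(S v ∩ S w) : ℝ) ≤ M * b) (hb : 0 ≤ b) :
    (#{ω | ∀ v, ω ∉ S v} : ℝ) * (Fintype.card V * a) ^ 2 ≤
      M * (Fintype.card V * a + (Fintype.card V : ℝ) ^ 2 * b - (Fintype.card V * a) ^ 2) := by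
  set c : ℝ := ((Fintype.card V : ℕ) : ℝ) with hc
  let X : Ω → ℝ := fun ω => ∑ v, if ω ∈ S v then 1 else 0
  have hX1 : ∑ ω, X ω = c * (M * a) := by
    simp only [X]
    rw [sum_comm, sum_congr rfl (g := fun _ => M * a)]
    · rw [sum_const, card_univ, nsmul_eq_mul]
    · intro v _; rw [← h1 v]; simp
  have hX2 : ∑ ω, X ω ^ 2 ≤ c * (M * a) + c ^ 2 * (M * b) := by
    have e1 : ∀ ω, X ω ^ 2 = ∑ v, ∑ w, if ω ∈ S v ∩ S w then (1 : ℝ) else 0 := by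
      intro ω
      simp only [X]
      rw [sq, sum_mul_sum]
      refine sum_congr rfl fun v _ => sum_congr rfl fun w _ => ?_
      by_cases hv : ω ∈ S v <;> by_cases hw : ω ∈ S w <;> simp [hv, hw]
    have e2 : ∑ ω, X ω ^ 2 = ∑ v, ∑ w, (#(S v ∩ S w) : ℝ) := by
      rw [sum_congr rfl fun ω _ => e1 ω, sum_comm]
      refine sum_congr rfl fun v _ => ?_
      rw [sum_comm]
      refine sum_congr rfl fun w _ => ?_
      rw [sum_ite_mem, univ_inter, sum_const, nsmul_eq_mul, mul_one]
    have hM0 : 0 ≤ M := by rw [hM]; positivity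
    have e3 : ∀ v w, (#(S v ∩ S w) : ℝ) ≤ (if v = w then M * a else 0) + M * b := by
      intro v w
      by_cases h : v = w
      · subst h
        simp only [if_true, inter_self, h1]
        have := mul_nonneg hM0 hb
        linarith
      · simpa [h] using h2 v w h
    rw [e2]
    refine (sum_le_sum fun v _ => sum_le_sum fun w _ => e3 v w).trans (le_of_eq ?_)
    simp only [sum_add_distrib, sum_ite_eq, mem_univ, if_true, sum_const, card_univ,
      nsmul_eq_mul, ← hc]
    ring
  have hpt : ∀ ω, (if ∀ v, ω ∉ S v then (1 : ℝ) else 0) * (c * a) ^ 2 ≤ (X ω - c * a) ^ 2 := by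
    intro ω
    split_ifs with h
    · have : X ω = 0 := by simp [X, h]
      rw [this]; exact le_of_eq (by ring)
    · rw [zero_mul]; positivity
  calc (#{ω | ∀ v, ω ∉ S v} : ℝ) * (c * a) ^ 2
      = ∑ ω, (if ∀ v, ω ∉ S v then (1 : ℝ) else 0) * (c * a) ^ 2 := by
        rw [← sum_mul]; simp
    _ ≤ ∑ ω, (X ω - c * a) ^ 2 := sum_le_sum fun ω _ => hpt ω
    _ = ∑ ω, X ω ^ 2 - 2 * (c * a) * ∑ ω, X ω + M * (c * a) ^ 2 := by
        rw [hM, mul_sum, ← sum_sub_distrib]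
        have : (Fintype.card Ω : ℝ) * (c * a) ^ 2 = ∑ _ω : Ω, (c * a) ^ 2 := by
          rw [sum_const, card_univ, nsmul_eq_mul]
        rw [this, ← sum_add_distrib]
        exact sum_congr rfl fun ω _ => by ring
    _ ≤ _ := by rw [hX1]; nlinarith

lemma avoidRatio_anti {N m s t : ℕ} (hst : s ≤ t) (ht : t < N) :
    ((N : ℝ) - m - t) / ((N : ℝ) - t) ≤ ((N : ℝ) - m - s) / ((N : ℝ) - s) := by
  have h1 : (s : ℝ) ≤ t := by exact_mod_cast hst
  have h2 : (t : ℝ) < N := by exact_mod_cast ht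
  rw [div_le_div_iff₀ (by linarith) (by linarith)]
  nlinarith [(Nat.cast_nonneg m : (0 : ℝ) ≤ m)]

/-- To be used with q = n - 2: one vertex has q + 1 edges, and two vertices have 2q + 1 edges
together. The shared edge makes the joint probability exceed the product by at most the inverse of
the last ratio. -/
lemma avoidProb_bounds {N m q : ℕ} (h : m + 2 * (q + 1) < N) :
    (((N : ℝ) - m - q) / ((N : ℝ) - q)) ^ (q + 1) ≤ avoidProb N m (q + 1) ∧
    avoidProb N m (2 * q + 1) * (((N : ℝ) - m - q) / ((N : ℝ) - q)) ≤
      avoidProb N m (q + 1) ^ 2 ∧ 0 ≤ avoidProb N m (2 * q + 1) := by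
  have hN : (m : ℝ) + 2 * (q + 1) < N := by exact_mod_cast h
  have hm : (0 : ℝ) ≤ m := Nat.cast_nonneg m
  have hq : (0 : ℝ) ≤ q := Nat.cast_nonneg q
  have hpos : ∀ s ∈ range (2 * q + 1), (0 : ℝ) ≤ ((N : ℝ) - m - s) / ((N : ℝ) - s) := by
    intro s hs
    have : (s : ℝ) ≤ 2 * q := by
      have := mem_range.1 hs
      exact_mod_cast (by omega : s ≤ 2 * q)
    exact div_nonneg (by linarith) (by linarith)
  refine ⟨?_, ?_, prod_nonneg hpos⟩
  · have hpow : (((N : ℝ) - m - q) / ((N : ℝ) - q)) ^ (q + 1) =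
        ∏ _s ∈ range (q + 1), ((N : ℝ) - m - q) / ((N : ℝ) - q) := by
      rw [prod_const, card_range]
    rw [hpow]
    refine prod_le_prod (fun s _ => div_nonneg (by linarith) (by linarith)) fun s hs => ?_
    exact avoidRatio_anti (by have := mem_range.1 hs; omega) (by omega)
  · have e1 : avoidProb N m (2 * q + 1) = avoidProb N m (q + 1) *
        ∏ s ∈ range q, ((N : ℝ) - m - (q + 1 + s : ℕ)) / ((N : ℝ) - (q + 1 + s : ℕ)) := by
      rw [avoidProb, avoidProb, ← prod_range_add, show q + 1 + q = 2 * q + 1 by ring]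
    have e2 : ∏ s ∈ range q, ((N : ℝ) - m - (q + 1 + s : ℕ)) / ((N : ℝ) - (q + 1 + s : ℕ)) ≤
        avoidProb N m q := by
      refine prod_le_prod (fun s hs => ?_) fun s hs => ?_
      · exact hpos _ (by have := mem_range.1 hs; rw [mem_range]; omega)
      · exact avoidRatio_anti (by omega) (by have := mem_range.1 hs; omega)
    have e3 : avoidProb N m (q + 1) = avoidProb N m q * (((N : ℝ) - m - q) / ((N : ℝ) - q)) := by
      rw [avoidProb, prod_range_succ, ← avoidProb]
    have e4 : 0 ≤ avoidProb N m (q + 1) :=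
      prod_nonneg fun s hs => hpos s (by have := mem_range.1 hs; rw [mem_range]; omega)
    have e5 : (0 : ℝ) ≤ ((N : ℝ) - m - q) / ((N : ℝ) - q) :=
      div_nonneg (by linarith) (by linarith)
    rw [e1, sq, mul_assoc]
    refine mul_le_mul_of_nonneg_left ?_ e4
    rw [e3]
    exact mul_le_mul_of_nonneg_right e2 e5

variable {n k : ℕ}

open Classical in
lemma processLaw_real_order (hk : k ≤ n - 1) (A : EdgeOrder n → Prop) :
    (processLaw n k).real {ω | A ω.1} = (#{σ | A σ} : ℝ) / (n.choose 2).factorial := by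
  have := nonempty_ColourSet hk
  have : IsProbabilityMeasure (uniformOn (Set.univ : Set (ColourSet n k))) :=
    isProbabilityMeasure_uniformOn Set.finite_univ Set.univ_nonempty
  have h : {ω : Outcome n k | A ω.1} = {σ | A σ} ×ˢ Set.univ := by ext; simp
  rw [h, measureReal_def, processLaw, Measure.prod_prod, measure_univ, mul_one, uniformOn_univ,
    Measure.count_apply_finite _ (Set.toFinite _), card_EdgeOrder]
  simp [ENNReal.toReal_div]

/-- Before the threshold there are isolated vertices. -/
theorem processLaw_real_isConn_le (hk : k ≤ n - 1) (hn : 2 ≤ n) (m : ℕ)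
    (hm : m + 2 * (n - 1) < n.choose 2) (f : ℝ)
    (hf : f = (((n.choose 2 : ℕ) : ℝ) - m - (n - 2 : ℕ)) / (((n.choose 2 : ℕ) : ℝ) - (n - 2 : ℕ))) :
    (processLaw n k).real {ω | ω.IsConn m} ≤ 1 / (n * f ^ (n - 1)) + (1 / f - 1) := by
  classical
  set N := n.choose 2 with hN
  have := isProbabilityMeasure_processLaw (k := k) hk
  obtain ⟨hb1, hb2, hb3⟩ := avoidProb_bounds (N := N) (m := m) (q := n - 2) (by omega)
  rw [show n - 2 + 1 = n - 1 by omega, ← hf] at hb1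
  rw [show n - 2 + 1 = n - 1 by omega, ← hf] at hb2
  set a := avoidProb N m (n - 1) with ha
  set b := avoidProb N m (2 * (n - 2) + 1) with hb
  let S : Fin n → Finset (EdgeOrder n) := fun v =>
    (univ : Finset (Fin N ≃ KEdge n)).filter fun σ => ∀ e ∈ cutEdges {v}, m ≤ (σ.symm e : ℕ)
  have hcut : ∀ v : Fin n, #(cutEdges {v}) = n - 1 := by
    intro v; rw [card_cutEdges]; simp
  have hS1 : ∀ v, (#(S v) : ℝ) = (N.factorial : ℝ) * a := by
    intro v
    have := card_avoiding_orders (card_KEdge n) (cutEdges {v}) m (by omega) (by rw [hcut]; omega)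
    rw [hcut] at this
    rw [ha, ← this]
    congr!
  have hS2 : ∀ v w, v ≠ w → (#(S v ∩ S w) : ℝ) ≤ (N.factorial : ℝ) * b := by
    intro v w hvw
    -- The stars at v and w share at most the edge vw, so their union has at least 2(n - 2) + 1
    -- edges. A subset of exactly that size gives the upper bound.
    have hinter : #(cutEdges {v} ∩ cutEdges {w}) ≤ 1 := by
      refine card_le_one.2 ?_
      have hmem : ∀ e ∈ cutEdges {v} ∩ cutEdges {w}, (e : Sym2 (Fin n)) = s(v, w) := by
        intro e he
        rw [mem_inter, mem_cutEdges, mem_cutEdges] at he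
        obtain ⟨⟨⟨x, hx, hxv⟩, -⟩, ⟨y, hy, hyw⟩, -⟩ := he
        rw [mem_singleton] at hxv hyw
        subst hxv hyw
        exact (Sym2.mem_and_mem_iff hvw).1 ⟨hx, hy⟩
      intro e he e' he'
      exact Subtype.ext ((hmem e he).trans (hmem e' he').symm)
    have hu := card_union_add_card_inter (cutEdges {v}) (cutEdges {w})
    rw [hcut, hcut] at hu
    obtain ⟨R, hR, hRc⟩ := exists_subset_card_eq (s := cutEdges {v} ∪ cutEdges {w})
      (n := 2 * (n - 2) + 1) (by omega)
    have := card_avoiding_orders (card_KEdge n) R m (by omega) (by omega)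
    rw [hRc] at this
    rw [hb, ← this]
    norm_cast
    refine card_le_card fun σ hσ => ?_
    rw [mem_inter] at hσ
    have hσv := (mem_filter.1 hσ.1).2
    have hσw := (mem_filter.1 hσ.2).2
    refine (mem_filter (s := (univ : Finset (Fin N ≃ KEdge n)))).2 ⟨mem_univ _, fun e he => ?_⟩
    rcases mem_union.1 (hR he) with h | h
    · exact hσv e h
    · exact hσw e h
  have hmain := card_avoiding_all_le S (N.factorial : ℝ) a b (by rw [card_EdgeOrder]) hS1 hS2 hb3
  rw [Fintype.card_fin] at hmain
  have hfpos : 0 < f := by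
    rw [hf]
    have h1 : (m : ℝ) + 2 * (n - 1 : ℕ) < N := by exact_mod_cast hm
    have h2 : ((n - 2 : ℕ) : ℝ) ≤ (n - 1 : ℕ) := by exact_mod_cast (by omega : n - 2 ≤ n - 1)
    have h3 : (0 : ℝ) ≤ (n - 2 : ℕ) := Nat.cast_nonneg _
    have h4 : (0 : ℝ) ≤ m := Nat.cast_nonneg _
    exact div_pos (by linarith) (by linarith)
  have hnpos : (0 : ℝ) < n := by exact_mod_cast (by omega : 0 < n)
  have hapos : 0 < a := lt_of_lt_of_le (by positivity) hb1
  have hNf : (0 : ℝ) < N.factorial := by positivity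
  have hsub : {ω : Outcome n k | ω.IsConn m} ⊆ {ω | ∀ v, ω.1 ∉ S v} := by
    intro ω hω v hv
    have hv := (mem_filter.1 hv).2
    have hconn : (graphOf (firstEdges ω m)).Connected := by rw [graphOf_firstEdges]; exact hω
    obtain ⟨y, hy⟩ : ∃ y : Fin n, y ≠ v := by
      have : Nontrivial (Fin n) := Fin.nontrivial_iff_two_le.2 hn
      exact exists_ne v
    obtain ⟨e, he, hec⟩ := exists_mem_cutEdges_of_connected hconn (U := {v}) (x := v) (y := y)
      (by simp) (by simpa using hy)
    have h1 := (mem_edges_iff _ _ _).1 (mem_firstEdges.1 he)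
    exact absurd (hv e hec) (not_le.2 h1)
  refine (measureReal_mono hsub).trans ?_
  have horder := processLaw_real_order (n := n) (k := k) hk (fun σ => ∀ v, σ ∉ S v)
  have hset : {ω : Outcome n k | ∀ v, ω.1 ∉ S v} =
    {ω : Outcome n k | (fun σ : EdgeOrder n => ∀ v, σ ∉ S v) ω.1} := rfl
  rw [hset, horder]
  have hq : (#{σ : EdgeOrder n | ∀ v, σ ∉ S v} : ℝ) / N.factorial ≤
      (n * a + (n : ℝ) ^ 2 * b - (n * a) ^ 2) / (n * a) ^ 2 := by
    rw [div_le_div_iff₀ hNf (by positivity), mul_comm _ (N.factorial : ℝ)]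
    refine le_trans (le_of_eq ?_) hmain
    congr!
  refine le_trans (le_of_eq ?_) (hq.trans ?_)
  · congr!
  have e1 : (n * a + (n : ℝ) ^ 2 * b - (n * a) ^ 2) / (n * a) ^ 2 =
      1 / (n * a) + (b / a ^ 2 - 1) := by field_simp; ring
  rw [e1]
  have e2 : 1 / (n * a) ≤ 1 / (n * f ^ (n - 1)) := by
    refine one_div_le_one_div_of_le (by positivity) ?_
    exact mul_le_mul_of_nonneg_left hb1 hnpos.le
  have e3 : b / a ^ 2 ≤ 1 / f := by
    rw [div_le_div_iff₀ (by positivity) hfpos, one_mul]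
    exact hb2
  linarith

end LowerBound

/-! ### What has happened by the early and by the late time -/

section Thresholds

open Finset

/-- Elementary facts about the parameters that hold for all large `n`. -/
structure LargeParam (n : ℕ) : Prop where
  log_ge : (100 : ℝ) ≤ Real.log n
  loglog_nonneg : 0 ≤ Real.log (Real.log n)
  loglog_le : Real.log (Real.log n) ≤ (1 / 200) * Real.log n
  log_sq_le : 1000 * Real.log n ^ 2 ≤ n

lemma eventually_largeParam : ∀ᶠ n : ℕ in atTop, LargeParam n := by
  filter_upwards [eventually_le_log 100, eventually_loglog_le (by norm_num : (0 : ℝ) < 1 / 200),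
    eventually_mul_log_pow_le_natCast 1000 2] with n h1 h2 h3
  exact ⟨h1, Real.log_nonneg (by linarith), h2, h3⟩

namespace LargeParam

variable {n : ℕ}

lemma log_le (h : LargeParam n) : 100000 * Real.log n ≤ n := by
  nlinarith [h.log_ge, h.log_sq_le]

lemma natCast_ge (h : LargeParam n) : (10000000 : ℝ) ≤ n := by
  linarith [h.log_ge, h.log_le]

lemma exp_log_eq (h : LargeParam n) : Real.exp (Real.log n) = n :=
  Real.exp_log (by linarith [h.natCast_ge])

lemma two_le (h : LargeParam n) : 2 ≤ n := by
  have : (2 : ℝ) ≤ n := by linarith [h.natCast_ge]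
  exact_mod_cast this

lemma cast_pred (h : LargeParam n) : ((n - 1 : ℕ) : ℝ) = (n : ℝ) - 1 := by
  rw [Nat.cast_sub (by have := h.two_le; omega)]; simp

lemma early_le (h : LargeParam n) :
    (earlyTime n : ℝ) ≤ (n : ℝ) * (Real.log n - Real.log (Real.log n) / 2) / 2 :=
  earlyTime_le (by linarith [h.log_ge, h.loglog_le])

lemma early_le_log (h : LargeParam n) : (earlyTime n : ℝ) ≤ (n : ℝ) * Real.log n / 2 := by
  refine h.early_le.trans ?_
  have := h.loglog_nonneg
  have hn : (0 : ℝ) ≤ n := Nat.cast_nonneg n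
  gcongr
  linarith

lemma late_le (h : LargeParam n) : (lateTime n : ℝ) ≤ 3 * (n : ℝ) * Real.log n :=
  Nat.floor_le (by have := h.log_ge; positivity)

lemma lateTime_le_choose (h : LargeParam n) : lateTime n ≤ n.choose 2 := by
  have h1 := h.late_le
  have h2 : (lateTime n : ℝ) ≤ (n.choose 2 : ℕ) := by
    rw [choose_two_eq]
    nlinarith [h.log_le, h.natCast_ge]
  exact_mod_cast h2

lemma early_le_late (h : LargeParam n) : earlyTime n ≤ lateTime n := by
  refine Nat.floor_le_floor ?_
  have hn : (0 : ℝ) ≤ n := Nat.cast_nonneg n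
  nlinarith [h.loglog_nonneg, h.log_ge, mul_nonneg hn h.loglog_nonneg,
    mul_nonneg hn (by linarith [h.log_ge] : (0 : ℝ) ≤ Real.log n)]

lemma earlyTime_le_choose (h : LargeParam n) : earlyTime n ≤ n.choose 2 :=
  h.early_le_late.trans h.lateTime_le_choose

end LargeParam

lemma sum_pow_Icc_le {x : ℝ} (h0 : 0 ≤ x) (h1 : x ≤ 1 / 2) (M : ℕ) :
    ∑ u ∈ Icc 1 M, x ^ u ≤ 2 * x := by
  have h2 : ∑ u ∈ Icc 1 M, x ^ u = x * ∑ u ∈ range M, x ^ u := by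
    rw [mul_sum, ← Ico_add_one_right_eq_Icc, sum_Ico_eq_sum_range]
    simp only [Nat.add_sub_cancel, pow_add, pow_one]
  have h3 : ∑ u ∈ range M, x ^ u ≤ 2 := by
    have h4 := mul_neg_geom_sum x M
    have h5 : 0 ≤ ∑ u ∈ range M, x ^ u := sum_nonneg fun u _ => pow_nonneg h0 u
    nlinarith [pow_nonneg h0 M]
  rw [h2, mul_comm]
  exact mul_le_mul_of_nonneg_right h3 h0

variable {k : ℕ}

/-- The expected number of isolated vertices is at least n f^(n-1) ≥ e^(-2) √(log n), which tends to
infinity. The correlation term 1/f - 1 is of order (log n)/n; the bound 2/log n is enough. -/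
theorem tendsto_isConn_early (k : ℕ) :
    Tendsto (fun n => (processLaw n k).real {ω | ω.IsConn (earlyTime n)}) atTop (𝓝 0) := by
  have hlim : Tendsto (fun n : ℕ => Real.exp (2 - Real.log (Real.log n) / 2) + 2 / Real.log n)
      atTop (𝓝 0) := by
    have h1 : Tendsto (fun n : ℕ => Real.log (Real.log n)) atTop atTop :=
      Real.tendsto_log_atTop.comp tendsto_log_natCast
    have h2 : Tendsto (fun n : ℕ => 2 - Real.log (Real.log n) / 2) atTop atBot :=
      tendsto_atBot_add_const_left _ 2 (tendsto_neg_atTop_atBot.comp (h1.atTop_div_const two_pos))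
    have h3 := Real.tendsto_exp_atBot.comp h2
    have h4 : Tendsto (fun n : ℕ => 2 / Real.log n) atTop (𝓝 0) :=
      tendsto_const_nhds.div_atTop tendsto_log_natCast
    simpa using h3.add h4
  refine squeeze_zero' (Eventually.of_forall fun n => measureReal_nonneg) ?_ hlim
  filter_upwards [eventually_largeParam, eventually_ge_atTop (k + 1)] with n h hnk
  set L := Real.log n with hL
  set l := Real.log L with hl
  have hLge := h.log_ge
  have hl0 := h.loglog_nonneg
  have hl1 := h.loglog_le
  have hLsq := h.log_sq_le
  have hnge := h.natCast_ge
  have hLn := h.log_le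
  rw [← hL] at hLge hl1 hLsq hl0 hLn
  rw [← hl] at hl0 hl1
  set m := earlyTime n with hm
  set w := L - l / 2 with hw
  have hmle : (m : ℝ) ≤ n * w / 2 := h.early_le
  have hm0 : (0 : ℝ) ≤ m := Nat.cast_nonneg m
  have hw0 : 0 ≤ w := by rw [hw]; linarith
  have hwL : w ≤ L := by rw [hw]; linarith
  have hNeq := choose_two_eq n
  set N := n.choose 2 with hN
  have hn2 : ((n - 2 : ℕ) : ℝ) = (n : ℝ) - 2 := by rw [Nat.cast_sub h.two_le]; simp
  have hnw : (n : ℝ) * w / 2 ≤ n * (n / 100) / 2 := by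
    have : w ≤ (n : ℝ) / 100 := by linarith
    gcongr
  have hden : (n : ℝ) ^ 2 / 4 ≤ (N : ℝ) - m - (n - 2) := by
    rw [hNeq]; nlinarith
  have hcond : m + 2 * (n - 1) < n.choose 2 := by
    have : (m : ℝ) + 2 * ((n - 1 : ℕ) : ℝ) < (n.choose 2 : ℕ) := by
      rw [h.cast_pred, ← hN, hNeq]; nlinarith
    exact_mod_cast this
  have hmain := processLaw_real_isConn_le (n := n) (k := k) (by omega) h.two_le m hcond _ rfl
  rw [← hN, hn2] at hmain
  set f : ℝ := ((N : ℝ) - m - (n - 2)) / ((N : ℝ) - (n - 2)) with hf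
  have hdpos : 0 < (N : ℝ) - m - (n - 2) := by
    refine lt_of_lt_of_le ?_ hden; positivity
  have hd2 : 0 < (N : ℝ) - (n - 2) := by linarith
  have hfpos : 0 < f := div_pos hdpos hd2
  have hfinv : 1 / f - 1 = m / ((N : ℝ) - m - (n - 2)) := by
    rw [hf]; field_simp; ring
  refine hmain.trans (add_le_add ?_ ?_)
  · have h1 : Real.exp (-(1 / f - 1)) ≤ f := by
      rw [← Real.le_log_iff_exp_le hfpos]
      have := Real.one_sub_inv_le_log_of_pos hfpos
      rw [one_div]; linarith
    have h2 : Real.exp (-(w + 2)) ≤ f ^ (n - 1) := by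
      refine le_trans ?_ (pow_le_pow_left₀ (Real.exp_pos _).le h1 (n - 1))
      rw [← Real.exp_nat_mul, Real.exp_le_exp, hfinv, h.cast_pred, mul_neg, neg_le_neg_iff,
        mul_div_assoc', div_le_iff₀ hdpos, hNeq]
      have h3 : (n - 1 : ℝ) * m ≤ (n - 1) * (n * w / 2) :=
        mul_le_mul_of_nonneg_left hmle (by linarith)
      have h4 : (w + 2) * (n * w / 2) ≥ (w + 2) * m :=
        mul_le_mul_of_nonneg_left hmle (by linarith)
      have h5 : (w + 2) * (w / 2 + 1) ≤ (n : ℝ) - 1 := by nlinarith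
      have h6 : (n : ℝ) * ((w + 2) * (w / 2 + 1)) ≤ n * (n - 1) :=
        mul_le_mul_of_nonneg_left h5 (by linarith)
      nlinarith
    have h3 : Real.exp (-(2 - l / 2)) ≤ n * f ^ (n - 1) := by
      have h4 : Real.exp (-(2 - l / 2)) = n * Real.exp (-(w + 2)) := by
        rw [← h.exp_log_eq, ← Real.exp_add, ← hL]; congr 1; rw [hw]; ring
      rw [h4]
      exact mul_le_mul_of_nonneg_left h2 (by linarith)
    rw [one_div, ← inv_inv (Real.exp (2 - l / 2)), ← Real.exp_neg]
    exact inv_anti₀ (Real.exp_pos _) h3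
  · rw [hfinv, div_le_div_iff₀ hdpos (by linarith)]
    have h1 : (m : ℝ) * L ≤ n * L / 2 * L := by
      refine mul_le_mul_of_nonneg_right ?_ (by linarith)
      refine hmle.trans ?_
      gcongr
    have h2 : (n : ℝ) * (1000 * L ^ 2) ≤ n * n := mul_le_mul_of_nonneg_left hLsq (by linarith)
    nlinarith

/-- The exponent of the union bounds at the late time. -/
lemma LargeParam.late_exponent {n : ℕ} (h : LargeParam n) {z : ℝ}
    (hz : z = (lateTime n : ℝ) / (n.choose 2 : ℕ)) : 3 * Real.log n / n ≤ z - z ^ 2 / 2 := by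
  have hL := h.log_ge
  have hLn := h.log_le
  have hn := h.natCast_ge
  set L := Real.log n with hLdef
  have hNpos : (0 : ℝ) < (n.choose 2 : ℕ) := by
    rw [choose_two_eq]; nlinarith
  -- The main term of z is 6L/n. The bounds z ≥ 5L/n and z ≤ 1/2 give z - z²/2 ≥ (3/4)z ≥ 3L/n.
  have h1 : 3 * (n : ℝ) * L - 1 ≤ lateTime n := (Nat.sub_one_lt_floor _).le
  have h2 := h.late_le
  have hzge : 5 * L / n ≤ z := by
    rw [hz, div_le_div_iff₀ (by linarith) hNpos, choose_two_eq]
    have : (5 * L : ℝ) * (n * (n - 1) / 2) ≤ (3 * n * L - 1) * n := by nlinarith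
    refine this.trans (mul_le_mul_of_nonneg_right h1 (by linarith))
  have hzle : z ≤ 1 / 2 := by
    rw [hz, div_le_iff₀ hNpos, choose_two_eq]
    nlinarith
  have h0 : 0 ≤ L / n := by positivity
  have e1 : 5 * L / n = 5 * (L / n) := by ring
  have e2 : 3 * L / n = 3 * (L / n) := by ring
  rw [e1] at hzge
  rw [e2]
  nlinarith

lemma choose_le_exp_mul_log {n : ℕ} (h : LargeParam n) (u : ℕ) :
    (n.choose u : ℝ) ≤ Real.exp (u * Real.log n) := by
  rw [mul_comm, Real.exp_mul, h.exp_log_eq, Real.rpow_natCast]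
  exact_mod_cast Nat.choose_le_pow n u

/-- In a disconnected graph some cut with u ≤ n/2 vertices on one side is empty: at most n^u
choices, each of probability at most n^(-3u/2). -/
theorem tendsto_not_isConn_late (k : ℕ) :
    Tendsto (fun n => (processLaw n k).real {ω | ¬ ω.IsConn (lateTime n)}) atTop (𝓝 0) := by
  have hlim : Tendsto (fun n : ℕ => 2 * Real.exp (-(Real.log n / 2))) atTop (𝓝 0) := by
    have h2 : Tendsto (fun n : ℕ => -(Real.log n / 2)) atTop atBot :=
      tendsto_neg_atTop_atBot.comp (tendsto_log_natCast.atTop_div_const two_pos)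
    simpa using (Real.tendsto_exp_atBot.comp h2).const_mul 2
  refine squeeze_zero' (Eventually.of_forall fun n => measureReal_nonneg) ?_ hlim
  filter_upwards [eventually_largeParam, eventually_ge_atTop (k + 1)] with n h hnk
  have hkn : k ≤ n - 1 := by omega
  have := isProbabilityMeasure_processLaw hkn
  have hsub : {ω : Outcome n k | ¬ ω.IsConn (lateTime n)} ⊆
      {ω | ∃ u ∈ Icc 1 (n / 2), ω ∈ {ω : Outcome n k | ∃ U ∈ powersetCard u (univ : Finset (Fin n)),
        ω ∈ {ω : Outcome n k | ∀ e ∈ cutEdges U, e ∉ ω.edges (lateTime n)}}} := by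
    classical
    intro ω hω
    have hNZ : NeZero n := ⟨by have := h.two_le; omega⟩
    have hnum : 2 ≤ numComps (firstEdges ω (lateTime n)) := by
      by_contra hlt
      have := connected_of_numComps_le_one (E := firstEdges ω (lateTime n)) (by omega)
      rw [graphOf_firstEdges] at this
      exact hω this
    obtain ⟨U, hU1, hU2, hU3⟩ := exists_balanced_cut (firstEdges ω (lateTime n))
    exact ⟨#U, mem_Icc.2 ⟨by omega, by omega⟩, U, by simp, fun e he hem =>
      hU3 e (mem_firstEdges.2 hem) he⟩
  refine (measureReal_mono hsub).trans ?_
  have hbound : ∀ u ∈ Icc 1 (n / 2), (processLaw n k).real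
      {ω : Outcome n k | ∃ U ∈ powersetCard u (univ : Finset (Fin n)),
        ω ∈ {ω : Outcome n k | ∀ e ∈ cutEdges U, e ∉ ω.edges (lateTime n)}} ≤
      Real.exp (-(Real.log n / 2)) ^ u := by
    intro u hu
    rw [mem_Icc] at hu
    refine (measureReal_exists_le_card_mul _ _ _ (Real.exp (-(3 / 2 * u * Real.log n)))
      fun U hU => ?_).trans ?_
    · rw [mem_powersetCard] at hU
      -- With `B` always true the colours play no role, and the event says that the cut is empty.
      have hP := processLaw_real_le hkn ∅ (cutEdges U) (disjoint_empty_left _) (lateTime n)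
        (lateTime n) (by simp) h.lateTime_le_choose h.lateTime_le_choose (fun _ _ => True)
        (fun _ => True) _ rfl
      have hone : colourProb n k (fun _ => True) = 1 := by
        have := colourProb_add_not (n := n) (k := k) hkn (fun _ => True)
        have h0 : colourProb n k (fun _ => ¬ True) = 0 := by simp [colourProb]
        linarith
      simp only [notMem_empty, false_imp_iff, implies_true, true_and, card_empty, pow_zero,
        prod_empty, one_mul, not_true_eq_false, hone, mul_one, Nat.cast_zero, sub_zero,
        card_cutEdges, hU.2] at hP
      refine hP.trans (Real.exp_le_exp.2 (neg_le_neg ?_))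
      have hE := h.late_exponent rfl
      have hnpos : (0 : ℝ) < n := by linarith [h.natCast_ge]
      have hcast : ((n - u : ℕ) : ℝ) = (n : ℝ) - u := Nat.cast_sub (by omega)
      have hu2 : (u : ℝ) ≤ n / 2 := by
        rw [le_div_iff₀ two_pos]; exact_mod_cast (by omega : u * 2 ≤ n)
      have hge : (u : ℝ) * (n / 2) ≤ ((u * (n - u) : ℕ) : ℝ) := by
        rw [Nat.cast_mul, hcast]
        exact mul_le_mul_of_nonneg_left (by linarith) (Nat.cast_nonneg _)
      have hLpos := h.log_ge
      calc 3 / 2 * (u : ℝ) * Real.log n = (u : ℝ) * (n / 2) * (3 * Real.log n / n) := by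
            field_simp
        _ ≤ _ := mul_le_mul hge hE (by positivity) (Nat.cast_nonneg _)
    · rw [card_powersetCard, card_univ, Fintype.card_fin, ← Real.exp_nat_mul]
      refine (mul_le_mul_of_nonneg_right (choose_le_exp_mul_log h u) (Real.exp_pos _).le).trans ?_
      rw [← Real.exp_add]
      exact le_of_eq (by congr 1; ring)
  refine (measureReal_exists_le_sum _ _ _ _ hbound).trans ?_
  refine sum_pow_Icc_le (Real.exp_pos _).le ?_ _
  have h1 := Real.add_one_le_exp (Real.log n / 2)
  rw [Real.exp_neg, one_div]
  refine inv_anti₀ two_pos ?_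
  linarith [h.log_ge]

/-- An edge has a given colour with probability at least 1/(n - 1), so the colour is missing with
probability at most n^(-3/2), against n - 1 colours. -/
theorem tendsto_not_allColours_late (hk : 2 ≤ k) :
    Tendsto (fun n => (processLaw n k).real {ω | ¬ ω.AllColours (lateTime n)}) atTop (𝓝 0) := by
  have hlim : Tendsto (fun n : ℕ => Real.exp (-(Real.log n / 2))) atTop (𝓝 0) := by
    have h2 : Tendsto (fun n : ℕ => -(Real.log n / 2)) atTop atBot :=
      tendsto_neg_atTop_atBot.comp (tendsto_log_natCast.atTop_div_const two_pos)
    exact Real.tendsto_exp_atBot.comp h2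
  refine squeeze_zero' (Eventually.of_forall fun n => measureReal_nonneg) ?_ hlim
  filter_upwards [eventually_largeParam, eventually_ge_atTop (k + 1)] with n h hnk
  have hkn : k ≤ n - 1 := by omega
  have := isProbabilityMeasure_processLaw hkn
  have hsub : {ω : Outcome n k | ¬ ω.AllColours (lateTime n)} ⊆
      {ω | ∃ w ∈ (univ : Finset (Fin (n - 1))),
        ω ∈ {ω : Outcome n k | ∀ e, e ∈ ω.edges (lateTime n) → w ∉ ω.colours e}} := by
    intro ω hω
    simp only [Outcome.AllColours, Set.mem_ofPred_eq, not_forall, not_exists, not_and] at hω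
    obtain ⟨w, hw⟩ := hω
    exact ⟨w, mem_univ _, hw⟩
  refine (measureReal_mono hsub).trans ?_
  refine (measureReal_exists_le_card_mul _ _ _ (Real.exp (-(3 / 2 * Real.log n)))
    fun w _ => ?_).trans ?_
  · have hP := processLaw_real_le hkn ∅ univ (disjoint_empty_left _) (lateTime n)
      (lateTime n) (by simp) h.lateTime_le_choose h.lateTime_le_choose (fun _ _ => True)
      (fun S => ¬ Disjoint S {w}) _ rfl
    simp only [notMem_empty, false_imp_iff, implies_true, true_and, card_empty, pow_zero,
      prod_empty, one_mul, mem_univ, true_imp_iff, not_not, disjoint_singleton_right,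
      Nat.cast_zero, sub_zero, card_univ, card_KEdge] at hP
    refine hP.trans (Real.exp_le_exp.2 (neg_le_neg ?_))
    have hE := h.late_exponent rfl
    have hp := le_colourProb_not_disjoint hk hkn {w}
    simp only [disjoint_singleton_right, not_not, card_singleton] at hp
    have hn := h.natCast_ge
    have hcast : ((n - 1 - 1 : ℕ) : ℝ) = (n : ℝ) - 2 := by
      rw [Nat.sub_sub, Nat.cast_sub h.two_le]; norm_num
    have hp' : 1 / ((n : ℝ) - 1) ≤ colourProb n k (fun S => w ∈ S) := by
      refine le_trans ?_ hp
      rw [hcast, h.cast_pred]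
      have h1 : ((n : ℝ) - 2) / (n - 1) = 1 - 1 / (n - 1) := by
        have : (n : ℝ) - 1 ≠ 0 := by linarith
        field_simp; ring
      have h2 : 0 ≤ 1 / ((n : ℝ) - 1) := by
        have : 0 < (n : ℝ) - 1 := by linarith
        positivity
      have h3 : 1 / ((n : ℝ) - 1) ≤ 1 := by
        rw [div_le_one (by linarith)]; linarith
      rw [h1]; nlinarith
    have hLpos := h.log_ge
    have hn1 : (0 : ℝ) < (n : ℝ) - 1 := by linarith
    calc 3 / 2 * Real.log n = ((n.choose 2 : ℕ) : ℝ) * (1 / ((n : ℝ) - 1)) * (3 * Real.log n / n) := by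
          rw [choose_two_eq]; field_simp
      _ ≤ _ := by
          refine mul_le_mul ?_ hE (by positivity) ?_
          · exact mul_le_mul_of_nonneg_left (by simpa using hp') (Nat.cast_nonneg _)
          · exact mul_nonneg (Nat.cast_nonneg _) (colourProb_nonneg _)
  · rw [card_univ, Fintype.card_fin, h.cast_pred]
    have h1 : Real.exp (-(Real.log n / 2)) = n * Real.exp (-(3 / 2 * Real.log n)) := by
      nth_rewrite 2 [← h.exp_log_eq]
      rw [← Real.exp_add]; congr 1; ring
    rw [h1]
    exact mul_le_mul_of_nonneg_right (by linarith) (Real.exp_pos _).le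

end Thresholds

/-! ### Small colour sets -/

section SmallColourSets

open Finset

lemma choose_le_exp_mul_div_pow (a : ℕ) {b : ℕ} (hb : 1 ≤ b) :
    (a.choose b : ℝ) ≤ (Real.exp 1 * a / b) ^ b := by
  have hb0 : (0 : ℝ) < b := by exact_mod_cast hb
  have h1 : (a.choose b : ℝ) ≤ (a : ℝ) ^ b / b.factorial := Nat.choose_le_pow_div b a
  have h2 : (b : ℝ) ^ b / b.factorial ≤ Real.exp b := Real.pow_div_factorial_le_exp b hb0.le b
  have hf : (0 : ℝ) < b.factorial := by positivity
  rw [div_pow, mul_pow, ← Real.exp_nat_mul, mul_one]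
  refine h1.trans ?_
  rw [div_le_iff₀ hf] at h2
  rw [div_le_div_iff₀ hf (by positivity)]
  calc (a : ℝ) ^ b * (b : ℝ) ^ b ≤ (a : ℝ) ^ b * (Real.exp b * b.factorial) := by gcongr
    _ = _ := by ring

/-- The term of the union bound over small colour sets. -/
lemma small_term_le {n k r d : ℕ} {L t p y : ℝ} (hr : 1 ≤ r) (hd : d ≤ r) (hrn : r ≤ n)
    (hk : 1 ≤ k) (ht0 : 0 < t) (ht : t ^ 16 = n) (hp0 : 0 ≤ p) (hp : p ≤ 7 * L / n)
    (hy0 : 0 ≤ y) (hy : y ≤ 4 * k * r / n) :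
    ((n - 1).choose (r + 1) : ℝ) * ((n.choose ((3 * r + d) / 2) : ℝ) *
      (((((3 * r + d) / 2) ^ 2).choose r : ℝ) * ((r.choose d : ℝ) *
        (p ^ r * y ^ (r + d) * ((t ^ 15) ^ (r + 1))⁻¹)))) ≤
      Real.exp 1 * t *
        (56 * Real.exp 1 ^ 3 * (4 * k * Real.exp 1) ^ 2 * L * t / t ^ 8) ^ r := by
  set E := Real.exp 1 with hE
  have hE1 : 1 ≤ E := Real.one_le_exp zero_le_one
  have hr0 : (0 : ℝ) < r := by exact_mod_cast hr
  have hr1 : (1 : ℝ) ≤ r := by exact_mod_cast hr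
  have hrn' : (r : ℝ) ≤ n := by exact_mod_cast hrn
  have hn0 : (0 : ℝ) < n := by linarith
  have hk1 : (1 : ℝ) ≤ k := by exact_mod_cast hk
  have hL0 : 0 ≤ L := by
    have : 0 ≤ 7 * L / n := hp0.trans hp
    rw [le_div_iff₀ hn0] at this
    linarith
  -- The square root handles the halved exponent: v = (3r + d)/2 vertices are chosen in at most
  -- (en/r)^v = q^(2v) ≤ q^(3r+d) ways.
  set q := √(E * n / r) with hq
  have hq2 : q ^ 2 = E * n / r := Real.sq_sqrt (by positivity)
  have hq1 : 1 ≤ q := by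
    rw [hq, Real.one_le_sqrt, le_div_iff₀ hr0]
    nlinarith
  have hq0 : 0 < q := by linarith
  set v := (3 * r + d) / 2 with hv
  have hv1 : r ≤ v := by omega
  have hv2 : v ≤ 2 * r := by omega
  have hv3 : 2 * v ≤ 3 * r + d := by omega
  have hrq : (r : ℝ) / n = E / q ^ 2 := by rw [hq2]; field_simp
  have c1 : ((n - 1).choose (r + 1) : ℝ) ≤ (E * n / (r + 1)) ^ (r + 1) := by
    refine le_trans (b := ((n.choose (r + 1) : ℕ) : ℝ)) ?_ ?_
    · exact_mod_cast Nat.choose_le_choose _ (Nat.sub_le _ _)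
    · have := choose_le_exp_mul_div_pow n (b := r + 1) (by omega)
      push_cast at this
      exact this
  have c2 : (n.choose v : ℝ) ≤ q ^ (3 * r + d) := by
    refine (choose_le_exp_mul_div_pow n (b := v) (by omega)).trans ?_
    have h1 : E * n / v ≤ q ^ 2 := by
      rw [hq2]
      have : (r : ℝ) ≤ v := by exact_mod_cast hv1
      gcongr
    calc (E * n / v) ^ v ≤ (q ^ 2) ^ v := by gcongr
      _ = q ^ (2 * v) := by rw [pow_mul]
      _ ≤ q ^ (3 * r + d) := pow_le_pow_right₀ hq1 hv3
  have c3 : ((v ^ 2).choose r : ℝ) ≤ (4 * E * r) ^ r := by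
    refine (choose_le_exp_mul_div_pow (v ^ 2) hr).trans ?_
    have h2 : (v : ℝ) ≤ 2 * r := by exact_mod_cast hv2
    refine pow_le_pow_left₀ (by positivity) ?_ r
    rw [div_le_iff₀ hr0]
    push_cast
    calc E * (v : ℝ) ^ 2 ≤ E * (2 * r) ^ 2 := by gcongr
      _ = _ := by ring
  have c4 : (r.choose d : ℝ) ≤ 2 ^ r := by exact_mod_cast Nat.choose_le_two_pow r d
  have c5 : p ^ r ≤ (7 * L / n) ^ r := pow_le_pow_left₀ hp0 hp r
  have c6 : y ^ (r + d) ≤ (4 * k * E / q ^ 2) ^ (r + d) := by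
    refine pow_le_pow_left₀ hy0 (hy.trans (le_of_eq ?_)) _
    rw [mul_div_assoc, hrq]; ring
  -- As r/n = e/q², choosing the edges of `T` and having them present gives q^(-2r), and their
  -- colours give q^(-2(r+d)). Against q^(3r+d) for the vertices, q^(-(r+d)) ≤ q^(-r) is left.
  have hmid : q ^ (3 * r + d) * ((4 * E * r) ^ r * (2 ^ r * ((7 * L / n) ^ r *
      (4 * k * E / q ^ 2) ^ (r + d)))) ≤ (56 * E ^ 2 * (4 * k * E) ^ 2 * L / q) ^ r := by
    have e1 : (4 * E * r) ^ r * (2 ^ r * (7 * L / n) ^ r) = (56 * E ^ 2 * L / q ^ 2) ^ r := by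
      rw [← mul_pow, ← mul_pow]
      congr 1
      calc 4 * E * r * (2 * (7 * L / n)) = 56 * E * L * (r / n) := by ring
        _ = _ := by rw [hrq]; ring
    have e2 : q ^ (3 * r + d) * ((4 * E * r) ^ r * (2 ^ r * ((7 * L / n) ^ r *
        (4 * k * E / q ^ 2) ^ (r + d)))) =
        (56 * E ^ 2 * L) ^ r * (4 * k * E) ^ (r + d) * (1 / q) ^ (r + d) := by
      calc _ = q ^ (3 * r + d) * (((4 * E * r) ^ r * (2 ^ r * (7 * L / n) ^ r)) *
            (4 * k * E / q ^ 2) ^ (r + d)) := by ring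
        _ = q ^ (3 * r + d) * ((56 * E ^ 2 * L / q ^ 2) ^ r *
            (4 * k * E / q ^ 2) ^ (r + d)) := by rw [e1]
        _ = _ := by
          simp only [div_pow, one_pow, ← pow_mul]
          field_simp
          ring
    rw [e2]
    have hkE : 1 ≤ 4 * k * E := by nlinarith
    have f1 : (4 * k * E) ^ (r + d) ≤ ((4 * k * E) ^ 2) ^ r := by
      rw [← pow_mul]; exact pow_le_pow_right₀ hkE (by omega)
    have f2 : (1 / q) ^ (r + d) ≤ (1 / q) ^ r :=
      pow_le_pow_of_le_one (by positivity) (by rw [div_le_one hq0]; exact hq1) (by omega)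
    calc (56 * E ^ 2 * L) ^ r * (4 * k * E) ^ (r + d) * (1 / q) ^ (r + d)
        ≤ (56 * E ^ 2 * L) ^ r * ((4 * k * E) ^ 2) ^ r * (1 / q) ^ r := by gcongr
      _ = _ := by rw [← mul_pow, ← mul_pow]; congr 1; ring
  -- The vacancy factor nearly cancels the choice of the colours: n/t^15 = t.
  have hout : (E * n / (r + 1)) ^ (r + 1) * ((t ^ 15) ^ (r + 1))⁻¹ ≤ (E * t / r) ^ r * (E * t) := by
    rw [← inv_pow, ← mul_pow]
    have e1 : E * n / (r + 1) * (t ^ 15)⁻¹ = E * t / (r + 1) := by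
      rw [← ht]; field_simp
    rw [e1, pow_succ]
    have g1 : E * t / (r + 1) ≤ E * t / r := by gcongr; linarith
    have g2 : E * t / (r + 1) ≤ E * t := div_le_self (by positivity) (by linarith)
    gcongr
  have hfinal : E * t / r * (56 * E ^ 2 * (4 * k * E) ^ 2 * L / q) ≤
      56 * E ^ 3 * (4 * k * E) ^ 2 * L * t / t ^ 8 := by
    have hrq8 : t ^ 8 ≤ r * q := by
      -- Squared, this is t^16 = n ≤ e n r = (r q)².
      refine (pow_le_pow_iff_left₀ (by positivity) (by positivity) two_ne_zero).1 ?_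
      rw [mul_pow, hq2, ← pow_mul, ht]
      calc (n : ℝ) ≤ r * (E * n) := by nlinarith [mul_le_mul hr1 hE1 zero_le_one hr0.le]
        _ = _ := by field_simp
    calc E * t / r * (56 * E ^ 2 * (4 * k * E) ^ 2 * L / q)
        = 56 * E ^ 3 * (4 * k * E) ^ 2 * L * t / (r * q) := by field_simp
      _ ≤ _ := by gcongr
  calc _ ≤ (E * n / (r + 1)) ^ (r + 1) * (q ^ (3 * r + d) * ((4 * E * r) ^ r * (2 ^ r *
        ((7 * L / n) ^ r * (4 * k * E / q ^ 2) ^ (r + d) * ((t ^ 15) ^ (r + 1))⁻¹)))) := by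
        gcongr
    _ = ((E * n / (r + 1)) ^ (r + 1) * ((t ^ 15) ^ (r + 1))⁻¹) *
        (q ^ (3 * r + d) * ((4 * E * r) ^ r * (2 ^ r * ((7 * L / n) ^ r *
          (4 * k * E / q ^ 2) ^ (r + d))))) := by ring
    _ ≤ ((E * t / r) ^ r * (E * t)) * (56 * E ^ 2 * (4 * k * E) ^ 2 * L / q) ^ r := by
        gcongr
    _ = E * t * (E * t / r * (56 * E ^ 2 * (4 * k * E) ^ 2 * L / q)) ^ r := by
        rw [mul_pow]; ring
    _ ≤ _ := by gcongr

namespace LargeParam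

variable {n : ℕ}

lemma _root_.sizeThreshold_le_div_sqrt (n : ℕ) : (sizeThreshold n : ℝ) ≤ n / √(Real.log n) :=
  Nat.floor_le (by positivity)

lemma ten_le_sqrt (h : LargeParam n) : 10 ≤ √(Real.log n) := by
  rw [show (10 : ℝ) = √100 by rw [show (100 : ℝ) = 10 ^ 2 by norm_num]; simp]
  exact Real.sqrt_le_sqrt h.log_ge

lemma sizeThreshold_le_div (h : LargeParam n) : (sizeThreshold n : ℝ) ≤ n / 10 := by
  refine (sizeThreshold_le_div_sqrt n).trans ?_
  have := h.ten_le_sqrt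
  have hn := h.natCast_ge
  gcongr

/-- The exponent of the union bounds at the early time. -/
lemma early_exponent (h : LargeParam n) {s z : ℝ} (hs0 : 0 ≤ s) (hs : s ≤ n / 10 + 1)
    (hz : z = ((earlyTime n : ℝ) - s) / (n.choose 2 : ℕ)) :
    0.98 * Real.log n / n ≤ z - z ^ 2 / 2 := by
  have hL := h.log_ge
  have hl := h.loglog_le
  have hLn := h.log_le
  have hn := h.natCast_ge
  have hm := le_earlyTime n
  have hm' := h.early_le_log
  set L := Real.log n with hLdef
  set l := Real.log L with hldef
  have hNpos : (0 : ℝ) < (n.choose 2 : ℕ) := by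
    rw [choose_two_eq]; nlinarith
  have hge : 0.99 * n * L / 2 ≤ (earlyTime n : ℝ) - s := by
    have h1 : (n : ℝ) * l ≤ n * (1 / 200 * L) := mul_le_mul_of_nonneg_left hl (by linarith)
    have h2 : (n : ℝ) * 100 ≤ n * L := mul_le_mul_of_nonneg_left hL (by linarith)
    nlinarith
  have hzge : 0.99 * (L / n) ≤ z := by
    rw [hz, le_div_iff₀ hNpos, choose_two_eq]
    refine le_trans ?_ hge
    have : 0.99 * (L / n) * (n * (n - 1) / 2) = 0.99 * L * (n - 1) / 2 := by
      field_simp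
    rw [this]; nlinarith
  have hzle : z ≤ 1 / 100 := by
    rw [hz, div_le_iff₀ hNpos, choose_two_eq]
    nlinarith
  have h0 : 0 ≤ L / n := by positivity
  have e2 : 0.98 * L / n = 0.98 * (L / n) := by ring
  rw [e2]
  nlinarith

lemma size_le_early (h : LargeParam n) : sizeThreshold n + 1 ≤ earlyTime n := by
  have h1 := h.sizeThreshold_le_div
  have h2 := le_earlyTime n
  have hl := h.loglog_le
  have hL := h.log_ge
  have hn := h.natCast_ge
  have : (sizeThreshold n : ℝ) + 1 ≤ earlyTime n := by nlinarith
  exact_mod_cast this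

lemma late_div_le (h : LargeParam n) :
    (lateTime n : ℝ) / (n.choose 2 : ℕ) ≤ 7 * Real.log n / n := by
  have hL := h.log_ge
  have hn := h.natCast_ge
  have hNpos : (0 : ℝ) < (n.choose 2 : ℕ) := by
    rw [choose_two_eq]; nlinarith
  rw [div_le_div_iff₀ hNpos (by linarith), choose_two_eq]
  have := h.late_le
  calc (lateTime n : ℝ) * n ≤ 3 * n * Real.log n * n := by gcongr
    _ ≤ 7 * Real.log n * (n * (n - 1) / 2) := by
      have h1 : (0 : ℝ) ≤ n * ((n : ℝ) - 7) := mul_nonneg (by linarith) (by linarith)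
      nlinarith [mul_nonneg (by linarith : (0 : ℝ) ≤ Real.log n) h1]

end LargeParam

/-- The probability that no early edge outside a small vertex set has a colour from `I`. -/
lemma small_exponent {n i : ℕ} (h : LargeParam n) (hL : 1000 ≤ Real.log n) (hi : 2 ≤ i)
    (hib : i ≤ sizeThreshold n) {v z : ℝ} (hv0 : 0 ≤ v) (hv : v ≤ 2 * i)
    (hz : z = ((earlyTime n : ℝ) - (i - 1 : ℕ)) / (n.choose 2 : ℕ)) :
    15 / 16 * i * Real.log n ≤ ((n.choose 2 : ℕ) - v ^ 2) *
      (1 - (((n - 1 - i : ℕ) : ℝ) / (n - 1 : ℕ)) ^ 2) * (z - z ^ 2 / 2) := by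
  have hn := h.natCast_ge
  have hib' : (i : ℝ) ≤ n / √(Real.log n) :=
    le_trans (by exact_mod_cast hib) (sizeThreshold_le_div_sqrt n)
  have hi10 : (i : ℝ) ≤ n / 10 := le_trans (by exact_mod_cast hib) h.sizeThreshold_le_div
  set L := Real.log n with hLdef
  have hsq : √L ^ 2 = L := Real.sq_sqrt (by linarith)
  have hspos : 0 < √L := Real.sqrt_pos.2 (by linarith)
  have hi0 : (0 : ℝ) ≤ i := Nat.cast_nonneg i
  have hiL : (i : ℝ) ^ 2 * L ≤ n ^ 2 := by
    rw [le_div_iff₀ hspos] at hib'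
    calc (i : ℝ) ^ 2 * L = (i * √L) ^ 2 := by rw [mul_pow, hsq]
      _ ≤ (n : ℝ) ^ 2 := by gcongr
  have hi2 : (i : ℝ) ^ 2 * 1000 ≤ n ^ 2 := by
    refine le_trans ?_ hiL; gcongr
  have hi31 : (i : ℝ) * 31 ≤ n := by nlinarith
  have hE := h.early_exponent (s := ((i - 1 : ℕ) : ℝ)) (Nat.cast_nonneg _) (by
    have : ((i - 1 : ℕ) : ℝ) ≤ i := by exact_mod_cast Nat.sub_le _ _
    linarith) hz
  have hin : i ≤ n - 1 := by
    have : (i : ℝ) ≤ (n - 1 : ℕ) := by rw [h.cast_pred]; linarith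
    exact_mod_cast this
  have hn1 : (0 : ℝ) < (n : ℝ) - 1 := by linarith
  have hp : 1.96 * ((i : ℝ) / (n - 1)) ≤
      1 - (((n - 1 - i : ℕ) : ℝ) / (n - 1 : ℕ)) ^ 2 := by
    rw [Nat.cast_sub hin, h.cast_pred]
    have e1 : ((n : ℝ) - 1 - i) / (n - 1) = 1 - i / (n - 1) := by field_simp
    rw [e1]
    have e2 : (i : ℝ) / (n - 1) ≤ 0.04 := by
      rw [div_le_iff₀ hn1]; linarith
    have e3 : 0 ≤ (i : ℝ) / (n - 1) := by positivity
    nlinarith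
  have hN : 0.99 * ((n : ℝ) * (n - 1) / 2) ≤ (n.choose 2 : ℕ) - v ^ 2 := by
    rw [choose_two_eq]
    have : v ^ 2 ≤ (2 * i) ^ 2 := by gcongr
    nlinarith
  have hL0 : 0 ≤ L := by linarith
  -- The ideal exponent is iL. The constants lost in the number of edges, in the colour probability
  -- and in z leave 0.9508, just above 15/16.
  calc 15 / 16 * (i : ℝ) * L ≤ 0.99 * 1.96 * 0.98 / 2 * (i * L) := by
        have : 0 ≤ (i : ℝ) * L := by positivity
        nlinarith
    _ = 0.99 * ((n : ℝ) * (n - 1) / 2) * (1.96 * ((i : ℝ) / (n - 1))) * (0.98 * L / n) := by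
        field_simp
    _ ≤ _ := by
        have h0 : 0 ≤ 1.96 * ((i : ℝ) / (n - 1)) := by positivity
        have h1 : 0 ≤ 0.99 * ((n : ℝ) * (n - 1) / 2) := by positivity
        have h2 : 0 ≤ 0.98 * L / n := by positivity
        refine mul_le_mul (mul_le_mul hN hp h0 (h1.trans hN)) hE h2 ?_
        exact mul_nonneg (h1.trans hN) (h0.trans hp)

theorem tendsto_smallColourSetBad {k : ℕ} (hk : 2 ≤ k) :
    Tendsto (fun n => (processLaw n k).real
      (SmallColourSetBad n k (earlyTime n) (lateTime n) (sizeThreshold n))) atTop (𝓝 0) := by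
  have hlim : Tendsto (fun n : ℕ => 4 * Real.exp (-(Real.log n / 4))) atTop (𝓝 0) := by
    have h2 : Tendsto (fun n : ℕ => -(Real.log n / 4)) atTop atBot :=
      tendsto_neg_atTop_atBot.comp (tendsto_log_natCast.atTop_div_const (by norm_num))
    simpa using (Real.tendsto_exp_atBot.comp h2).const_mul 4
  refine squeeze_zero' (Eventually.of_forall fun n => measureReal_nonneg) ?_ hlim
  filter_upwards [eventually_largeParam, eventually_ge_atTop (k + 1), eventually_le_log 1000,
    eventually_mul_log_pow_le (56 * Real.exp 1 ^ 3 * (4 * k * Real.exp 1) ^ 2) 1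
      (by norm_num : (0 : ℝ) < 1 / 16)] with n h hnk hL hK
  have hkn : k ≤ n - 1 := by omega
  have hn := h.natCast_ge
  rw [pow_one] at hK
  have hnexp := h.exp_log_eq
  have hlate := h.late_div_le
  -- So t = n^(1/16): the exponent 15/16 leaves one factor t per colour, and `hK` says that t also
  -- exceeds the constants times log n.
  set t := Real.exp (1 / 16 * Real.log n) with htdef
  have ht0 : 0 < t := Real.exp_pos _
  have ht : t ^ 16 = n := by
    rw [htdef, ← Real.exp_nat_mul, ← hnexp]
    congr 1
    rw [Real.log_exp]; push_cast; ring
  have hE : Real.exp 1 ≤ t := by rw [htdef, Real.exp_le_exp]; linarith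
  have ht2 : 2 ≤ t := by
    have := Real.add_one_le_exp 1
    linarith
  refine (smallColourSetBad_le hk hkn (by have := h.size_le_early; omega) h.earlyTime_le_choose
    h.lateTime_le_choose (fun i => 15 / 16 * i * Real.log n) ?_).trans ?_
  · intro i hi v z hv hv0 hz
    rw [mem_Icc] at hi
    exact small_exponent h hL hi.1 hi.2 hv0 hv hz
  have hterm : ∀ i ∈ Icc 2 (sizeThreshold n), ((n - 1).choose i : ℝ) * ∑ d ∈ range i,
      (n.choose ((3 * (i - 1) + d) / 2) : ℝ) *
        (((((3 * (i - 1) + d) / 2) ^ 2).choose (i - 1) : ℝ) * (((i - 1).choose d : ℝ) *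
        (((lateTime n : ℝ) / (n.choose 2 : ℕ)) ^ (i - 1) *
          ((k * i : ℝ) / (n - 1 : ℕ)) ^ (i - 1 + d) *
          Real.exp (-(15 / 16 * i * Real.log n))))) ≤ t ^ 2 * (2 * (t ^ 6)⁻¹) ^ (i - 1) := by
    intro i hi
    rw [mem_Icc] at hi
    obtain ⟨r, rfl⟩ : ∃ r, i = r + 1 := ⟨i - 1, by omega⟩
    have hr : 1 ≤ r := by omega
    have hrn : r ≤ n := by
      have h1 : (sizeThreshold n : ℝ) ≤ n := h.sizeThreshold_le_div.trans (by linarith)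
      have h2 : sizeThreshold n ≤ n := by exact_mod_cast h1
      omega
    have hexp : Real.exp (-(15 / 16 * ((r + 1 : ℕ) : ℝ) * Real.log n)) =
        ((t ^ 15) ^ (r + 1))⁻¹ := by
      rw [Real.exp_neg, htdef, ← Real.exp_nat_mul, ← Real.exp_nat_mul]
      congr 2
      push_cast; ring
    rw [hexp, Nat.add_sub_cancel, mul_sum]
    have hy : (k * ((r + 1 : ℕ) : ℝ)) / (n - 1 : ℕ) ≤ 4 * k * r / n := by
      rw [h.cast_pred, div_le_div_iff₀ (by linarith) (by linarith)]
      have hr' : (1 : ℝ) ≤ r := by exact_mod_cast hr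
      have h1 : ((r + 1 : ℕ) : ℝ) * n ≤ 4 * r * (n - 1) := by push_cast; nlinarith
      have hk0 : (0 : ℝ) ≤ k := Nat.cast_nonneg k
      nlinarith
    have hb : ∀ d ∈ range (r + 1), ((n - 1).choose (r + 1) : ℝ) *
        ((n.choose ((3 * r + d) / 2) : ℝ) *
        (((((3 * r + d) / 2) ^ 2).choose r : ℝ) * ((r.choose d : ℝ) *
        (((lateTime n : ℝ) / (n.choose 2 : ℕ)) ^ r *
          ((k * ((r + 1 : ℕ) : ℝ)) / (n - 1 : ℕ)) ^ (r + d) * ((t ^ 15) ^ (r + 1))⁻¹)))) ≤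
        t ^ 2 * ((t ^ 6)⁻¹) ^ r := by
      intro d hd
      rw [mem_range] at hd
      refine (small_term_le hr (by omega) hrn (by omega) ht0 ht (by positivity) hlate
        (by positivity) hy).trans ?_
      have hL0 : 0 ≤ Real.log n := by linarith
      have e1 : 56 * Real.exp 1 ^ 3 * (4 * k * Real.exp 1) ^ 2 * Real.log n * t / t ^ 8 ≤
          (t ^ 6)⁻¹ := by
        calc _ ≤ t * t / t ^ 8 := by gcongr
          _ = _ := by field_simp
      calc _ ≤ t * t * ((t ^ 6)⁻¹) ^ r := by gcongr
        _ = _ := by ring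
    refine (sum_le_sum hb).trans ?_
    rw [sum_const, card_range, nsmul_eq_mul, mul_pow]
    -- The factor 2^r absorbs the r + 1 values of d.
    have h2r : ((r + 1 : ℕ) : ℝ) ≤ 2 ^ r := by exact_mod_cast Nat.lt_two_pow_self
    calc ((r + 1 : ℕ) : ℝ) * (t ^ 2 * ((t ^ 6)⁻¹) ^ r) ≤ 2 ^ r * (t ^ 2 * ((t ^ 6)⁻¹) ^ r) := by
          gcongr
      _ = _ := by ring
  refine (sum_le_sum hterm).trans ?_
  rw [← mul_sum]
  have hx : 2 * (t ^ 6)⁻¹ ≤ 1 / 2 := by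
    have h6 : (2 : ℝ) ^ 6 ≤ t ^ 6 := by gcongr
    have : (t ^ 6)⁻¹ ≤ ((2 : ℝ) ^ 6)⁻¹ := inv_anti₀ (by positivity) h6
    norm_num at this ⊢
    linarith
  have hsum : ∑ i ∈ Icc 2 (sizeThreshold n), (2 * (t ^ 6)⁻¹) ^ (i - 1) ≤ 2 * (2 * (t ^ 6)⁻¹) := by
    refine le_trans ?_ (sum_pow_Icc_le (by positivity) hx (sizeThreshold n))
    refine le_trans (le_of_eq ?_) (sum_le_sum_of_subset_of_nonneg
      (s := (Icc 2 (sizeThreshold n)).image (fun i => i - 1)) ?_ fun _ _ _ => by positivity)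
    · rw [sum_image]
      intro a ha b hb hab
      simp only [coe_Icc, Set.mem_Icc] at ha hb
      dsimp only at hab
      omega
    · intro a ha
      obtain ⟨i, hi, rfl⟩ := mem_image.1 ha
      rw [mem_Icc] at hi ⊢
      omega
  calc t ^ 2 * ∑ i ∈ Icc 2 (sizeThreshold n), (2 * (t ^ 6)⁻¹) ^ (i - 1)
      ≤ t ^ 2 * (2 * (2 * (t ^ 6)⁻¹)) := by gcongr
    _ = 4 * (t ^ 4)⁻¹ := by field_simp; ring
    _ = _ := by
        rw [htdef, ← Real.exp_nat_mul, ← Real.exp_neg]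
        congr 2
        push_cast; ring

end SmallColourSets

/-! ### Colour sets of intermediate size -/

section BalancedCuts

open Finset

/-- The cut has at least (j/2)(n/2) edges, each meeting `I` with probability at least i/n. The
smaller of i, j is at least n/√L and the larger at least n/3, so the exponent has order n√L. The
constant 2 is chosen because e² > 4. -/
lemma balanced_exponent {n i u : ℕ} (h : LargeParam n) (hL : 1000 ≤ Real.log n)
    (hi : sizeThreshold n < i) (hj : sizeThreshold n < n - 1 - i) (hu1 : n - 1 - i + 1 ≤ 2 * u)
    (hu2 : 2 * u ≤ n) {z : ℝ} (hz : z = (earlyTime n : ℝ) / (n.choose 2 : ℕ)) :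
    2 * (n : ℝ) ≤ (u * (n - u : ℕ) : ℝ) * (1 - (((n - 1 - i : ℕ) : ℝ) / (n - 1 : ℕ)) ^ 2) *
        (z - z ^ 2 / 2) := by
  have hn := h.natCast_ge
  have hE := h.early_exponent (s := 0) le_rfl (by positivity) (z := z) (by rw [hz, sub_zero])
  have hthr : (n : ℝ) / √(Real.log n) ≤ (sizeThreshold n : ℝ) + 1 := (Nat.lt_floor_add_one _).le
  set L := Real.log n with hLdef
  set j := n - 1 - i with hjdef
  have hin : i + j = n - 1 := by omega
  have hsum : (i : ℝ) + j = n - 1 := by rw [← h.cast_pred, ← hin]; push_cast; ring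
  have hs30 : 30 ≤ √L := by
    rw [show (30 : ℝ) = √(30 ^ 2) by simp]
    exact Real.sqrt_le_sqrt (by linarith)
  have hsq : √L * √L = L := Real.mul_self_sqrt (by linarith)
  have hspos : 0 < √L := by linarith
  have hib : (n : ℝ) / √L ≤ i := by
    have : (sizeThreshold n : ℝ) + 1 ≤ i := by exact_mod_cast hi
    linarith
  have hjb : (n : ℝ) / √L ≤ j := by
    have : (sizeThreshold n : ℝ) + 1 ≤ j := by exact_mod_cast hj
    linarith
  have hprod : (n : ℝ) / √L * (n / 3) ≤ i * j := by
    have hpos : 0 ≤ (n : ℝ) / √L := by positivity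
    rcases le_total i j with hij | hij
    · have : (i : ℝ) ≤ j := by exact_mod_cast hij
      exact mul_le_mul hib (by linarith) (by linarith) (Nat.cast_nonneg _)
    · have : (j : ℝ) ≤ i := by exact_mod_cast hij
      rw [mul_comm (i : ℝ)]
      exact mul_le_mul hjb (by linarith) (by linarith) (Nat.cast_nonneg _)
  have hn1 : (0 : ℝ) < (n : ℝ) - 1 := by linarith
  have hp : (i : ℝ) / n ≤ 1 - ((j : ℝ) / (n - 1 : ℕ)) ^ 2 := by
    rw [h.cast_pred]
    have e1 : (j : ℝ) / (n - 1) = 1 - i / (n - 1) := by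
      rw [eq_sub_iff_add_eq, ← add_div, add_comm, hsum, div_self hn1.ne']
    have e2 : (i : ℝ) / (n - 1) ≤ 1 := by
      rw [div_le_one hn1]
      linarith [(Nat.cast_nonneg j : (0 : ℝ) ≤ j)]
    have e3 : 0 ≤ (i : ℝ) / (n - 1) := by positivity
    have e4 : (i : ℝ) / n ≤ i / (n - 1) := by gcongr; linarith
    rw [e1]; nlinarith
  have hM : (j : ℝ) / 2 * (n / 2) ≤ (u * (n - u : ℕ) : ℝ) := by
    rw [Nat.cast_sub (by omega : u ≤ n)]
    have e1 : (j : ℝ) / 2 ≤ u := by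
      rw [div_le_iff₀ two_pos]; exact_mod_cast (by omega : j ≤ u * 2)
    have e2 : (u : ℝ) ≤ n / 2 := by
      rw [le_div_iff₀ two_pos]; exact_mod_cast (by omega : u * 2 ≤ n)
    exact mul_le_mul e1 (by linarith) (by positivity) (Nat.cast_nonneg _)
  calc 2 * (n : ℝ) ≤ 0.98 / 12 * √L * n := by nlinarith
    _ = 0.98 / 4 * L / n * (n / √L * (n / 3)) := by
        nth_rewrite 2 [← hsq]; field_simp; ring
    _ ≤ 0.98 / 4 * L / n * (i * j) := by gcongr
    _ = (j : ℝ) / 2 * (n / 2) * (i / n) * (0.98 * L / n) := by field_simp; ring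
    _ ≤ _ := by
        have h0 : 0 ≤ (i : ℝ) / n := by positivity
        have h1 : 0 ≤ (j : ℝ) / 2 * (n / 2) := by positivity
        refine mul_le_mul (mul_le_mul hM hp h0 (h1.trans hM)) hE (by positivity) ?_
        exact mul_nonneg (h1.trans hM) (h0.trans hp)

theorem tendsto_balancedCutBad {k : ℕ} (hk : 2 ≤ k) :
    Tendsto (fun n => (processLaw n k).real (BalancedCutBad n k (earlyTime n) (sizeThreshold n)))
      atTop (𝓝 0) := by
  have hlim : Tendsto (fun n : ℕ => (4 / Real.exp 2) ^ n) atTop (𝓝 0) := by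
    refine tendsto_pow_atTop_nhds_zero_of_lt_one (by positivity) ?_
    rw [div_lt_one (Real.exp_pos _)]
    have h1 := Real.exp_one_gt_d9
    have h2 : Real.exp 2 = Real.exp 1 * Real.exp 1 := by rw [← Real.exp_add]; norm_num
    rw [h2]; nlinarith
  refine squeeze_zero' (Eventually.of_forall fun n => measureReal_nonneg) ?_ hlim
  filter_upwards [eventually_largeParam, eventually_ge_atTop (k + 1), eventually_le_log 1000]
    with n h hnk hL
  refine (balancedCutBad_le hk (by omega) h.earlyTime_le_choose (2 * n) _ rfl
    fun i u hi hj hu1 hu2 => balanced_exponent h hL hi hj hu1 hu2 rfl).trans (le_of_eq ?_)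
  rw [Real.exp_neg, mul_comm (2 : ℝ) n, Real.exp_nat_mul, ← inv_pow, ← mul_pow, ← mul_pow]
  congr 1
  ring

end BalancedCuts

/-! ### Large colour sets -/

section LargeColourSets

open Finset

/-- The term of the union bound over large colour sets. -/
lemma large_term_le {n j u : ℕ} {L p y g : ℝ} (hj : 1 ≤ j) (hjn : j ≤ n - 1)
    (hL : 0 ≤ L) (hp0 : 0 ≤ p) (hp : p ≤ 7 * L / n) (hy0 : 0 ≤ y) (hy : y ≤ 2 * j / n) :
    ((n - 1).choose (n - 1 - j) : ℝ) * ((n.choose u : ℝ) * (((u * (n - u)).choose (j + 1) : ℝ) *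
      (p ^ (j + 1) * (y ^ 2) ^ (j + 1) * Real.exp (-g)))) ≤
      (n : ℝ) ^ u / u.factorial * Real.exp (-g - (j + 1 : ℕ)) *
        (28 * Real.exp 1 ^ 3 * u * L / n) ^ (j + 1) := by
  set E := Real.exp 1 with hE
  have hE1 : 1 ≤ E := Real.one_le_exp zero_le_one
  have hj0 : (0 : ℝ) < j := by exact_mod_cast hj
  have hjn' : (j : ℝ) ≤ n := by exact_mod_cast (by omega : j ≤ n)
  have hn0 : (0 : ℝ) < n := by linarith
  -- The exponent j is raised to j + 1, to match the other factors; the base is at least 1.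
  have c1 : ((n - 1).choose (n - 1 - j) : ℝ) ≤ (E * n / j) ^ (j + 1) := by
    rw [Nat.choose_symm hjn]
    refine le_trans (b := ((n.choose j : ℕ) : ℝ)) ?_ ?_
    · exact_mod_cast Nat.choose_le_choose _ (Nat.sub_le _ _)
    · refine (choose_le_exp_mul_div_pow n hj).trans (pow_le_pow_right₀ ?_ (Nat.le_succ _))
      rw [le_div_iff₀ hj0]; nlinarith
  have c2 : (n.choose u : ℝ) ≤ (n : ℝ) ^ u / u.factorial := Nat.choose_le_pow_div u n
  have c3 : ((u * (n - u)).choose (j + 1) : ℝ) ≤ (E * (u * n) / j) ^ (j + 1) := by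
    refine (choose_le_exp_mul_div_pow _ (by omega)).trans ?_
    refine pow_le_pow_left₀ (by positivity) ?_ _
    have e1 : ((u * (n - u) : ℕ) : ℝ) ≤ u * n := by
      rw [Nat.cast_mul]
      have : ((n - u : ℕ) : ℝ) ≤ n := by exact_mod_cast Nat.sub_le _ _
      gcongr
    have e2 : (j : ℝ) ≤ (j + 1 : ℕ) := by push_cast; linarith
    gcongr
  have hs : Real.exp (-g) = Real.exp (-g - (j + 1 : ℕ)) * E ^ (j + 1) := by
    rw [hE, ← Real.exp_nat_mul, ← Real.exp_add]; congr 1; ring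
  -- The powers of j cancel: choosing the colours and the edges costs a factor 1/j each, and the
  -- squared colour probability returns j². The factor e^(j+1) split off from the exponential
  -- compensates the loss j + 1 in `large_exponent`.
  calc _ ≤ (E * n / j) ^ (j + 1) * ((n : ℝ) ^ u / u.factorial * ((E * (u * n) / j) ^ (j + 1) *
        ((7 * L / n) ^ (j + 1) * ((2 * j / n) ^ 2) ^ (j + 1) * Real.exp (-g)))) := by
        gcongr
    _ = (n : ℝ) ^ u / u.factorial * Real.exp (-g - (j + 1 : ℕ)) *
        ((E * n / j) * (E * (u * n) / j) * (7 * L / n) * (2 * j / n) ^ 2 * E) ^ (j + 1) := by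
        rw [hs]; simp only [mul_pow]; ring
    _ = _ := by
        congr 2
        field_simp
        ring

set_option maxHeartbeats 1000000 in
-- The leading term has to be exact up to O(u) + O(j), because n^u is to be cancelled. The early
-- time costs 2u, the term z²/2 costs u/2, and the colour probability costs 2u since (j/(n - 1))²
-- log n stays bounded; this is what the threshold n/√(log n) is for. Removing `X` costs at most j +
-- 1.
lemma large_exponent {n j u : ℕ} (h : LargeParam n) (hj : j ≤ sizeThreshold n)
    (hu1 : 1 ≤ u) (hu2 : 2 * u ≤ n) {z : ℝ}
    (hz : z = ((earlyTime n : ℝ) - (j + 1 : ℕ)) / (n.choose 2 : ℕ)) :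
    (u : ℝ) * (n - u) * (Real.log n - Real.log (Real.log n) / 2) / n - 5 * u - (j + 1 : ℕ) ≤
      ((u * (n - u : ℕ) : ℝ) - (j + 1 : ℕ)) * (1 - ((j : ℝ) / (n - 1 : ℕ)) ^ 2) *
        (z - z ^ 2 / 2) := by
  have hn := h.natCast_ge
  have hLn := h.log_le
  have hLsq := h.log_sq_le
  have hL := h.log_ge
  have hl0 := h.loglog_nonneg
  have hl := h.loglog_le
  have hm := le_earlyTime n
  have hm' := h.early_le_log
  have hsize := h.size_le_early
  have hjs : (j : ℝ) ≤ n / √(Real.log n) :=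
    le_trans (by exact_mod_cast hj) (sizeThreshold_le_div_sqrt n)
  have hj10 : (j : ℝ) ≤ n / 10 := le_trans (by exact_mod_cast hj) h.sizeThreshold_le_div
  rw [h.cast_pred, Nat.cast_sub (by omega : u ≤ n)]
  set L := Real.log n with hLdef
  set w := L - Real.log L / 2 with hw
  set N : ℝ := ((n.choose 2 : ℕ) : ℝ) with hN
  have hNeq : N = (n : ℝ) * (n - 1) / 2 := choose_two_eq n
  set s : ℝ := ((j + 1 : ℕ) : ℝ) with hs
  set M : ℝ := (u : ℝ) * ((n : ℝ) - u) with hM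
  have hn1 : (0 : ℝ) < (n : ℝ) - 1 := by linarith
  have hn0 : (0 : ℝ) < n := by linarith
  have hNpos : 0 < N := by rw [hNeq]; positivity
  have hu1' : (1 : ℝ) ≤ u := by exact_mod_cast hu1
  have hu2' : 2 * (u : ℝ) ≤ n := by exact_mod_cast hu2
  have hM0 : 0 ≤ M := mul_nonneg (by linarith) (by linarith)
  have hMn : M ≤ u * n := by rw [hM]; nlinarith
  have hs0 : 0 ≤ s := Nat.cast_nonneg _
  have hs10 : s ≤ n / 10 + 1 := by rw [hs]; push_cast; linarith
  have hsq : √L ^ 2 = L := Real.sq_sqrt (by linarith)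
  have hspos : 0 < √L := Real.sqrt_pos.2 (by linarith)
  have hsm : s ≤ earlyTime n := by rw [hs]; exact_mod_cast (by omega : j + 1 ≤ earlyTime n)
  have hz0 : 0 ≤ z := by rw [hz]; exact div_nonneg (by linarith) hNpos.le
  have hzle : z ≤ L / (n - 1) := by
    rw [hz, div_le_div_iff₀ hNpos hn1, hNeq]
    have : ((earlyTime n : ℝ) - s) * (n - 1) ≤ n * L / 2 * (n - 1) :=
      mul_le_mul_of_nonneg_right (by linarith) hn1.le
    linarith
  have hzn : z * n ≤ 1.01 * L := by
    have h1 : z * (n - 1) ≤ L := by rwa [le_div_iff₀ hn1] at hzle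
    have h2 : z ≤ 0.01 := by
      refine hzle.trans ?_
      rw [div_le_iff₀ hn1]; linarith
    linarith
  have hz1 : z ≤ 1 := by nlinarith
  set x : ℝ := ((j : ℝ) / (n - 1)) ^ 2 with hx
  have hx0 : 0 ≤ x := by positivity
  have hxL : x * L ≤ 1.03 := by
    have h1 : (j : ℝ) * √L ≤ n := by rwa [le_div_iff₀ hspos] at hjs
    have h2 : (j : ℝ) / (n - 1) * √L ≤ 1.01 := by
      rw [div_mul_eq_mul_div, div_le_iff₀ hn1]; linarith
    have h3 : 0 ≤ (j : ℝ) / (n - 1) * √L := by positivity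
    calc x * L = ((j : ℝ) / (n - 1) * √L) ^ 2 := by rw [mul_pow, hsq]
      _ ≤ 1.01 ^ 2 := by gcongr
      _ ≤ 1.03 := by norm_num
  have hx1 : x ≤ 1 := by nlinarith
  have hMz : M * (w / n) - 2 * u ≤ M * z := by
    have h1 : w / (n - 1) - 2 / (n * (n - 1)) - s / N ≤ z := by
      have : w / (n - 1) - 2 / (n * (n - 1)) - s / N = (n * w / 2 - 1 - s) / N := by
        rw [hNeq]; field_simp
      rw [this, hz]
      gcongr
    have hw0 : 0 ≤ w := by rw [hw]; linarith
    have h2 : w / n ≤ w / (n - 1) := by gcongr; linarith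
    have h3 : M * (2 / (n * (n - 1))) ≤ u := by
      calc M * (2 / (n * (n - 1))) ≤ u * n * (2 / (n * (n - 1))) := by gcongr
        _ = u * (2 / (n - 1)) := by field_simp
        _ ≤ u * 1 := by
          have : 2 / ((n : ℝ) - 1) ≤ 1 := by rw [div_le_one hn1]; linarith
          gcongr
        _ = u := mul_one _
    have h4 : M * (s / N) ≤ u := by
      have h5 : s * n ≤ N := by rw [hNeq]; nlinarith
      calc M * (s / N) ≤ u * n * (s / N) := by gcongr
        _ = u * ((s * n) / N) := by ring
        _ ≤ u * 1 := by
          have : s * n / N ≤ 1 := by rw [div_le_one hNpos]; exact h5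
          gcongr
        _ = u := mul_one _
    have h5 := mul_le_mul_of_nonneg_left h1 hM0
    have h6 := mul_le_mul_of_nonneg_left h2 hM0
    have h7 : M * (w / (n - 1) - 2 / (n * (n - 1)) - s / N) =
      M * (w / (n - 1)) - M * (2 / (n * (n - 1))) - M * (s / N) := by ring
    linarith
  have hMz1 : M * z ≤ 1.01 * u * L := by
    calc M * z ≤ u * n * z := by gcongr
      _ = u * (z * n) := by ring
      _ ≤ u * (1.01 * L) := by gcongr
      _ = _ := by ring
  have hMz2 : M * z * z ≤ u := by
    have h1 : L * z ≤ 1 / 2 := by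
      have : L * z * n ≤ 1 / 2 * n := by
        calc L * z * n = L * (z * n) := by ring
          _ ≤ L * (1.01 * L) := by gcongr
          _ ≤ 1 / 2 * n := by nlinarith
      exact le_of_mul_le_mul_right this hn0
    calc M * z * z ≤ 1.01 * u * L * z := by gcongr
      _ = 1.01 * u * (L * z) := by ring
      _ ≤ 1.01 * u * (1 / 2) := by gcongr
      _ ≤ u := by linarith
  have hMxz : x * (M * z) ≤ 2 * u := by
    calc x * (M * z) ≤ x * (1.01 * u * L) := by gcongr
      _ = 1.01 * u * (x * L) := by ring
      _ ≤ 1.01 * u * 1.03 := by gcongr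
      _ ≤ 2 * u := by linarith
  have hsz : s * z ≤ s := by nlinarith
  have hkey : M * (w / n) - 5 * u - s ≤ M * z - M * z * z / 2 - x * (M * z) - s * z := by
    linarith
  have hzz : 0 ≤ z - z ^ 2 / 2 := by nlinarith
  have hzz' : z - z ^ 2 / 2 ≤ z := by nlinarith
  have e1 : (u : ℝ) * (n - u) * w / n = M * (w / n) := by rw [hM]; ring
  rw [e1]
  refine hkey.trans ?_
  have e2 : (M - s) * (1 - x) * (z - z ^ 2 / 2) = M * (z - z ^ 2 / 2) -
      x * (M * (z - z ^ 2 / 2)) - s * (1 - x) * (z - z ^ 2 / 2) := by ring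
  rw [e2]
  have e3 : x * (M * (z - z ^ 2 / 2)) ≤ x * (M * z) := by gcongr
  have e4 : s * (1 - x) * (z - z ^ 2 / 2) ≤ s * z := by
    have : s * (1 - x) ≤ s := by nlinarith
    exact mul_le_mul this hzz' hzz hs0
  have e5 : M * (z - z ^ 2 / 2) = M * z - M * z * z / 2 := by ring
  linarith

/-- The numerical constant of the union bound over large colour sets. -/
noncomputable def cutConst : ℝ := 28 * Real.exp 1 ^ 3

lemma one_le_cutConst : 1 ≤ cutConst := by
  have : 1 ≤ Real.exp 1 ^ 3 := one_le_pow₀ (Real.one_le_exp zero_le_one)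
  unfold cutConst; linarith

/-- The factor n^u cancels against e^(-u log n). The log log term of the early time leaves √(log n)
per vertex, and replacing n - u by n in the exponent costs e^(u² (log n)/n). -/
lemma large_vertex_factor_le {n u : ℕ} (h : LargeParam n) :
    (n : ℝ) ^ u / u.factorial * Real.exp (-((u : ℝ) * (n - u) *
      (Real.log n - Real.log (Real.log n) / 2) / n - 5 * u)) ≤
    (Real.exp 5 * √(Real.log n)) ^ u / u.factorial * Real.exp ((u : ℝ) ^ 2 * Real.log n / n) := by
  have hn := h.natCast_ge
  have hL := h.log_ge
  have hl0 := h.loglog_nonneg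
  have h1 : (n : ℝ) ^ u = Real.exp (u * Real.log n) := by
    rw [Real.exp_nat_mul, h.exp_log_eq]
  have h2 : (Real.exp 5 * √(Real.log n)) ^ u =
      Real.exp (u * (5 + Real.log (Real.log n) / 2)) := by
    rw [Real.exp_nat_mul, Real.exp_add, Real.sqrt_eq_rpow,
      Real.rpow_def_of_pos (by linarith : 0 < Real.log n)]
    congr 4
    ring
  rw [h1, h2, div_mul_eq_mul_div, div_mul_eq_mul_div, ← Real.exp_add, ← Real.exp_add]
  refine div_le_div_of_nonneg_right (Real.exp_le_exp.2 ?_) (by positivity)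
  set L := Real.log n with hLdef
  set l := Real.log L with hldef
  have e1 : (u : ℝ) * (n - u) * (L - l / 2) / n =
      u * (L - l / 2) - u ^ 2 * L / n + u ^ 2 * (l / 2) / n := by
    field_simp; ring
  rw [e1]
  have e2 : 0 ≤ (u : ℝ) ^ 2 * (l / 2) / n := by positivity
  linarith

/-- Small vertex sets in the union bound over large colour sets. -/
lemma large_term_small_cut {n j u : ℕ} (h : LargeParam n) (hj : 1 ≤ j)
    (hu : 2 * cutConst * u * Real.log n ≤ n) :
    (Real.exp 5 * √(Real.log n)) ^ u / u.factorial * Real.exp ((u : ℝ) ^ 2 * Real.log n / n) *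
      (cutConst * u * Real.log n / n) ^ (j + 1) ≤
    (4 * Real.exp 6 * √(Real.log n)) ^ u / u.factorial *
      (2 * cutConst ^ 2 * Real.log n ^ 2 / n ^ 2 * (1 / 2) ^ j) := by
  have hn := h.natCast_ge
  have hL := h.log_ge
  have hκ := one_le_cutConst
  set κ := cutConst with hκdef
  set L := Real.log n with hLdef
  have hn0 : (0 : ℝ) < n := by linarith
  have hu0 : (0 : ℝ) ≤ u := Nat.cast_nonneg u
  have hL0 : 0 ≤ L := by linarith
  have h1 : Real.exp ((u : ℝ) ^ 2 * L / n) ≤ Real.exp 1 ^ u := by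
    rw [← Real.exp_nat_mul, Real.exp_le_exp, div_le_iff₀ hn0]
    have : (u : ℝ) * L ≤ n := by nlinarith [mul_nonneg hu0 hL0]
    nlinarith
  set β := κ * u * L / n with hβ
  have hβ0 : 0 ≤ β := by positivity
  have hβ1 : β ≤ 1 / 2 := by
    rw [hβ, div_le_iff₀ hn0]; linarith
  -- Because j ≥ 1, two factors β can be set aside, which supply 1/n²; the others decay
  -- geometrically in j.
  have h2 : β ^ (j + 1) ≤ β ^ 2 * (2 * (1 / 2) ^ j) := by
    obtain ⟨i, rfl⟩ : ∃ i, j = i + 1 := ⟨j - 1, by omega⟩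
    have : β ^ (i + 1 + 1) = β ^ 2 * β ^ i := by ring
    rw [this]
    refine mul_le_mul_of_nonneg_left ?_ (by positivity)
    calc β ^ i ≤ (1 / 2) ^ i := by gcongr
      _ = 2 * (1 / 2) ^ (i + 1) := by rw [pow_succ]; ring
  have h3 : (u : ℝ) ^ 2 ≤ 4 ^ u := by
    have : (u : ℝ) ≤ 2 ^ u := by exact_mod_cast Nat.lt_two_pow_self.le
    calc (u : ℝ) ^ 2 ≤ (2 ^ u) ^ 2 := by gcongr
      _ = 4 ^ u := by rw [← pow_mul, mul_comm, pow_mul]; norm_num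
  have h4 : β ^ 2 ≤ 4 ^ u * (κ ^ 2 * L ^ 2 / n ^ 2) := by
    calc β ^ 2 = (u : ℝ) ^ 2 * (κ ^ 2 * L ^ 2 / n ^ 2) := by rw [hβ]; ring
      _ ≤ _ := by gcongr
  calc (Real.exp 5 * √L) ^ u / u.factorial * Real.exp ((u : ℝ) ^ 2 * L / n) * β ^ (j + 1)
      ≤ (Real.exp 5 * √L) ^ u / u.factorial * Real.exp 1 ^ u *
        (4 ^ u * (κ ^ 2 * L ^ 2 / n ^ 2) * (2 * (1 / 2) ^ j)) := by
        gcongr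
        exact h2.trans (by gcongr)
    _ = (4 * (Real.exp 5 * Real.exp 1) * √L) ^ u / u.factorial *
      (2 * κ ^ 2 * L ^ 2 / n ^ 2 * (1 / 2) ^ j) := by
        simp only [mul_pow]; ring
    _ = _ := by rw [← Real.exp_add]; norm_num

/-- Large vertex sets in the union bound over large colour sets. -/
lemma large_term_large_cut {n j u : ℕ} (h : LargeParam n) (hj : j ≤ sizeThreshold n)
    (hu1 : 1 ≤ u) (hu2 : 2 * u ≤ n) (hu : (n : ℝ) < 2 * cutConst * u * Real.log n)
    (hE2 : 2 * cutConst * Real.exp 6 * Real.log n ^ 2 ≤ Real.exp (1 / 4 * Real.log n))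
    (hE3 : cutConst * √(Real.log n) ^ 2 ≤ Real.exp (1 / (32 * cutConst) * √(Real.log n))) :
    (Real.exp 5 * √(Real.log n)) ^ u / u.factorial * Real.exp ((u : ℝ) ^ 2 * Real.log n / n) *
      (cutConst * u * Real.log n / n) ^ (j + 1) ≤ Real.exp (-(n / (16 * cutConst))) := by
  have hn := h.natCast_ge
  have hL := h.log_ge
  have hLn := h.log_le
  have hκ := one_le_cutConst
  have hnexp := h.exp_log_eq
  have hjs : (j : ℝ) ≤ n / √(Real.log n) :=
    le_trans (by exact_mod_cast hj) (sizeThreshold_le_div_sqrt n)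
  have hs10 := h.ten_le_sqrt
  set κ := cutConst with hκdef
  set L := Real.log n with hLdef
  have hsq : √L ^ 2 = L := Real.sq_sqrt (by linarith)
  have hn0 : (0 : ℝ) < n := by linarith
  have hu1' : (1 : ℝ) ≤ u := by exact_mod_cast hu1
  have hu2' : 2 * (u : ℝ) ≤ n := by exact_mod_cast hu2
  have hu0 : (0 : ℝ) < u := by linarith
  have hsL : √L ≤ L := by nlinarith
  have hfact : 1 / (u.factorial : ℝ) ≤ (Real.exp 1 / u) ^ u := by
    have h2 : (u : ℝ) ^ u / u.factorial ≤ Real.exp u := Real.pow_div_factorial_le_exp u hu0.le u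
    have hf : (0 : ℝ) < u.factorial := by positivity
    rw [div_le_iff₀ hf] at h2
    rw [div_pow, ← Real.exp_nat_mul, mul_one, div_le_div_iff₀ hf (by positivity)]
    linarith
  have hexp : Real.exp ((u : ℝ) ^ 2 * L / n) ≤ Real.exp (L / 2) ^ u := by
    rw [← Real.exp_nat_mul, Real.exp_le_exp, div_le_iff₀ hn0]
    have : (u : ℝ) * L * (2 * u) ≤ u * L * n := by gcongr
    nlinarith
  -- The factor 1/u from the factorial is below 2κL/n, which outweighs e^(L/2) = √n; the remaining
  -- powers of L are covered by n^(1/4).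
  have hbase : Real.exp 5 * √L * (Real.exp 1 / u) * Real.exp (L / 2) ≤ Real.exp (-(L / 4)) := by
    have h1 : 1 / (u : ℝ) ≤ 2 * κ * L / n := by
      rw [div_le_div_iff₀ hu0 hn0]; linarith
    have h2 : Real.exp (L / 2) * (1 / n) = Real.exp (-(L / 2)) := by
      rw [← hnexp, one_div, ← Real.exp_neg, ← Real.exp_add]; congr 1; ring
    calc Real.exp 5 * √L * (Real.exp 1 / u) * Real.exp (L / 2)
        = (Real.exp 5 * Real.exp 1) * √L * Real.exp (L / 2) * (1 / u) := by ring
      _ ≤ (Real.exp 5 * Real.exp 1) * √L * Real.exp (L / 2) * (2 * κ * L / n) := by gcongr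
      _ = 2 * κ * Real.exp 6 * (√L * L) * (Real.exp (L / 2) * (1 / n)) := by
          rw [← Real.exp_add]; norm_num; ring
      _ ≤ 2 * κ * Real.exp 6 * L ^ 2 * (Real.exp (L / 2) * (1 / n)) := by
          rw [sq]; gcongr
      _ ≤ Real.exp (1 / 4 * L) * Real.exp (-(L / 2)) := by rw [h2]; gcongr
      _ = _ := by rw [← Real.exp_add]; congr 1; ring
  have hfirst : (Real.exp 5 * √L) ^ u / u.factorial * Real.exp ((u : ℝ) ^ 2 * L / n) ≤
      Real.exp (-(n / (8 * κ))) := by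
    calc (Real.exp 5 * √L) ^ u / u.factorial * Real.exp ((u : ℝ) ^ 2 * L / n)
        = (Real.exp 5 * √L) ^ u * (1 / u.factorial) * Real.exp ((u : ℝ) ^ 2 * L / n) := by ring
      _ ≤ (Real.exp 5 * √L) ^ u * (Real.exp 1 / u) ^ u * Real.exp (L / 2) ^ u := by gcongr
      _ = (Real.exp 5 * √L * (Real.exp 1 / u) * Real.exp (L / 2)) ^ u := by
          rw [← mul_pow, ← mul_pow]
      _ ≤ Real.exp (-(L / 4)) ^ u := by gcongr
      _ ≤ _ := by
          rw [← Real.exp_nat_mul, Real.exp_le_exp, mul_neg, neg_le_neg_iff,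
            div_le_iff₀ (by positivity)]
          linarith
  -- The base is at most κL ≤ e^(√L/(32κ)), and (j + 1)√L ≤ 2n, so this gives back only half of the
  -- exponent gained in `hfirst`.
  have hsecond : (κ * u * L / n) ^ (j + 1) ≤ Real.exp (n / (16 * κ)) := by
    have h1 : κ * u * L / n ≤ κ * √L ^ 2 := by
      rw [hsq, div_le_iff₀ hn0]
      have : κ * L * u ≤ κ * L * n := by gcongr; linarith
      linarith
    calc (κ * u * L / n) ^ (j + 1) ≤ (Real.exp (1 / (32 * κ) * √L)) ^ (j + 1) := by
          gcongr; exact h1.trans hE3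
      _ ≤ _ := by
          rw [← Real.exp_nat_mul, Real.exp_le_exp]
          have h2 : ((j + 1 : ℕ) : ℝ) * √L ≤ 2 * n := by
            push_cast
            have : (j : ℝ) * √L ≤ n := by rwa [le_div_iff₀ (by linarith)] at hjs
            linarith
          calc ((j + 1 : ℕ) : ℝ) * (1 / (32 * κ) * √L)
              = (1 / (32 * κ)) * (((j + 1 : ℕ) : ℝ) * √L) := by ring
            _ ≤ (1 / (32 * κ)) * (2 * n) := by gcongr
            _ = _ := by field_simp; norm_num
  calc _ ≤ Real.exp (-(n / (8 * κ))) * Real.exp (n / (16 * κ)) := by gcongr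
    _ = _ := by
        rw [← Real.exp_add]; congr 1; field_simp; norm_num

lemma tendsto_sq_mul_exp_neg {c : ℝ} (hc : 0 < c) :
    Tendsto (fun n : ℕ => (n : ℝ) ^ 2 * Real.exp (-(n / c))) atTop (𝓝 0) := by
  have h1 : Tendsto (fun n : ℕ => (n : ℝ) / c) atTop atTop :=
    tendsto_natCast_atTop_atTop.atTop_div_const hc
  have h2 := ((Real.tendsto_pow_mul_exp_neg_atTop_nhds_zero 2).comp h1).const_mul (c ^ 2)
  rw [mul_zero] at h2
  refine h2.congr fun n => ?_
  simp only [Function.comp]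
  field_simp

/-- Small cuts sum to at most 2 c e^a, where c has order (log n)²/n² and e^a ≤ n because a is a
constant times √(log n). Large cuts contribute at most n² terms, each exponentially small in n. -/
theorem tendsto_largeColourSetBad {k : ℕ} (hk : 2 ≤ k) :
    Tendsto (fun n => (processLaw n k).real
      (LargeColourSetBad n k (earlyTime n) (lateTime n) (sizeThreshold n))) atTop (𝓝 0) := by
  have hκ := one_le_cutConst
  have hlim : Tendsto (fun n : ℕ => 1 / Real.log n +
      (n : ℝ) ^ 2 * Real.exp (-(n / (16 * cutConst)))) atTop (𝓝 0) := by
    have h1 : Tendsto (fun n : ℕ => 1 / Real.log n) atTop (𝓝 0) :=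
      tendsto_const_nhds.div_atTop tendsto_log_natCast
    simpa using h1.add (tendsto_sq_mul_exp_neg (by positivity : 0 < 16 * cutConst))
  have hsqrt : Tendsto (fun n : ℕ => √(Real.log n)) atTop atTop :=
    Real.tendsto_sqrt_atTop.comp tendsto_log_natCast
  have hE3ev : ∀ᶠ n : ℕ in atTop,
      cutConst * √(Real.log n) ^ 2 ≤ Real.exp (1 / (32 * cutConst) * √(Real.log n)) := by
    have h := (isLittleO_pow_exp_pos_mul_atTop 2
      (by positivity : 0 < 1 / (32 * cutConst))).bound (inv_pos.2 (by linarith : 0 < cutConst))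
    filter_upwards [hsqrt.eventually h] with n hn
    rw [Real.norm_eq_abs, Real.norm_eq_abs, abs_of_pos (Real.exp_pos _), ← div_eq_inv_mul,
      le_div_iff₀ (by linarith), abs_of_nonneg (by positivity)] at hn
    linarith
  refine squeeze_zero' (Eventually.of_forall fun n => measureReal_nonneg) ?_ hlim
  filter_upwards [eventually_largeParam, eventually_ge_atTop (k + 1),
    eventually_le_log ((4 * Real.exp 6) ^ 2),
    eventually_mul_log_pow_le (2 * cutConst * Real.exp 6) 2 (by norm_num : (0 : ℝ) < 1 / 4),
    eventually_mul_log_pow_le_natCast (4 * cutConst ^ 2) 3, hE3ev] with n h hnk hE1 hE2 hE4 hE3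
  have hkn : k ≤ n - 1 := by omega
  have hn := h.natCast_ge
  have hL := h.log_ge
  have hsize : sizeThreshold n + 1 ≤ n := by
    have : (sizeThreshold n : ℝ) + 1 ≤ n := by linarith [h.sizeThreshold_le_div]
    exact_mod_cast this
  have hnexp := h.exp_log_eq
  have hlate := h.late_div_le
  have hn0 : (0 : ℝ) < n := by linarith
  refine (largeColourSetBad_le hk hkn h.size_le_early (by omega) h.earlyTime_le_choose
    h.lateTime_le_choose (fun j u => (u : ℝ) * (n - u) *
      (Real.log n - Real.log (Real.log n) / 2) / n - 5 * u - (j + 1 : ℕ)) ?_).trans ?_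
  · intro j hj u hu z hz
    rw [mem_range] at hj
    rw [mem_Icc] at hu
    exact large_exponent h (by omega) hu.1 (by omega) hz
  set L := Real.log n with hLdef
  set a := 4 * Real.exp 6 * √L with ha
  set c := 2 * cutConst ^ 2 * L ^ 2 / n ^ 2 with hc
  set ε := Real.exp (-(n / (16 * cutConst))) with hε
  have ha0 : 0 ≤ a := by positivity
  have hc0 : 0 ≤ c := by positivity
  have hterm : ∀ j ∈ range (sizeThreshold n + 1), ∀ u ∈ Icc 1 (n / 2),
      ((n - 1).choose (n - 1 - j) : ℝ) * ((n.choose u : ℝ) *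
        (((u * (n - u)).choose (j + 1) : ℝ) *
        (((lateTime n : ℝ) / (n.choose 2 : ℕ)) ^ (j + 1) *
          (((j : ℝ) / (n - 1 : ℕ)) ^ 2) ^ (j + 1) *
          Real.exp (-((u : ℝ) * (n - u) * (L - Real.log L / 2) / n - 5 * u - (j + 1 : ℕ)))))) ≤
      a ^ u / u.factorial * (c * (1 / 2) ^ j) + ε := by
    intro j hj u hu
    rw [mem_range] at hj
    rw [mem_Icc] at hu
    -- For j = 0 the edge of `X` would have no colour at all: the term vanishes through the factor 0
    -- of the colour probability.
    rcases Nat.eq_zero_or_pos j with rfl | hj1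
    · have : (((0 : ℕ) : ℝ) / (n - 1 : ℕ)) ^ 2 = 0 := by simp
      rw [this, zero_pow (by omega)]
      simp only [mul_zero, zero_mul]
      positivity
    have hy : (j : ℝ) / (n - 1 : ℕ) ≤ 2 * j / n := by
      rw [h.cast_pred, div_le_div_iff₀ (by linarith) hn0]
      have : (0 : ℝ) ≤ j := Nat.cast_nonneg j
      nlinarith
    refine (large_term_le hj1 (by omega) (by linarith : 0 ≤ L) (by positivity) hlate
      (by positivity) hy).trans ?_
    have hg : -((u : ℝ) * (n - u) * (L - Real.log L / 2) / n - 5 * u - (j + 1 : ℕ)) -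
        (j + 1 : ℕ) = -((u : ℝ) * (n - u) * (L - Real.log L / 2) / n - 5 * u) := by ring
    rw [hg]
    have hβ0 : 0 ≤ 28 * Real.exp 1 ^ 3 * u * L / n := by
      have : 0 ≤ L := by linarith
      positivity
    refine (mul_le_mul_of_nonneg_right (large_vertex_factor_le h)
      (pow_nonneg hβ0 _)).trans ?_
    rcases le_or_gt (2 * cutConst * u * Real.log n) n with hcase | hcase
    · refine (large_term_small_cut h hj1 hcase).trans ?_
      exact le_add_of_nonneg_right (Real.exp_pos _).le
    · refine (large_term_large_cut h (by omega) hu.1 (by omega) hcase hE2 hE3).trans ?_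
      exact le_add_of_nonneg_left (by positivity)
  have hsum1 : ∑ u ∈ Icc 1 (n / 2), a ^ u / u.factorial ≤ Real.exp a := by
    refine le_trans (sum_le_sum_of_subset_of_nonneg (t := range (n / 2 + 1)) ?_
      fun _ _ _ => by positivity) (Real.sum_le_exp_of_nonneg ha0 _)
    intro u hu
    rw [mem_Icc] at hu
    rw [mem_range]; omega
  have hsum2 : ∑ j ∈ range (sizeThreshold n + 1), (1 / 2 : ℝ) ^ j ≤ 2 := by
    have h4 := mul_neg_geom_sum (1 / 2 : ℝ) (sizeThreshold n + 1)
    have h5 : (0 : ℝ) ≤ (1 / 2) ^ (sizeThreshold n + 1) := by positivity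
    linarith
  have hexpa : Real.exp a ≤ n := by
    rw [← hnexp, Real.exp_le_exp, ha]
    have h1 : 4 * Real.exp 6 ≤ √L := Real.le_sqrt_of_sq_le hE1
    calc 4 * Real.exp 6 * √L ≤ √L * √L := by gcongr
      _ = L := Real.mul_self_sqrt (by linarith)
  calc _ ≤ ∑ j ∈ range (sizeThreshold n + 1), ∑ u ∈ Icc 1 (n / 2),
        (a ^ u / u.factorial * (c * (1 / 2) ^ j) + ε) := by
        refine sum_le_sum fun j hj => ?_
        rw [mul_sum]
        exact sum_le_sum fun u hu => hterm j hj u hu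
    _ = (∑ j ∈ range (sizeThreshold n + 1), (1 / 2 : ℝ) ^ j) * c *
          (∑ u ∈ Icc 1 (n / 2), a ^ u / u.factorial) +
        ((sizeThreshold n + 1 : ℕ) : ℝ) * ((n / 2 : ℕ) : ℝ) * ε := by
        simp only [sum_add_distrib, sum_const, card_range, nsmul_eq_mul, Nat.card_Icc,
          Nat.add_sub_cancel, ← sum_mul]
        rw [← mul_sum, ← mul_sum]
        ring
    _ ≤ 2 * c * n + (n : ℝ) * n * ε := by
        have h1 : ((sizeThreshold n + 1 : ℕ) : ℝ) ≤ n := by exact_mod_cast hsize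
        have h2 : ((n / 2 : ℕ) : ℝ) ≤ n := by exact_mod_cast Nat.div_le_self n 2
        have h3 := hsum1.trans hexpa
        have h0 : 0 ≤ ∑ u ∈ Icc 1 (n / 2), a ^ u / (u.factorial : ℝ) :=
          sum_nonneg fun _ _ => by positivity
        gcongr
    _ ≤ _ := by
        have h1 : 2 * c * n ≤ 1 / L := by
          rw [hc, le_div_iff₀ (by linarith)]
          calc 2 * (2 * cutConst ^ 2 * L ^ 2 / n ^ 2) * n * L = 4 * cutConst ^ 2 * L ^ 3 / n := by
                field_simp; ring
            _ ≤ 1 := by rw [div_le_one hn0]; exact hE4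
        rw [sq]
        linarith

end LargeColourSets

/-! ### From the good event to the hitting times -/

section HittingTimes

variable {n k : ℕ}

lemma edges_mono (ω : Outcome n k) {m m' : ℕ} (h : m ≤ m') : ω.edges m ⊆ ω.edges m' := by
  rintro e ⟨i, hi, rfl⟩
  exact ⟨i, hi.trans_le h, rfl⟩

lemma isConn_mono {ω : Outcome n k} {m m' : ℕ} (h : m ≤ m') (hm : ω.IsConn m) : ω.IsConn m' :=
  SimpleGraph.Connected.mono
    (SimpleGraph.fromEdgeSet_mono (Set.image_mono (edges_mono ω h))) hm

lemma allColours_mono {ω : Outcome n k} {m m' : ℕ} (h : m ≤ m') (hm : ω.AllColours m) :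
    ω.AllColours m' := fun w => by
  obtain ⟨e, he, hw⟩ := hm w
  exact ⟨e, edges_mono ω h he, hw⟩

lemma exists_isFirstTime {E : ℕ → Prop} {m : ℕ} (hm : m ≤ n.choose 2) (hE : E m) :
    ∃ t ≤ m, IsFirstTime n E t := by
  classical
  have hex : ∃ m, m ≤ n.choose 2 ∧ E m := ⟨m, hm, hE⟩
  exact ⟨Nat.find hex, Nat.find_min' hex ⟨hm, hE⟩, Nat.find_spec hex,
    fun t ht => Nat.find_min' hex ht⟩

/-- Outside the bad events the hitting times agree. -/
lemma hittingTimes_of_good {ω : Outcome n k} {m₀ m₁ b : ℕ} (hn : 2 ≤ n) (hb : 2 * b ≤ n)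
    (hm₁ : m₁ ≤ n.choose 2) (hearly : ¬ ω.IsConn m₀) (hconn : ω.IsConn m₁)
    (hall : ω.AllColours m₁) (hA : ω ∉ SmallColourSetBad n k m₀ m₁ b)
    (hB : ω ∉ BalancedCutBad n k m₀ b) (hC : ω ∉ LargeColourSetBad n k m₀ m₁ b) :
    ∃ mR mC mN : ℕ, IsFirstTime n ω.HasRainbowTree mR ∧ IsFirstTime n ω.IsConn mC ∧
      IsFirstTime n ω.AllColours mN ∧ mR = max mC mN := by
  obtain ⟨mC, hC1, hCfirst⟩ := exists_isFirstTime hm₁ hconn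
  obtain ⟨mN, hN1, hNfirst⟩ := exists_isFirstTime hm₁ hall
  have h0 : m₀ ≤ mC := by
    by_contra hlt
    exact hearly (isConn_mono (by omega) hCfirst.1.2)
  have htree : ω.HasRainbowTree (max mC mN) :=
    hasRainbowTree_of_good hn hb (h0.trans (le_max_left _ _)) (max_le hC1 hN1)
      (isConn_mono (le_max_left _ _) hCfirst.1.2)
      (allColours_mono (le_max_right _ _) hNfirst.1.2) hA hB hC
  refine ⟨max mC mN, mC, mN, ⟨⟨(max_le hC1 hN1).trans hm₁, htree⟩, ?_⟩, hCfirst, hNfirst, rfl⟩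
  rintro m ⟨hm, hR⟩
  exact max_le (hCfirst.2 ⟨hm, isConn_of_hasRainbowTree hR⟩)
    (hNfirst.2 ⟨hm, allColours_of_hasRainbowTree hR⟩)

/-- Events whose complements are eventually covered by events of vanishing probability have
probability tending to `1`. -/
lemma tendsto_measure_one_of_compl {Ω : ℕ → Type*} [∀ n, MeasurableSpace (Ω n)]
    {μ : ∀ n, Measure (Ω n)} {s t : ∀ n, Set (Ω n)}
    (hμ : ∀ᶠ n in atTop, IsProbabilityMeasure (μ n))
    (hst : ∀ᶠ n in atTop, (s n)ᶜ ⊆ t n)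
    (ht : Tendsto (fun n => (μ n).real (t n)) atTop (𝓝 0)) :
    Tendsto (fun n => μ n (s n)) atTop (𝓝 1) := by
  have h1 : Tendsto (fun n => ENNReal.ofReal (1 - (μ n).real (t n))) atTop (𝓝 1) := by
    have := ENNReal.tendsto_ofReal (ht.const_sub 1)
    simpa using this
  refine tendsto_of_tendsto_of_tendsto_of_le_of_le' h1 tendsto_const_nhds ?_ ?_
  · filter_upwards [hμ, hst] with n hn hsub
    refine ENNReal.ofReal_le_of_le_toReal ?_
    have h2 : (μ n).real Set.univ ≤ (μ n).real (s n) + (μ n).real (t n) := by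
      refine (measureReal_mono ?_).trans (measureReal_union_le _ _)
      rw [← Set.union_compl_self (s n)]
      exact Set.union_subset_union_right _ hsub
    rw [probReal_univ] at h2
    change 1 - (μ n).real (t n) ≤ (μ n).real (s n)
    linarith
  · filter_upwards [hμ] with n hn
    exact prob_le_one

end HittingTimes

theorem theorem1p1 (k : ℕ) (hk : 2 ≤ k) :
    Tendsto
      (fun n : ℕ => processLaw n k
        {ω : Outcome n k | ∃ mR mC mN : ℕ,
          IsFirstTime n ω.HasRainbowTree mR ∧
          IsFirstTime n ω.IsConn mC ∧
          IsFirstTime n ω.AllColours mN ∧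
          mR = max mC mN})
      atTop (𝓝 1) := by
  have hprob : ∀ᶠ n in atTop, IsProbabilityMeasure (processLaw n k) := by
    filter_upwards [eventually_ge_atTop (k + 1)] with n hn
    exact isProbabilityMeasure_processLaw (by omega)
  have hsum := ((((((tendsto_isConn_early k).add (tendsto_not_isConn_late k)).add
    (tendsto_not_allColours_late hk)).add (tendsto_smallColourSetBad hk)).add
    (tendsto_balancedCutBad hk)).add (tendsto_largeColourSetBad hk))
  simp only [add_zero] at hsum
  refine tendsto_measure_one_of_compl (t := fun n => {ω : Outcome n k | ω.IsConn (earlyTime n)} ∪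
    {ω | ¬ ω.IsConn (lateTime n)} ∪ {ω | ¬ ω.AllColours (lateTime n)} ∪
    SmallColourSetBad n k (earlyTime n) (lateTime n) (sizeThreshold n) ∪
    BalancedCutBad n k (earlyTime n) (sizeThreshold n) ∪
    LargeColourSetBad n k (earlyTime n) (lateTime n) (sizeThreshold n)) hprob ?_
    (squeeze_zero (fun n => measureReal_nonneg) (fun n => ?_) hsum)
  · filter_upwards [eventually_largeParam] with n h ω hω
    by_contra hbad
    simp only [Set.mem_union, Set.mem_ofPred_eq, not_or, not_not] at hbad
    obtain ⟨⟨⟨⟨⟨h1, h2⟩, h3⟩, h4⟩, h5⟩, h6⟩ := hbad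
    have hb : 2 * sizeThreshold n ≤ n := by
      have : 2 * (sizeThreshold n : ℝ) ≤ n := by
        linarith [h.sizeThreshold_le_div, h.natCast_ge]
      exact_mod_cast this
    exact hω (hittingTimes_of_good h.two_le hb h.lateTime_le_choose h1 h2 h3 h4 h5 h6)
  · refine (measureReal_union_le _ _).trans (add_le_add_left ?_ _)
    refine (measureReal_union_le _ _).trans (add_le_add_left ?_ _)
    refine (measureReal_union_le _ _).trans (add_le_add_left ?_ _)
    refine (measureReal_union_le _ _).trans (add_le_add_left ?_ _)
    exact measureReal_union_le _ _
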